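/- **Regexes.** Fix a finite alphabet $\Sigma$. Regexes are $R ::= \epsilon \mid a \mid RR \mid R|R \mid R^* \mid R\{k,\ell\}$ with $a\in\Sigma$, $k\in\mathbb N$, $\ell\in\mathbb N\cup\{\infty\}$, $0<\ell$, $k\le\ell$, with the usual languages; $\sharp R$ is the number of letter occurrences in $R$. $R$ has *flat counting* if no operator $\{k,\ell\}$ occurs inside the scope of another one. **Automata with registers.** Such an automaton has finitely many states and finitely many transitions $q\xrightarrow{a,\varphi,u}q'$ (guard $\varphi$ on the registers, update $u$ assigning a term to every register), initial configurations (state, memory), and a final condition for each state; runs and language are as usual. Its size is the number of states plus the sizes (numbers of symbols) of the guards and updates of all transitions. In a *counting automaton* (CA) registers hold natural numbers, terms are built from $0,1$, registers and $+1$, and guards are Boolean combinations of atoms $x<k$, $x\ge k$. In a *counting-set automaton* (CSA) registers hold sets of naturals; terms are finite unions of *r-terms*, built from $0$ (the set $\{0\}$), $1$ (the set $\{1\}$), registers, elementwise $+1$, and filters $\nabla_{p}$ keeping the elements that satisfy $p$; an atom holds of a set if some element satisfies it. A CSA is *non-replicating* if on no transition a register occurs in two r-terms of one assignment or in two different assignments.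 **The automaton $\mathrm{CA}(R)$.** Normalise $R$ without changing its language or $\sharp R$: replace $S\{k,\ell\}$ by $\epsilon$ if $S$ has no letters, replace $k$ by $0$ if $\epsilon\in L(S)$, and replace $S\{0,\infty\}$ by $S^*$. Number the letter occurrences. The states are these occurrences and an initial state $q_0$; the counters are the occurrences of counted sub-expressions, all initially $0$. With $\mathrm{first}$, $\mathrm{last}$ the sets of occurrences that can begin or end a word, the transitions (each reading the letter of its target) are: (i) $q_0\to q$ for $q\in\mathrm{first}(R)$, with a true guard, setting the counters whose expression contains $q$ to $1$ and the others to $0$; (ii) $p\to q$ for $p\in\mathrm{last}(S_1)$, $q\in\mathrm{first}(S_2)$, $S_1S_2$ a sub-expression, with guard $\bigwedge x_T\ge k_T$ over the counted $T$ with $p\in\mathrm{last}(T)$ and $q\notin T$, keeping the counters $x_T$ with $p,q\in T$, setting the other counters with $q\in\mathrm{first}(T)$ to $1$ and the rest to $0$; (iii) $p\to q$ for $p\in\mathrm{last}(S)$, $q\in\mathrm{first}(S)$, $S$ an iterated sub-expression ($T^*$ or $T\{k,\ell\}$), with guard $\bigwedge x_T\ge k_T$ over the counted proper sub-expressions $T$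 of $S$ with $p\in\mathrm{last}(T)$, and also $x_S<\ell_S$ if $S$ is counted, incrementing $x_S$ (if $S$ is counted), setting $x_T$ for counted proper sub-expressions $T$ of $S$ to $1$ if $q\in\mathrm{first}(T)$ and to $0$ otherwise, keeping other counters $x_T$ with $p,q\in T$, and setting the rest to $0$. The final condition of $q_0$ is true iff $\epsilon\in L(R)$, that of $q\in \mathrm{last}(R)$ is $\bigwedge x_T\ge k_T$ over the counted $T$ with $q\in\mathrm{last}(T)$, and that of other states is false. **Counter-subset transitions.** Let $x_q$ be a register for each counter $x$ and state $q$ of $\mathrm{CA}(R)$. The set version of a transition $q\xrightarrow{a,\varphi,u}r$ has guard $\varphi$ with each $x$ replaced by $x_q$, and assigns to $x_r$ the term $u(x)$ with each counter $y$ replaced by $\nabla_{p}(y_q)$ if $\varphi$ has the conjunct $p[y]$, and by $y_q$ otherwise; it assigns $\emptyset$ to the other registers. For a set $P$ of states and a letter $a$ let $J$ be the set of the set versions of $a$-transitions with source in $P$. For each minterm $\psi$ (satisfiable conjunction of all guards in $J$, each taken positively or negated) there is a transition $P\xrightarrow{a,\psi,u}P'$, where $P'$ consists of the targets, and $u$ unites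 the updates, of all members of $J$ whose guard is compatible with $\psi$. **Augmented determinization.** Its registers are $x_S$ with $S$ a set of states $q$ and marked states $q^+$ (a mark is a postponed increment). Its states are pairs $(P,\mathcal A)$ of a set of states of $\mathrm{CA}(R)$ and a set of active registers. Write $t{\uparrow}$ for $\nabla_{x<\ell_x}(t)+1$. The initial state is $(\{q_0\},\{x_{\{q_0\}}\}_x)$, where the active registers hold $\{0\}$ and the others $\emptyset$. From a generated state $(P,\mathcal A)$ each counter-subset transition $P\xrightarrow{a,\psi,u}P'$ yields $(P,\mathcal A)\xrightarrow{a,\psi',u'}(P',\mathcal A')$ as follows. $\psi'$ replaces each atom $p[x_q]$ by $\bigvee_{x_S\in\mathcal A,\,q\in S}p[x_S]$. In $u$ each r-term $t[x_q]$ is replaced by all $t[x_S]$ with $x_S\in\mathcal A$, $q\in S$, and all $t[x_S]{\uparrow}$ with $x_S\in\mathcal A$, $q^+\in S$ (constants stay); if an r-term $t{\uparrow}{\uparrow}$ arises, the whole construction aborts. Then every increment $x_S{\uparrow}$ for which $x_S$ is also an r-term of the update is postponed: it is removed from the assignment to $x_q$, and $x_S$ is added to the assignment to $x_{q^+}$.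 Finally, for each counter $x$ and each r-term $t$ assigned to some $x_{\mathfrak q}$ ($\mathfrak q$ a marked or unmarked state), $t$ is put into the assignment to $x_S$, where $S$ is the set of all $\mathfrak q$ such that $t$ is assigned to $x_{\mathfrak q}$; $\mathcal A'$ is the set of these $x_S$, and other registers get $\emptyset$. The final condition of $(P,\mathcal A)$ is the disjunction over $q\in P$ of the final conditions of $q$ in $\mathrm{CA}(R)$, with $x$ replaced by $x_q$ and then rewritten like $\psi'$. If the construction does not abort, let $\mathcal C(R)$ be the resulting CSA. **Simulation.** A set of numbers is stored as an offset list: an offset and a sorted doubly linked list with access to both ends. For each letter, all transitions from the current state on this letter are searched until one with a true guard is found, evaluating guards symbol by symbol; an atom is tested on the least or the greatest element. Then the update is evaluated register by register: r-terms are evaluated in situ (increment: add one to the offset; filter: remove items at one end one by one; constant: a fresh list), and the results are united by merging the list with the smaller maximum into the other one by sorted merging from the front, until the former is exhausted. At the end of the word the final condition is evaluated. Time is the number of elementary steps: symbols of guards and terms, transitions and registers visited, list items visited, and registers initialised. **Theorem.** For every finite alphabet $\Sigma$ there is a constant $C$ such that for every regex $R$ over $\Sigma$ with flat counting for which the augmented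 determinization does not abort, with $m=\sharp R$: 1. $\mathcal C(R)$ is non-replicating; 2. if $m\ge1$, the size of $\mathcal C(R)$ is at most $C\cdot 2^{2^m}\cdot m$; 3. $L(\mathcal C(R))=L(\mathrm{CA}(R))$; 4. $\mathcal C(R)$ has exactly one initial configuration, and for every word $w$ the simulation started there correctly decides whether $w\in L(\mathcal C(R))$; if $m\ge 1$ and $n=|w|\ge1$, it takes at most $C\cdot 2^{2m}\cdot m\cdot n$ steps. In particular, the bounds do not depend on the counter bounds $k,\ell$ occurring in $R$. -/

import Mathlib

/-! Regexes with counting, counting automata, counting-set automata, the augmented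
determinization (counter sharing and increment postponing), and the offset-list simulation. -/

namespace CountReg

/-! ### Regular expressions with counting -/

/-- Regexes with counting; `count r lo hi` is `r{lo,hi}`, with `0 < hi` and `lo ≤ hi ≤ ∞`. -/
inductive Regex (β : Type) : Type where
  | eps : Regex β
  | char (b : β) : Regex β
  | cat (r s : Regex β) : Regex β
  | alt (r s : Regex β) : Regex β
  | star (r : Regex β) : Regex β
  | count (r : Regex β) (lo : ℕ) (hi : ℕ∞) (hpos : 0 < hi) (hle : (lo : ℕ∞) ≤ hi) : Regex β
  deriving DecidableEq

namespace Regex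

variable {β : Type}

/-- The language of a regex. -/
def lang : Regex β → Language β
  | eps => 1
  | char b => {[b]}
  | cat r s => r.lang * s.lang
  | alt r s => r.lang + s.lang
  | star r => KStar.kstar r.lang
  | count r lo hi _ _ => {w | ∃ i : ℕ, lo ≤ i ∧ (i : ℕ∞) ≤ hi ∧ w ∈ r.lang ^ i}

/-- `♯R`, the number of character occurrences. -/
def chars : Regex β → ℕ
  | eps => 0
  | char _ => 1
  | cat r s => r.chars + s.chars
  | alt r s => r.chars + s.chars
  | star r => r.chars
  | count r _ _ _ _ => r.chars

/-- No counting operator occurs. -/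
def NoCount : Regex β → Prop
  | eps => True
  | char _ => True
  | cat r s => r.NoCount ∧ s.NoCount
  | alt r s => r.NoCount ∧ s.NoCount
  | star r => r.NoCount
  | count _ _ _ _ _ => False

/-- Flat counting: counting operators are not nested. -/
def Flat : Regex β → Prop
  | eps => True
  | char _ => True
  | cat r s => r.Flat ∧ s.Flat
  | alt r s => r.Flat ∧ s.Flat
  | star r => r.Flat
  | count r _ _ _ _ => r.NoCount

/-- Decides whether the empty word belongs to the language, see `nullable_iff`. -/
def nullable : Regex β → Bool
  | eps => true
  | char _ => false
  | cat r s => r.nullable && s.nullable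
  | alt r s => r.nullable || s.nullable
  | star _ => true
  | count r lo _ _ _ => decide (lo = 0) || r.nullable

theorem nil_mem_pow_of {L : Language β} (h : [] ∈ L) (i : ℕ) : [] ∈ L ^ i := by
  induction i with
  | zero => rw [pow_zero, Language.mem_one]
  | succ k ih => rw [pow_succ, Language.mem_mul]; exact ⟨[], ih, [], h, rfl⟩

theorem nullable_iff (r : Regex β) : r.nullable = true ↔ [] ∈ r.lang := by
  induction r with
  | eps => simp [nullable, lang, Language.mem_one]
  | char b =>
    simp only [nullable, lang, Bool.false_eq_true, false_iff]
    intro h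
    exact List.cons_ne_nil _ _ (Set.mem_singleton_iff.mp h).symm
  | cat r s ihr ihs =>
    simp only [nullable, lang, Bool.and_eq_true, ihr, ihs, Language.mem_mul]
    constructor
    · rintro ⟨h1, h2⟩
      exact ⟨[], h1, [], h2, rfl⟩
    · rintro ⟨a, ha, b, hb, hab⟩
      obtain ⟨rfl, rfl⟩ := List.append_eq_nil_iff.mp hab
      exact ⟨ha, hb⟩
  | alt r s ihr ihs => simp [nullable, lang, Language.mem_add, ihr, ihs]
  | star r _ => simp [nullable, lang, Language.nil_mem_kstar]
  | count r lo hi hpos hle ih =>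
    simp only [nullable, lang, Bool.or_eq_true, decide_eq_true_eq, ih]
    constructor
    · rintro (rfl | h)
      · exact ⟨0, le_refl _, by simp, by rw [pow_zero, Language.mem_one]⟩
      · exact ⟨lo, le_refl _, hle, nil_mem_pow_of h lo⟩
    · rintro ⟨i, h1, _, h3⟩
      rcases Nat.eq_zero_or_pos lo with h0 | h0
      · exact Or.inl h0
      · right
        obtain ⟨j, rfl⟩ : ∃ j, i = j + 1 := ⟨i - 1, by omega⟩
        rw [pow_succ, Language.mem_mul] at h3
        obtain ⟨a, _, b, hb, hab⟩ := h3
        obtain ⟨_, rfl⟩ := List.append_eq_nil_iff.mp hab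
        exact hb

/-- The normal form assumed by the translation to automata (same language, same `♯R`):
`S{m,n}` with `[] ∈ L(S)` has `m = 0`; `S{0,∞}` and `S*` are identified (no counter is needed);
and a counted expression without letters, whose language is `{ε}`, is `ε`. -/
def norm : Regex β → Regex β
  | eps => eps
  | char b => char b
  | cat r s => cat r.norm s.norm
  | alt r s => alt r.norm s.norm
  | star r => star r.norm
  | count r lo hi hpos hle =>
    if r.chars = 0 then eps
    else if r.nullable = true then
      (if hi = ⊤ then star r.norm else count r.norm 0 hi hpos (by simp))
    else if lo = 0 ∧ hi = ⊤ then star r.norm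
    else count r.norm lo hi hpos hle

/-- The marked regex: the letter occurrences are numbered from left to right, from `n` on. -/
def mark : Regex β → ℕ → Regex (β × ℕ)
  | eps, _ => eps
  | char b, n => char (b, n)
  | cat r s, n => cat (r.mark n) (s.mark (n + r.chars))
  | alt r s, n => alt (r.mark n) (s.mark (n + r.chars))
  | star r, n => star (r.mark n)
  | count r lo hi hpos hle, n => count (r.mark n) lo hi hpos hle

/-- The marked normal form of a regex. -/
def marked (r : Regex β) : Regex (β × ℕ) := r.norm.mark 0

/-- Is it of the form `S{m,n}`? -/
def isCount : Regex β → Bool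
  | count _ _ _ _ _ => true
  | _ => false

/-- Is it of the form `S*` or `S{m,n}`? -/
def isIter : Regex β → Bool
  | star _ => true
  | count _ _ _ _ _ => true
  | _ => false

/-- The lower bound of `S{m,n}`. -/
def lower : Regex β → ℕ
  | count _ lo _ _ _ => lo
  | _ => 0

/-- The upper bound of `S{m,n}`. -/
def upper : Regex β → ℕ∞
  | count _ _ hi _ _ => hi
  | _ => ⊤

variable [DecidableEq β]

/-- The sub-expressions, including the expression itself. -/
def subs : Regex β → Finset (Regex β)
  | eps => {eps}
  | char b => {char b}
  | cat r s => insert (cat r s) (r.subs ∪ s.subs)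
  | alt r s => insert (alt r s) (r.subs ∪ s.subs)
  | star r => insert (star r) r.subs
  | count r lo hi hpos hle => insert (count r lo hi hpos hle) r.subs

/-- The letters that occur. -/
def letters : Regex β → Finset β
  | eps => ∅
  | char b => {b}
  | cat r s => r.letters ∪ s.letters
  | alt r s => r.letters ∪ s.letters
  | star r => r.letters
  | count r _ _ _ _ => r.letters

/-- The letters that can start a word. -/
def first : Regex β → Finset β
  | eps => ∅
  | char b => {b}
  | cat r s => if r.nullable = true then r.first ∪ s.first else r.first
  | alt r s => r.first ∪ s.first
  | star r => r.first
  | count r _ _ _ _ => r.first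

/-- The letters that can end a word. -/
def last : Regex β → Finset β
  | eps => ∅
  | char b => {b}
  | cat r s => if s.nullable = true then r.last ∪ s.last else s.last
  | alt r s => r.last ∪ s.last
  | star r => r.last
  | count r _ _ _ _ => r.last

/-- Pairs `(p, q)` with `p ∈ last S₁` and `q ∈ first S₂` for a sub-expression `S₁S₂`. -/
def followCat : Regex β → Finset (β × β)
  | eps => ∅
  | char _ => ∅
  | cat r s => r.followCat ∪ s.followCat ∪ r.last ×ˢ s.first
  | alt r s => r.followCat ∪ s.followCat
  | star r => r.followCat
  | count r _ _ _ _ => r.followCat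

/-- The counted sub-expressions. -/
def counted (M : Regex β) : Finset (Regex β) := M.subs.filter fun s => s.isCount = true

/-- The iterated sub-expressions `S*` and `S{m,n}`. -/
def iterated (M : Regex β) : Finset (Regex β) := M.subs.filter fun s => s.isIter = true

/-- The letter occurrences of a marked regex, as a type. -/
def Pos (M : Regex β) : Type := {p : β // p ∈ M.letters}

/-- The counters of a marked regex, as a type. -/
def Ctr (M : Regex β) : Type := {s : Regex β // s ∈ M.counted}

instance (M : Regex β) : DecidableEq M.Pos :=
  inferInstanceAs (DecidableEq {p : β // p ∈ M.letters})

instance (M : Regex β) : Fintype M.Pos :=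
  inferInstanceAs (Fintype {p : β // p ∈ M.letters})

instance (M : Regex β) : DecidableEq M.Ctr :=
  inferInstanceAs (DecidableEq {s : Regex β // s ∈ M.counted})

instance (M : Regex β) : Fintype M.Ctr :=
  inferInstanceAs (Fintype {s : Regex β // s ∈ M.counted})

end Regex

/-! ### Automata with registers -/

/-- Boolean combinations of atoms. -/
inductive Form (A : Type) : Type where
  | tt : Form A
  | ff : Form A
  | atom (a : A) : Form A
  | neg (φ : Form A) : Form A
  | and (φ ψ : Form A) : Form A
  | or (φ ψ : Form A) : Form A
  deriving DecidableEq

namespace Form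

variable {A B : Type}

/-- Truth, given the truth of the atoms. -/
def Holds (v : A → Prop) : Form A → Prop
  | tt => True
  | ff => False
  | atom a => v a
  | neg φ => ¬ φ.Holds v
  | and φ ψ => φ.Holds v ∧ ψ.Holds v
  | or φ ψ => φ.Holds v ∨ ψ.Holds v

/-- The number of symbols. -/
def size : Form A → ℕ
  | tt => 1
  | ff => 1
  | atom _ => 1
  | neg φ => φ.size + 1
  | and φ ψ => φ.size + ψ.size + 1
  | or φ ψ => φ.size + ψ.size + 1

/-- Replace every atom by a formula. -/
def subst (f : A → Form B) : Form A → Form B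
  | tt => tt
  | ff => ff
  | atom a => f a
  | neg φ => neg (φ.subst f)
  | and φ ψ => and (φ.subst f) (ψ.subst f)
  | or φ ψ => or (φ.subst f) (ψ.subst f)

/-- The atoms, from left to right. -/
def atoms : Form A → List A
  | tt => []
  | ff => []
  | atom a => [a]
  | neg φ => φ.atoms
  | and φ ψ => φ.atoms ++ ψ.atoms
  | or φ ψ => φ.atoms ++ ψ.atoms

/-- Conjunction of a list. -/
def conj (l : List (Form A)) : Form A := l.foldr and tt

/-- Disjunction of a list. -/
def disj (l : List (Form A)) : Form A := l.foldr or ff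

end Form

/-- A language for operating registers in `X` with values in `D`: guards `G`, terms `T`, their
interpretation under a memory `X → D`, and their sizes. -/
structure RegLang (X G T D : Type) where
  sat : G → (X → D) → Prop
  eval : T → (X → D) → D
  guardSize : G → ℕ
  termSize : T → ℕ

/-- A transition from `src` to `tgt`. -/
structure Trans (α Q G U : Type) where
  src : Q
  letter : α
  guard : G
  update : U
  tgt : Q
  deriving DecidableEq

/-- Automata with registers. A configuration is a pair of a state and a memory. -/
structure RegAut (α X Q G T D : Type) where
  states : Finset Q
  trans : Finset (Trans α Q G (X → T))
  init : Set (Q × (X → D))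
  final : Q → G

namespace RegAut

variable {α X Q G T D : Type}

/-- `A` can move from the configuration `c` to `c'` under the letter `a`. -/
def Step (𝓛 : RegLang X G T D) (A : RegAut α X Q G T D) (c : Q × (X → D)) (a : α)
    (c' : Q × (X → D)) : Prop :=
  ∃ δ ∈ A.trans, δ.src = c.1 ∧ δ.letter = a ∧ 𝓛.sat δ.guard c.2 ∧
    c' = (δ.tgt, fun x => 𝓛.eval (δ.update x) c.2)

/-- `A` has a run over the word from the first to the second configuration. -/
inductive Run (𝓛 : RegLang X G T D) (A : RegAut α X Q G T D) :
    Q × (X → D) → List α → Q × (X → D) → Prop where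
  | nil (c : Q × (X → D)) : Run 𝓛 A c [] c
  | cons {c c' c'' : Q × (X → D)} {a : α} {w : List α} :
      Step 𝓛 A c a c' → Run 𝓛 A c' w c'' → Run 𝓛 A c (a :: w) c''

/-- The language of an automaton with registers. -/
def lang (𝓛 : RegLang X G T D) (A : RegAut α X Q G T D) : Language α :=
  {w | ∃ c ∈ A.init, ∃ c', Run 𝓛 A c w c' ∧ 𝓛.sat (A.final c'.1) c'.2}

/-- The number of states plus the sizes of the guards and updates of all transitions. -/
def size [Fintype X] (𝓛 : RegLang X G T D) (A : RegAut α X Q G T D) : ℕ :=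
  A.states.card +
    ∑ δ ∈ A.trans, (𝓛.guardSize δ.guard + ∑ x, 𝓛.termSize (δ.update x))

end RegAut

/-! ### Counting automata -/

/-- The predicates `x < k` and `x ≥ k` (`x < ∞` is true of every number). -/
inductive CPred : Type where
  | lt (k : ℕ∞) : CPred
  | ge (k : ℕ) : CPred
  deriving DecidableEq

/-- The standard interpretation over numbers. -/
def CPred.Holds : CPred → ℕ → Prop
  | lt k, n => (n : ℕ∞) < k
  | ge k, n => k ≤ n

/-- Terms of the counting language. -/
inductive CTerm (X : Type) : Type where
  | zero : CTerm X
  | one : CTerm X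
  | var (x : X) : CTerm X
  | succ (t : CTerm X) : CTerm X
  deriving DecidableEq

namespace CTerm

variable {X : Type}

def eval (m : X → ℕ) : CTerm X → ℕ
  | zero => 0
  | one => 1
  | var x => m x
  | succ t => t.eval m + 1

def size : CTerm X → ℕ
  | zero => 1
  | one => 1
  | var _ => 1
  | succ t => t.size + 1

end CTerm

/-- Guards: boolean combinations of atoms `p[x]`. -/
abbrev Guard (X : Type) : Type := Form (CPred × X)

/-- The counting language with its interpretation over `ℕ`. -/
def natLang (X : Type) : RegLang X (Guard X) (CTerm X) ℕ where
  sat φ m := φ.Holds fun c => c.1.Holds (m c.2)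
  eval t m := t.eval m
  guardSize := Form.size
  termSize := CTerm.size

/-- Counting automata with counters `X` and states `Q`. -/
abbrev CA (α X Q : Type) : Type := RegAut α X Q (Guard X) (CTerm X) ℕ

/-! ### Counting-set automata -/

/-- The r-terms of the counting-set language over registers `Y`. -/
inductive RTerm (Y : Type) : Type where
  | zero : RTerm Y
  | one : RTerm Y
  | var (y : Y) : RTerm Y
  | succ (t : RTerm Y) : RTerm Y
  | filt (p : CPred) (t : RTerm Y) : RTerm Y
  deriving DecidableEq

namespace RTerm

variable {Y Z : Type}

/-- `0`, `1` are `{0}`, `{1}`; increment acts elementwise; filters keep what satisfies `p`. -/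
def eval (s : Y → Set ℕ) : RTerm Y → Set ℕ
  | zero => {0}
  | one => {1}
  | var y => s y
  | succ t => (fun n => n + 1) '' t.eval s
  | filt p t => {n | n ∈ t.eval s ∧ p.Holds n}

def size : RTerm Y → ℕ
  | zero => 1
  | one => 1
  | var _ => 1
  | succ t => t.size + 1
  | filt _ t => t.size + 1

/-- The register of an r-term, if there is one. -/
def reg : RTerm Y → Option Y
  | zero => none
  | one => none
  | var y => some y
  | succ t => t.reg
  | filt _ t => t.reg

/-- Rename the register. -/
def map (f : Y → Z) : RTerm Y → RTerm Z
  | zero => zero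
  | one => one
  | var y => var (f y)
  | succ t => succ (t.map f)
  | filt p t => filt p (t.map f)

end RTerm

/-- The terms assigned to counting sets: unions `t₁ ∪ ⋯ ∪ tₙ` of r-terms, given by the set of
their r-terms (`∅` is the empty union). -/
abbrev SetTerm (Y : Type) : Type := Finset (RTerm Y)

/-- The counting-set language with its interpretation over sets of numbers: a set satisfies a
predicate if one of its elements does. -/
def setLang (Y : Type) : RegLang Y (Guard Y) (SetTerm Y) (Set ℕ) where
  sat φ s := φ.Holds fun c => ∃ n ∈ s c.2, c.1.Holds n
  eval T s := {n | ∃ t ∈ T, n ∈ t.eval s}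
  guardSize := Form.size
  termSize T := if T.card = 0 then 1 else ∑ t ∈ T, t.size + (T.card - 1)

/-- Counting-set automata with registers `Y` and states `Q`. -/
abbrev CSA (α Y Q : Type) : Type := RegAut α Y Q (Guard Y) (SetTerm Y) (Set ℕ)

/-- No transition has a register in two different r-terms of one assignment, or in the r-terms
of two different assignments. -/
def NonReplicating {α Y Q : Type} (A : CSA α Y Q) : Prop :=
  ∀ δ ∈ A.trans, ∀ (z x x' : Y) (t t' : RTerm Y), t ∈ δ.update x → t' ∈ δ.update x' →
    t.reg = some z → t'.reg = some z → x = x' ∧ t = t'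

/-! ### The counting automaton of a regex -/

namespace Regex

variable {α : Type} [DecidableEq α]

/-- Transition into the first letter. -/
def startTrans (M : Regex (α × ℕ)) (q : M.Pos) :
    Trans α (Option M.Pos) (Guard M.Ctr) (M.Ctr → CTerm M.Ctr) where
  src := none
  letter := q.1.1
  guard := .tt
  update T := if q.1 ∈ T.1.letters then .one else .zero
  tgt := some q

/-- Transition between letters that are adjacent by a concatenation: the counters of `p` that are
left are tested, those that are entered are set to `1`, the surrounding ones are kept. -/
noncomputable def catTrans (M : Regex (α × ℕ)) (p q : M.Pos) :
    Trans α (Option M.Pos) (Guard M.Ctr) (M.Ctr → CTerm M.Ctr) where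
  src := some p
  letter := q.1.1
  guard := Form.conj
    (((Finset.univ.filter fun T : M.Ctr => p.1 ∈ T.1.last ∧ q.1 ∉ T.1.letters).toList).map
      fun T => .atom (.ge T.1.lower, T))
  update T :=
    if p.1 ∈ T.1.letters ∧ q.1 ∈ T.1.letters then .var T
    else if q.1 ∈ T.1.first then .one
    else .zero
  tgt := some q

/-- Transition that starts a new iteration of the iterated sub-expression `S`: if `S` is a
counter, it is tested and incremented, the counters inside `S` are left and re-entered, the
surrounding ones are kept. -/
noncomputable def iterTrans (M S : Regex (α × ℕ)) (p q : M.Pos) :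
    Trans α (Option M.Pos) (Guard M.Ctr) (M.Ctr → CTerm M.Ctr) where
  src := some p
  letter := q.1.1
  guard := Form.conj
    ((if h : S ∈ M.counted then [.atom (.lt S.upper, (⟨S, h⟩ : M.Ctr))] else []) ++
    ((Finset.univ.filter fun T : M.Ctr => T.1 ∈ S.subs ∧ T.1 ≠ S ∧ p.1 ∈ T.1.last).toList).map
      fun T => .atom (.ge T.1.lower, T))
  update T :=
    if T.1 = S then .succ (.var T)
    else if T.1 ∈ S.subs then (if q.1 ∈ T.1.first then .one else .zero)
    else if p.1 ∈ T.1.letters ∧ q.1 ∈ T.1.letters then .var T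
    else .zero
  tgt := some q

/-- The counting automaton of a marked regex `M`: its states are an initial state `none` and the
letter occurrences, its counters the counted sub-expressions of `M`. -/
noncomputable def glushkov (M : Regex (α × ℕ)) : CA α M.Ctr (Option M.Pos) where
  states := Finset.univ
  trans :=
    (Finset.univ.filter fun q : M.Pos => q.1 ∈ M.first).image M.startTrans ∪
    (Finset.univ.filter fun e : M.Pos × M.Pos => (e.1.1, e.2.1) ∈ M.followCat).image
      (fun e => M.catTrans e.1 e.2) ∪
    M.iterated.biUnion fun S =>
      (Finset.univ.filter fun e : M.Pos × M.Pos => e.1.1 ∈ S.last ∧ e.2.1 ∈ S.first).image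
        fun e => M.iterTrans S e.1 e.2
  init := {(none, fun _ => 0)}
  final
    | none => if M.nullable = true then .tt else .ff
    | some p =>
      if p.1 ∈ M.last then
        Form.conj (((Finset.univ.filter fun T : M.Ctr => p.1 ∈ T.1.last).toList).map
          fun T => .atom (.ge T.1.lower, T))
      else .ff

/-- `CA(R)`. -/
noncomputable def ca (R : Regex α) : CA α R.marked.Ctr (Option R.marked.Pos) :=
  R.marked.glushkov

end Regex

/-! ### The counter-subset construction -/

section Subset

variable {α X Q : Type} [DecidableEq α] [DecidableEq X] [DecidableEq Q]
  [Fintype X] [Fintype Q]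

/-- Index the registers of a guard by a state: `p[x]` becomes `p[x_q]`. -/
def indexGuard (q : Q) (φ : Guard X) : Guard (X × Q) :=
  φ.subst fun c => .atom (c.1, (c.2, q))

/-- Index the registers of a term by a state, after filtering each register `y` by the predicate
on `y` in the guard `φ`, if there is one. -/
def filterTerm (φ : Guard X) (q : Q) : CTerm X → RTerm (X × Q)
  | .zero => .zero
  | .one => .one
  | .var y => (φ.atoms.filter fun c => c.2 = y).foldr (fun c t => .filt c.1 t) (.var (y, q))
  | .succ t => .succ (filterTerm φ q t)

/-- The set version of a transition. -/
def setVersion (δ : Trans α Q (Guard X) (X → CTerm X)) :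
    Trans α Q (Guard (X × Q)) (X × Q → SetTerm (X × Q)) where
  src := δ.src
  letter := δ.letter
  guard := indexGuard δ.src δ.guard
  update y := if y.2 = δ.tgt then {filterTerm δ.guard δ.src (δ.update y.1)} else ∅
  tgt := δ.tgt

/-- The constituent `a`-transitions for a set of states `P`. -/
def constituents (A : CA α X Q) (P : Finset Q) (a : α) :
    Finset (Trans α Q (Guard (X × Q)) (X × Q → SetTerm (X × Q))) :=
  (A.trans.filter fun δ => δ.src ∈ P ∧ δ.letter = a).image setVersion

/-- Satisfiability in the counting-set interpretation. -/
def Satisfiable {Y : Type} (φ : Guard Y) : Prop := ∃ s : Y → Set ℕ, (setLang Y).sat φ s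

/-- The minterms of a set `Ψ` of guards: the satisfiable conjunctions of all members of `Ψ`,
each taken positively or negated. -/
noncomputable def minterms {Y : Type} [DecidableEq Y] (Ψ : Finset (Guard Y)) :
    Finset (Guard Y) :=
  open Classical in
  (Ψ.powerset.image fun K =>
    Form.conj (Ψ.toList.map fun φ => if φ ∈ K then φ else .neg φ)).filter Satisfiable

/-- The `a`-transitions of the counter-subset construction from the set of states `P`: one for
every minterm `ψ` of the constituent guards, uniting the constituents compatible with `ψ`. -/
noncomputable def subsetTrans (A : CA α X Q) (P : Finset Q) (a : α) :
    Finset (Trans α (Finset Q) (Guard (X × Q)) (X × Q → SetTerm (X × Q))) :=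
  open Classical in
  (minterms ((constituents A P a).image fun δ => δ.guard)).image fun ψ =>
    let K := (constituents A P a).filter fun δ => Satisfiable (.and ψ δ.guard)
    { src := P
      letter := a
      guard := ψ
      update := fun y => K.biUnion fun δ => δ.update y
      tgt := K.image fun δ => δ.tgt }

/-- The final condition of the set of states `P` in the counter-subset construction. -/
noncomputable def subsetFinal (A : CA α X Q) (P : Finset Q) : Guard (X × Q) :=
  Form.disj (P.toList.map fun q => indexGuard q (A.final q))

end Subset

/-! ### The augmented determinization -/

section Augmented

variable {α X Q : Type} [DecidableEq α] [DecidableEq X] [DecidableEq Q]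
  [Fintype X] [Fintype Q]

/-- Possibly marked states: `(q, true)` is `q⁺`, a state with a postponed increment. -/
abbrev MState (Q : Type) : Type := Q × Bool

/-- The shared counters `x_S`, where `S` is a set of possibly marked states. -/
abbrev Shared (X Q : Type) : Type := X × Finset (MState Q)

/-- States: a set of states of the counting automaton and a set of active shared counters. -/
abbrev AugState (X Q : Type) : Type := Finset Q × Finset (Shared X Q)

instance : DecidableEq (Shared X Q) := fun a b => instDecidableEqProd a b

instance : DecidableEq (AugState X Q) := fun a b => instDecidableEqProd a b

/-- The term `t + 1` for `t` filtered by `x < max x`. -/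
def finc (hi : X → ℕ∞) (x : X) (t : RTerm (Shared X Q)) : RTerm (Shared X Q) :=
  .succ (.filt (.lt (hi x)) t)

/-- `p[x_q]` expressed by the active shared counters. -/
noncomputable def shareAtom (Act : Finset (Shared X Q)) (c : CPred × (X × Q)) :
    Guard (Shared X Q) :=
  Form.disj (((Act.filter fun z => z.1 = c.2.1 ∧ (c.2.2, false) ∈ z.2).toList).map
    fun z => .atom (c.1, z))

/-- An r-term `t[x_q]` expressed by the active shared counters: all `t[x_S]` with `q ∈ S`, and
all increments of `t[x_S]` with `q⁺ ∈ S`. Constants stay as they are (`map` then only changes the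
type). -/
def shareTerm (hi : X → ℕ∞) (Act : Finset (Shared X Q)) (t : RTerm (X × Q)) :
    SetTerm (Shared X Q) :=
  match t.reg with
  | none => {t.map fun y => (y.1, ∅)}
  | some (x, q) =>
    ((Act.filter fun z => z.1 = x ∧ (q, false) ∈ z.2).image fun z => t.map fun _ => z) ∪
    ((Act.filter fun z => z.1 = x ∧ (q, true) ∈ z.2).image fun z => finc hi x (t.map fun _ => z))

/-- The first step of the augmented update: r-terms expressed by shared counters. -/
def sharedUpdate (hi : X → ℕ∞) (Act : Finset (Shared X Q))
    (u : X × Q → SetTerm (X × Q)) (y : X × Q) : SetTerm (Shared X Q) :=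
  (u y).biUnion (shareTerm hi Act)

/-- Some r-term is a double increment: the replication cannot be resolved. -/
def DoubleInc (hi : X → ℕ∞) (v : X × Q → SetTerm (Shared X Q)) : Prop :=
  ∃ (y : X × Q) (x : X) (t : RTerm (Shared X Q)), finc hi x (finc hi x t) ∈ v y

/-- The conflicting increments: increments of a counter `x_S` that is itself an r-term. -/
def conflict (hi : X → ℕ∞) (v : X × Q → SetTerm (Shared X Q)) : SetTerm (Shared X Q) :=
  (Finset.univ.filter fun z : Shared X Q =>
    finc hi z.1 (.var z) ∈ Finset.univ.biUnion v ∧ RTerm.var z ∈ Finset.univ.biUnion v).image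
      fun z => finc hi z.1 (.var z)

/-- The second step: conflicting increments are postponed. -/
def postponedUpdate (hi : X → ℕ∞) (v : X × Q → SetTerm (Shared X Q)) (x : X)
    (q : MState Q) : SetTerm (Shared X Q) :=
  if q.2 = true then
    (Finset.univ.filter fun z : Shared X Q =>
      finc hi z.1 (.var z) ∈ v (x, q.1) ∩ conflict hi v).image .var
  else v (x, q.1) \ conflict hi v

/-- The l-values of an r-term among the `x_q`, for a fixed `x`. (The constants `0` and `1` are
grouped for each counter `x` separately.) -/
def lval (up : X → MState Q → SetTerm (Shared X Q)) (x : X) (t : RTerm (Shared X Q)) :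
    Finset (MState Q) :=
  Finset.univ.filter fun q => t ∈ up x q

/-- The third step: `x_S` is assigned the r-terms whose set of l-values is `S`. -/
def groupedUpdate (up : X → MState Q → SetTerm (Shared X Q)) (z : Shared X Q) :
    SetTerm (Shared X Q) :=
  (Finset.univ.biUnion (up z.1)).filter fun t => lval up z.1 t = z.2

/-- The counters that are active after the third step. -/
def nextActive (up : X → MState Q → SetTerm (Shared X Q)) : Finset (Shared X Q) :=
  Finset.univ.biUnion fun x =>
    (Finset.univ.biUnion (up x)).image fun t => (x, lval up x t)

/-- The augmented version, from the state `(δ.src, Act)`, of a transition `δ` of the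
counter-subset construction. -/
noncomputable def augTrans (hi : X → ℕ∞) (Act : Finset (Shared X Q))
    (δ : Trans α (Finset Q) (Guard (X × Q)) (X × Q → SetTerm (X × Q))) :
    Trans α (AugState X Q) (Guard (Shared X Q)) (Shared X Q → SetTerm (Shared X Q)) :=
  let up := postponedUpdate hi (sharedUpdate hi Act δ.update)
  { src := (δ.src, Act)
    letter := δ.letter
    guard := δ.guard.subst (shareAtom Act)
    update := groupedUpdate up
    tgt := (δ.tgt, nextActive up) }

/-- The active counters of the initial state. -/
def augInit (X : Type) {Q : Type} [DecidableEq X] [DecidableEq Q] [Fintype X] (q₀ : Q) :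
    Finset (Shared X Q) :=
  Finset.univ.image fun x => (x, {(q₀, false)})

/-- The states that the augmented determinization generates. -/
inductive AugReach (A : CA α X Q) (hi : X → ℕ∞) (q₀ : Q) : AugState X Q → Prop where
  | init : AugReach A hi q₀ ({q₀}, augInit X q₀)
  | step {P : Finset Q} {Act : Finset (Shared X Q)} {a : α}
      {δ : Trans α (Finset Q) (Guard (X × Q)) (X × Q → SetTerm (X × Q))} :
      AugReach A hi q₀ (P, Act) → δ ∈ subsetTrans A P a →
      AugReach A hi q₀ (augTrans hi Act δ).tgt

/-- The construction meets an irresolvable counter replication. -/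
def Aborts (A : CA α X Q) (hi : X → ℕ∞) (q₀ : Q) : Prop :=
  ∃ (P : Finset Q) (Act : Finset (Shared X Q)), AugReach A hi q₀ (P, Act) ∧
    ∃ a, ∃ δ ∈ subsetTrans A P a, DoubleInc hi (sharedUpdate hi Act δ.update)

/-- The augmented determinization of a counting automaton with initial state `q₀`, where all
counters are `0`, and with upper bounds `hi`; `none` if the construction aborts. -/
noncomputable def augDet [Fintype α] (A : CA α X Q) (hi : X → ℕ∞) (q₀ : Q) :
    Option (CSA α (Shared X Q) (AugState X Q)) :=
  open Classical in
  if Aborts A hi q₀ then none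
  else some
    { states := Finset.univ.filter (AugReach A hi q₀)
      trans := (Finset.univ.filter (AugReach A hi q₀)).biUnion fun s =>
        Finset.univ.biUnion fun a => (subsetTrans A s.1 a).image (augTrans hi s.2)
      init := {((({q₀}, augInit X q₀) : AugState X Q),
        fun z => if z ∈ augInit X q₀ then {0} else ∅)}
      final := fun s => (subsetFinal A s.1).subst (shareAtom s.2) }

end Augmented

/-- The counting-set automaton that the augmented determinization produces from `CA(R)`. -/
noncomputable def Regex.csa {α : Type} [DecidableEq α] [Fintype α] (R : Regex α) :
    Option (CSA α (Shared R.marked.Ctr (Option R.marked.Pos))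
      (AugState R.marked.Ctr (Option R.marked.Pos))) :=
  augDet R.ca (fun T => T.1.upper) none

/-! ### Simulation of counting-set automata with offset lists -/

/-- A result together with the number of elementary steps spent on it. -/
structure Timed (β : Type) : Type where
  val : β
  time : ℕ

instance : Monad Timed where
  pure b := ⟨b, 0⟩
  bind m f := ⟨(f m.val).val, m.time + (f m.val).time⟩

/-- Spend `k` elementary steps. -/
def spend (k : ℕ) : Timed Unit := ⟨(), k⟩

/-- An offset list: an offset and a sorted doubly-linked list with access to both ends. -/
structure OList : Type where
  off : ℕ
  items : List ℤ

namespace OList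

/-- The set that is represented. -/
def toSet (l : OList) : Set ℕ := {n | (n : ℤ) - l.off ∈ l.items}

def empty : OList := ⟨0, []⟩

/-- The offset list of a set that is empty or a singleton. -/
noncomputable def ofSet (s : Set ℕ) : OList :=
  open Classical in
  if h : ∃ n : ℕ, s = {n} then ⟨0, [(h.choose : ℤ)]⟩ else empty

/-- The number that a list item `z` stands for satisfies `p`. -/
def itemHolds (p : CPred) (off : ℕ) (z : ℤ) : Prop := p.Holds (z + off).toNat

/-- Test whether some element satisfies `p`: look at the least or at the greatest element. -/
noncomputable def test (p : CPred) (l : OList) : Timed Bool :=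
  open Classical in
  do
    spend 1
    match p with
    | .lt _ => pure ((l.items.head?.map fun z => decide (itemHolds p l.off z)).getD false)
    | .ge _ => pure ((l.items.getLast?.map fun z => decide (itemHolds p l.off z)).getD false)

/-- Remove items from the front of a list while they do not satisfy `p`. -/
noncomputable def trim (p : CPred) (off : ℕ) : List ℤ → Timed (List ℤ)
  | [] => do spend 1; pure []
  | z :: l =>
    open Classical in
    do
      spend 1
      if itemHolds p off z then pure (z :: l) else trim p off l

/-- Filter by `p`. For `x ≥ k` items are removed from the front, for `x < k` from the back. -/
noncomputable def filter (p : CPred) (l : OList) : Timed OList :=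
  match p with
  | .ge _ => do
    let r ← trim p l.off l.items
    pure ⟨l.off, r⟩
  | .lt _ => do
    let r ← trim p l.off l.items.reverse
    pure ⟨l.off, r.reverse⟩

/-- Insert the items of the second sorted list into the first one by sorted merging from the
front. It stops when all items of the second list have been inserted. -/
def weave : List ℤ → List ℤ → Timed (List ℤ)
  | bs, [] => pure bs
  | [], z :: zs => do
    spend 1
    let r ← weave [] zs
    pure (z :: r)
  | b :: bs, z :: zs => do
    spend 1
    if b < z then
      let r ← weave bs (z :: zs)
      pure (b :: r)
    else if b = z then
      let r ← weave bs zs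
      pure (b :: r)
    else
      let r ← weave (b :: bs) zs
      pure (z :: r)
  termination_by bs zs => bs.length + zs.length

/-- Insert the elements of the second offset list into the first one. -/
def insertInto (l l' : OList) : Timed OList := do
  let r ← weave l.items (l'.items.map fun z => z + l'.off - l.off)
  pure ⟨l.off, r⟩

/-- Union: the offset list with the smaller maximum is merged into the other one. -/
def merge (l l' : OList) : Timed OList := do
  spend 1
  match l.items.getLast?, l'.items.getLast? with
  | none, _ => pure l'
  | _, none => pure l
  | some z, some z' => if z' + l'.off ≤ z + l.off then insertInto l l' else insertInto l' l

end OList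

section Simulation

variable {α Y Q : Type} [DecidableEq α] [DecidableEq Y] [DecidableEq Q] [Fintype Y]

/-- Evaluate a guard; every symbol costs one step. -/
noncomputable def checkGuard (m : Y → OList) : Guard Y → Timed Bool
  | .tt => do spend 1; pure true
  | .ff => do spend 1; pure false
  | .atom c => OList.test c.1 (m c.2)
  | .neg φ => do
    spend 1
    let b ← checkGuard m φ
    pure (!b)
  | .and φ ψ => do
    spend 1
    let b ← checkGuard m φ
    let b' ← checkGuard m ψ
    pure (b && b')
  | .or φ ψ => do
    spend 1
    let b ← checkGuard m φ
    let b' ← checkGuard m ψ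
    pure (b || b')

/-- Go through a list of transitions until an enabled one is found. -/
noncomputable def findTrans (m : Y → OList) :
    List (Trans α Q (Guard Y) (Y → SetTerm Y)) →
      Timed (Option (Trans α Q (Guard Y) (Y → SetTerm Y)))
  | [] => pure none
  | δ :: l => do
    spend 1
    let b ← checkGuard m δ.guard
    if b = true then pure (some δ) else findTrans m l

/-- Evaluate an r-term in situ: the list of its register is not copied, but moved out of the
memory, so that the register is empty afterwards. -/
noncomputable def computeTerm : RTerm Y → (Y → OList) → Timed (OList × (Y → OList))
  | .zero, m => do spend 1; pure (⟨0, [0]⟩, m)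
  | .one, m => do spend 1; pure (⟨0, [1]⟩, m)
  | .var y, m => do spend 1; pure (m y, Function.update m y OList.empty)
  | .succ t, m => do
    spend 1
    let r ← computeTerm t m
    pure (⟨r.1.off + 1, r.1.items⟩, r.2)
  | .filt p t, m => do
    let r ← computeTerm t m
    let l ← r.1.filter p
    pure (l, r.2)

/-- Evaluate a union of r-terms by successive merging. -/
noncomputable def computeUnion : List (RTerm Y) → (Y → OList) → Timed (OList × (Y → OList))
  | [], m => do spend 1; pure (OList.empty, m)
  | t :: ts, m => do
    let r ← computeTerm t m
    let r' ← computeUnion ts r.2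
    let l ← OList.merge r.1 r'.1
    pure (l, r'.2)

/-- Evaluate an update, register by register, from the old into the new memory. -/
noncomputable def computeUpdate (u : Y → SetTerm Y) :
    List Y → (Y → OList) → (Y → OList) → Timed (Y → OList)
  | [], _, new => pure new
  | y :: ys, old, new => do
    spend 1
    let r ← computeUnion (u y).toList old
    computeUpdate u ys r.2 (Function.update new y r.1)

/-- Process a word from a state and a memory; answers whether the word is accepted. For each
letter `a`, the `a`-transitions from the current state are searched for an enabled one. -/
noncomputable def simulateFrom (A : CSA α Y Q) : List α → Q → (Y → OList) → Timed Bool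
  | [], q, m => checkGuard m (A.final q)
  | a :: w, q, m => do
    spend 1
    let o ← findTrans m ((A.trans.filter fun δ => δ.src = q ∧ δ.letter = a).toList)
    match o with
    | none => pure false
    | some δ => do
      let m' ← computeUpdate δ.update Finset.univ.toList m fun _ => OList.empty
      simulateFrom A w δ.tgt m'

/-- Simulate a counting-set automaton on a word from the initial configuration `c₀`, whose
memory assigns a singleton or the empty set to every register. -/
noncomputable def simulate (A : CSA α Y Q) (c₀ : Q × (Y → Set ℕ)) (w : List α) :
    Timed Bool := do
  spend (Fintype.card Y + 1)
  simulateFrom A w c₀.1 fun y => OList.ofSet (c₀.2 y)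

end Simulation

end CountReg

open CountReg

namespace CountReg

set_option linter.unusedSectionVars false

/-! Cost of one step. The simulation is amortised against `potential`, the sum over all registers of
the height (maximum plus one) of the stored list. An increment raises one height by at most one. A
filter `x < k` removes items from the back, and each removal lowers the maximum. A merge visits only
values up to the smaller of the two maxima and replaces two heights by the larger one, so the
smaller height pays for it. All this needs lists that are moved and never copied, which is what
non-replication provides. A letter then costs one search for an enabled transition plus a constant
per register, independently of the counter bounds.

Flatness. In the marked regex no letter occurs twice, so sub-expressions that share a letter are
nested, and flat counting makes the scopes of distinct counters disjoint (`counted_eq_of_letters`).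
Hence each state lies in the scope of at most one counter, and each guard is true or tests a single
counter, at a state that can end its scope. `FlatCA` records this; everything later uses only that
interface.

Correctness. Under a fixed minterm an active register `x_S` flows as a whole into one register, with
index `nextSet`: the states reached by keeping the unmarked part, together with marked states for
the increments. This gives non-replication at once. The minterm with all guards positive is always
satisfiable; if the construction does not abort, no marked state can therefore be one where the
counter is tested or incremented (`marked_not_mem_lst`). So guards may ignore postponed increments.
As every guard concerns only one counter, it is enough to know, for each counter and state, the set
of values occurring in the reached configurations, and this set is maintained exactly
(`exists_reached`).

Number of states. All states in a generated `P`, except initially, carry the last letter `a`. An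
index assigns to each of them one of absent, unmarked, marked (never both, `disjoint_plain_marked`),
which alone would give only about `2 ^ 3 ^ m` families of indices. The improvement separates the
indices that arise from a fresh `1` while `a` is repeated (`descendants`) from the older ones. The
older ones number at most `3 ^ k` with `k = m - |labelled a|`, because they descend from indices
over the states of a different letter; they also number at most `3 ^ |labelled a|`, hence at most `3
^ (m / 2)`, which is negligible against `2 ^ m`. For the descendants, a single postponed increment
can only absorb a difference of one between the increment counts of runs over a power of `a`. This
forces the exit states of a counter to be met at one time only, and all runs to die soon after it
(`PairSystem`). So either there are linearly many descendants, or they avoid the exit states and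
form subsets of a set smaller than the scope. Summed over the counters this is at most `5 * m + 2 ^
(m - 1)`, leaving room in the exponent `2 ^ m` for all other factors.

Search time. With `n` states of the current letter there are at most `2 * 4 ^ n` minterms. A tested
atom is expanded into the older registers, at most `4 ^ k` of them with `n + k = m`, and at most one
descendant. The product is of order `m * 4 ^ m`, which is also the order of the number of registers.
-/

@[simp] theorem Timed.bind_val {β γ : Type} (m : Timed β) (f : β → Timed γ) :
    (m >>= f).val = (f m.val).val := rfl

@[simp] theorem Timed.bind_time {β γ : Type} (m : Timed β) (f : β → Timed γ) :
    (m >>= f).time = m.time + (f m.val).time := rfl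

@[simp] theorem Timed.pure_val {β : Type} (b : β) : (pure b : Timed β).val = b := rfl

@[simp] theorem Timed.pure_time {β : Type} (b : β) : (pure b : Timed β).time = 0 := rfl

@[simp] theorem spend_time (k : ℕ) : (spend k).time = k := rfl

/-! ### Offset lists -/

namespace OList

/-- The items are sorted and stand for natural numbers. -/
structure Valid (l : OList) : Prop where
  sorted : l.items.Pairwise (· < ·)
  nonneg : ∀ z ∈ l.items, 0 ≤ z + l.off

/-- The maximum plus one, and `0` for the empty list. -/
def height (l : OList) : ℕ := (l.items.map fun z : ℤ => (z + l.off).toNat + 1).foldr max 0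

theorem height_le_iff {l : OList} {k : ℕ} :
    l.height ≤ k ↔ ∀ z ∈ l.items, (z + l.off).toNat + 1 ≤ k := by
  unfold height
  induction l.items with
  | nil => simp
  | cons a t ih => simp only [List.map_cons, List.foldr_cons, max_le_iff, ih, List.forall_mem_cons]

theorem lt_height {l : OList} {z : ℤ} (h : z ∈ l.items) : (z + l.off).toNat + 1 ≤ l.height :=
  height_le_iff.1 le_rfl z h

@[simp] theorem height_empty : empty.height = 0 := rfl

theorem valid_empty : empty.Valid := ⟨List.Pairwise.nil, by simp [empty]⟩

@[simp] theorem toSet_empty : empty.toSet = ∅ := by ext n; simp [toSet, empty]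

theorem mem_toSet {l : OList} {n : ℕ} : n ∈ l.toSet ↔ (n : ℤ) - l.off ∈ l.items := Iff.rfl

theorem Valid.toNat_mem {l : OList} (h : l.Valid) {z : ℤ} (hz : z ∈ l.items) :
    (z + l.off).toNat ∈ l.toSet := by
  rw [mem_toSet, Int.toNat_of_nonneg (h.nonneg z hz)]
  simpa using hz

theorem exists_mem_toSet {l : OList} (h : l.Valid) (p : CPred) :
    (∃ n ∈ l.toSet, p.Holds n) ↔ ∃ z ∈ l.items, itemHolds p l.off z := by
  constructor
  · rintro ⟨n, hn, hp⟩
    exact ⟨_, hn, by simpa [itemHolds] using hp⟩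
  · rintro ⟨z, hz, hp⟩
    exact ⟨_, h.toNat_mem hz, hp⟩

@[simp] theorem test_time (p : CPred) (l : OList) : (test p l).time = 1 := by
  cases p <;> rfl

theorem itemHolds_lt_of_le {k : ℕ∞} {o : ℕ} {z z' : ℤ} (h : z' ≤ z)
    (hz : itemHolds (.lt k) o z) : itemHolds (.lt k) o z' := by
  simp only [itemHolds, CPred.Holds] at *
  refine lt_of_le_of_lt ?_ hz
  exact_mod_cast Int.toNat_le_toNat (by omega)

theorem itemHolds_ge_of_le {k : ℕ} {o : ℕ} {z z' : ℤ} (h : z ≤ z')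
    (hz : itemHolds (.ge k) o z) : itemHolds (.ge k) o z' := by
  simp only [itemHolds, CPred.Holds] at *
  exact hz.trans (Int.toNat_le_toNat (by omega))

/-- On a sorted list, `x < k` holds somewhere iff it holds at the least element, and `x ≥ k` iff it
holds at the greatest one. -/
theorem test_val {l : OList} (h : l.Valid) (p : CPred) :
    (test p l).val = true ↔ ∃ n ∈ l.toSet, p.Holds n := by
  rw [exists_mem_toSet h]
  cases p with
  | lt k =>
    have hs := h.sorted
    simp only [test, Timed.bind_val, Timed.pure_val]
    cases hl : l.items with
    | nil => simp
    | cons a t =>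
      rw [hl] at hs
      simp only [List.head?_cons, Option.map_some, Option.getD_some, decide_eq_true_eq]
      constructor
      · intro ha; exact ⟨a, by simp, ha⟩
      · rintro ⟨z, hz, hp⟩
        rcases List.mem_cons.1 hz with rfl | hz
        · exact hp
        · exact itemHolds_lt_of_le ((List.pairwise_cons.1 hs).1 z hz).le hp
  | ge k =>
    have hs := h.sorted
    simp only [test, Timed.bind_val, Timed.pure_val]
    rcases List.eq_nil_or_concat l.items with hl | ⟨t, a, hl⟩ <;>
    try rw [List.concat_eq_append] at hl
    · simp [hl]
    · rw [hl] at hs ⊢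
      simp only [List.getLast?_append, List.getLast?_singleton, Option.some_or, Option.map_some,
        Option.getD_some, decide_eq_true_eq]
      constructor
      · intro ha; exact ⟨a, by simp, ha⟩
      · rintro ⟨z, hz, hp⟩
        rcases List.mem_append.1 hz with hz | hz
        · exact itemHolds_ge_of_le
            ((List.pairwise_append.1 hs).2.2 z hz a (by simp)).le hp
        · rw [List.mem_singleton.1 hz] at hp
          exact hp

/-- `x < k` is downward closed, so in a decreasing list the violating items form a prefix and
removal may stop at the first good one. -/
theorem trim_lt_val (k : ℕ∞) (o : ℕ) : ∀ l : List ℤ, l.Pairwise (· > ·) →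
    ∀ z, z ∈ (trim (.lt k) o l).val ↔ z ∈ l ∧ itemHolds (.lt k) o z
  | [], _, z => by simp [trim]
  | a :: l, h, z => by
    obtain ⟨h1, h2⟩ := List.pairwise_cons.1 h
    by_cases ha : itemHolds (.lt k) o a
    · simp only [trim, Timed.bind_val, if_pos ha, Timed.pure_val]
      refine ⟨fun hz => ⟨hz, ?_⟩, fun hz => hz.1⟩
      rcases List.mem_cons.1 hz with rfl | hz
      · exact ha
      · exact itemHolds_lt_of_le (h1 z hz).le ha
    · simp only [trim, Timed.bind_val, if_neg ha, trim_lt_val k o l h2 z, List.mem_cons]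
      constructor
      · exact fun hz => ⟨Or.inr hz.1, hz.2⟩
      · rintro ⟨rfl | hz, hp⟩
        · exact absurd hp ha
        · exact ⟨hz, hp⟩

theorem trim_sublist (p : CPred) (o : ℕ) : ∀ l : List ℤ, (trim p o l).val.Sublist l
  | [] => by simp [trim]
  | a :: l => by
    by_cases ha : itemHolds p o a
    · simp [trim, ha]
    · simp only [trim, Timed.bind_val, if_neg ha]
      exact (trim_sublist p o l).cons a

/-- In a decreasing list every removed item lowers the maximum by at least one, so the drop in
height pays for the removals; the extra `1` is the last, unsuccessful look. -/
theorem trim_time (p : CPred) (o : ℕ) (off : ℕ) : ∀ l : List ℤ, l.Pairwise (· > ·) →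
    (∀ z ∈ l, 0 ≤ z + off) →
    (trim p o l).time + (OList.mk off (trim p o l).val).height ≤ (OList.mk off l).height + 1
  | [], _, _ => by simp [trim, height]
  | a :: l, h, hn => by
    obtain ⟨h1, h2⟩ := List.pairwise_cons.1 h
    by_cases ha : itemHolds p o a
    · simp only [trim, Timed.bind_val, Timed.bind_time, if_pos ha, Timed.pure_val,
        Timed.pure_time, spend_time]
      omega
    · simp only [trim, Timed.bind_val, Timed.bind_time, if_neg ha, spend_time]
      have ih := trim_time p o off l h2 fun z hz => hn z (List.mem_cons_of_mem _ hz)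
      have : (OList.mk off l).height + 1 ≤ (OList.mk off (a :: l)).height := by
        have h3 : (a + off).toNat + 1 ≤ (OList.mk off (a :: l)).height :=
          lt_height (l := OList.mk off (a :: l)) (by simp)
        have h4 : (OList.mk off l).height ≤ (a + off).toNat := by
          rw [height_le_iff]
          intro z hz
          have := h1 z hz
          have := hn z (List.mem_cons_of_mem _ hz)
          simp only at *
          omega
        omega
      omega

/-- Removal happens at the large end, where it lowers the height. Filters `x ≥ k` work at the small
end and would not be paid for in this way; they never occur in the updates considered (see
`ltOnly`). -/
theorem filter_lt_spec {l : OList} (h : l.Valid) (k : ℕ∞) :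
    (l.filter (.lt k)).val.Valid ∧
    (l.filter (.lt k)).val.toSet = {n | n ∈ l.toSet ∧ CPred.Holds (.lt k) n} ∧
    (l.filter (.lt k)).time + (l.filter (.lt k)).val.height ≤ l.height + 1 := by
  have hrev : l.items.reverse.Pairwise (· > ·) := List.pairwise_reverse.2 h.sorted
  have hm := trim_lt_val k l.off l.items.reverse hrev
  refine ⟨⟨?_, ?_⟩, ?_, ?_⟩
  · simp only [filter, Timed.bind_val, Timed.pure_val]
    rw [List.pairwise_reverse]
    exact hrev.sublist (trim_sublist _ _ _)
  · simp only [filter, Timed.bind_val, Timed.pure_val, List.mem_reverse]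
    intro z hz
    exact h.nonneg z (by simpa using ((hm z).1 hz).1)
  · ext n
    simp only [filter, Timed.bind_val, Timed.pure_val, mem_toSet, List.mem_reverse, hm,
      Set.mem_ofPred_eq, itemHolds]
    simp
  · simp only [filter, Timed.bind_val, Timed.bind_time, Timed.pure_val, Timed.pure_time]
    have := trim_time (.lt k) l.off l.off l.items.reverse hrev
      fun z hz => h.nonneg z (by simpa using hz)
    have h1 : (OList.mk l.off l.items.reverse).height ≤ l.height :=
      height_le_iff.2 fun z hz => lt_height (by simpa using hz)
    have h2 : (OList.mk l.off (trim (.lt k) l.off l.items.reverse).val.reverse).height ≤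
        (OList.mk l.off (trim (.lt k) l.off l.items.reverse).val).height :=
      height_le_iff.2 fun z hz =>
        lt_height (l := OList.mk l.off (trim (.lt k) l.off l.items.reverse).val)
          (by simpa using hz)
    omega

theorem mem_weave (bs zs : List ℤ) : ∀ x, x ∈ (weave bs zs).val ↔ x ∈ bs ∨ x ∈ zs := by
  fun_induction weave bs zs with
  | case1 => simp
  | case2 z zs ih => simp_all
  | case3 b bs z zs ih1 ih2 ih3 =>
    intro x
    split_ifs with h h'
    · simp_all; tauto
    · simp_all; tauto
    · simp_all; tauto

theorem weave_sorted (bs zs : List ℤ) (hb : bs.Pairwise (· < ·)) (hz : zs.Pairwise (· < ·)) :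
    (weave bs zs).val.Pairwise (· < ·) := by
  fun_induction weave bs zs with
  | case1 => simpa
  | case2 z zs ih =>
    simp only [Timed.bind_val, Timed.pure_val, List.pairwise_cons, mem_weave] at *
    exact ⟨by simpa using hz.1, ih hb hz.2⟩
  | case3 b bs z zs ih1 ih2 ih3 =>
    obtain ⟨hb1, hb2⟩ := List.pairwise_cons.1 hb
    obtain ⟨hz1, hz2⟩ := List.pairwise_cons.1 hz
    simp only [Timed.bind_val]
    split_ifs with h h' <;>
      simp only [Timed.bind_val, Timed.pure_val, List.pairwise_cons, mem_weave]
    · refine ⟨?_, ih1 hb2 hz⟩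
      rintro x (hx | hx)
      · exact hb1 x hx
      · rcases List.mem_cons.1 hx with rfl | hx
        · exact h
        · exact h.trans (hz1 x hx)
    · subst h'
      refine ⟨?_, ih2 hb2 hz2⟩
      rintro x (hx | hx)
      · exact hb1 x hx
      · exact hz1 x hx
    · refine ⟨?_, ih3 hb hz2⟩
      rintro x (hx | hx)
      · rcases List.mem_cons.1 hx with rfl | hx
        · omega
        · have := hb1 x hx; omega
      · exact hz1 x hx

/-- The value emitted at each step is at least the current `L` and at most `M`, and the next step
has a larger `L`. The work is therefore bounded by the width of the value range and not by the
length of the first list. -/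
theorem weave_time (bs zs : List ℤ) (hb : bs.Pairwise (· < ·)) (hz : zs.Pairwise (· < ·))
    (L M : ℤ) (h1 : ∀ b ∈ bs, L ≤ b) (h2 : ∀ z ∈ zs, L ≤ z ∧ z ≤ M) :
    (weave bs zs).time ≤ (M + 1 - L).toNat := by
  fun_induction weave bs zs generalizing L with
  | case1 => simp
  | case2 z zs ih =>
    simp only [Timed.bind_time, Timed.pure_time, spend_time, List.pairwise_cons] at *
    have := ih hb hz.2 (z + 1) (by simp) fun y hy =>
      ⟨by have := hz.1 y hy; omega, (h2 y (List.mem_cons_of_mem _ hy)).2⟩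
    have := h2 z (by simp)
    omega
  | case3 b bs z zs ih1 ih2 ih3 =>
    obtain ⟨hb1, hb2⟩ := List.pairwise_cons.1 hb
    obtain ⟨hz1, hz2⟩ := List.pairwise_cons.1 hz
    have hz3 := h2 z (by simp)
    have hb3 := h1 b (by simp)
    have h2' : ∀ y ∈ zs, y ≤ M := fun y hy => (h2 y (by simp [hy])).2
    simp only [Timed.bind_time, spend_time]
    split_ifs with h h' <;>
      simp only [Timed.bind_time, Timed.pure_time]
    · have := ih1 hb2 hz (b + 1) (fun y hy => by have := hb1 y hy; omega)
        (fun y hy => ⟨by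
          rcases List.mem_cons.1 hy with rfl | hy
          · omega
          · have := hz1 y hy; omega, (h2 y hy).2⟩)
      omega
    · have := ih2 hb2 hz2 (b + 1) (fun y hy => by have := hb1 y hy; omega)
        (fun y hy => ⟨by have := hz1 y hy; omega, h2' y hy⟩)
      omega
    · have := ih3 hb hz2 (z + 1)
        (fun y hy => by
          rcases List.mem_cons.1 hy with rfl | hy
          · omega
          · have := hb1 y hy; omega)
        (fun y hy => ⟨by have := hz1 y hy; omega, h2' y hy⟩)
      omega

theorem insertInto_spec {l l' : OList} (h : l.Valid) (h' : l'.Valid) :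
    (insertInto l l').val.Valid ∧
    (insertInto l l').val.toSet = l.toSet ∪ l'.toSet ∧
    (insertInto l l').time ≤ l'.height ∧
    (insertInto l l').val.height ≤ max l.height l'.height := by
  have hs : (l'.items.map fun z : ℤ => z + l'.off - l.off).Pairwise (· < ·) :=
    List.pairwise_map.2 (h'.sorted.imp fun {a b} hab => by omega)
  refine ⟨⟨weave_sorted _ _ h.sorted hs, ?_⟩, ?_, ?_, ?_⟩
  · simp only [insertInto, Timed.bind_val, Timed.pure_val, mem_weave, List.mem_map]
    rintro z (hz | ⟨y, hy, rfl⟩)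
    · exact h.nonneg z hz
    · have := h'.nonneg y hy; omega
  · ext n
    simp only [insertInto, Timed.bind_val, Timed.pure_val, mem_toSet, mem_weave, List.mem_map,
      Set.mem_union]
    refine or_congr_right ⟨?_, fun hn => ⟨_, hn, by omega⟩⟩
    rintro ⟨y, hy, hyn⟩
    have : y = (n : ℤ) - l'.off := by omega
    exact this ▸ hy
  · simp only [insertInto, Timed.bind_time, Timed.pure_time, add_zero]
    -- Relative to the offset of `l`, the item `-l.off` stands for `0` and `l'.height - 1 - l.off`
    -- for the maximum of `l'`, so the range has exactly `l'.height` values.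
    have := weave_time _ _ h.sorted hs (-l.off) (l'.height - 1 - l.off)
      (fun b hb => by have := h.nonneg b hb; omega)
      (fun z hz => by
        obtain ⟨y, hy, rfl⟩ := List.mem_map.1 hz
        have := h'.nonneg y hy
        have := lt_height hy
        constructor <;> omega)
    omega
  · rw [height_le_iff]
    simp only [insertInto, Timed.bind_val, Timed.pure_val, mem_weave, List.mem_map]
    rintro z (hz | ⟨y, hy, rfl⟩)
    · exact (lt_height hz).trans (le_max_left _ _)
    · refine le_trans ?_ ((lt_height hy).trans (le_max_right _ _))
      simp

theorem height_of_getLast? {l : OList} (h : l.Valid) {z : ℤ} (hz : l.items.getLast? = some z) :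
    l.height = (z + l.off).toNat + 1 := by
  refine le_antisymm (height_le_iff.2 ?_) (lt_height (List.mem_of_getLast? hz))
  have hs := h.sorted
  rcases List.eq_nil_or_concat l.items with hl | ⟨t, a, hl⟩ <;>
    try rw [List.concat_eq_append] at hl
  · simp [hl] at hz
  · rw [hl] at hz hs ⊢
    simp only [List.getLast?_append, List.getLast?_singleton, Option.some_or, Option.some.injEq]
      at hz
    subst hz
    intro y hy
    rcases List.mem_append.1 hy with hy | hy
    · have := (List.pairwise_append.1 hs).2.2 y hy a (by simp)
      omega
    · rw [List.mem_singleton.1 hy]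

/-- The list with the smaller maximum is the inserted one. Its height bounds the steps, and the
height of the result is that of the other list, so the sum of both heights covers time and result.
-/
theorem merge_spec {l l' : OList} (h : l.Valid) (h' : l'.Valid) :
    (merge l l').val.Valid ∧
    (merge l l').val.toSet = l.toSet ∪ l'.toSet ∧
    (merge l l').time + (merge l l').val.height ≤ l.height + l'.height + 1 := by
  unfold merge
  simp only [Timed.bind_val, Timed.bind_time, spend_time]
  split
  · rename_i hl
    have hl := List.getLast?_eq_none_iff.1 hl
    refine ⟨h', ?_, ?_⟩
    · ext n; simp [mem_toSet, hl]
    · simp only [Timed.pure_time, Timed.pure_val]; omega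
  · rename_i hl _
    have hl := List.getLast?_eq_none_iff.1 hl
    refine ⟨h, ?_, ?_⟩
    · ext n; simp [mem_toSet, hl]
    · simp only [Timed.pure_time, Timed.pure_val]; omega
  · rename_i z z' hz hz'
    have e := height_of_getLast? h hz
    have e' := height_of_getLast? h' hz'
    split
    · obtain ⟨h1, h2, h3, h4⟩ := insertInto_spec h h'
      refine ⟨h1, h2, ?_⟩
      omega
    · obtain ⟨h1, h2, h3, h4⟩ := insertInto_spec h' h
      refine ⟨h1, by rw [h2, Set.union_comm], ?_⟩
      omega

theorem ofSet_spec {s : Set ℕ} (hs : s = ∅ ∨ s = {0}) :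
    (ofSet s).Valid ∧ (ofSet s).toSet = s ∧ (ofSet s).height ≤ 1 := by
  rcases hs with rfl | rfl
  · have : ofSet ∅ = empty := by
      rw [ofSet, dif_neg]
      rintro ⟨n, hn⟩
      exact Set.singleton_ne_empty n hn.symm
    rw [this]
    exact ⟨valid_empty, toSet_empty, by simp⟩
  · have hex : ∃ n : ℕ, ({0} : Set ℕ) = {n} := ⟨0, rfl⟩
    have h0 : hex.choose = 0 := (Set.singleton_eq_singleton_iff.1 hex.choose_spec).symm
    have : ofSet {0} = ⟨0, [0]⟩ := by
      rw [ofSet, dif_pos hex, h0]; rfl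
    rw [this]
    refine ⟨⟨by simp, by simp⟩, ?_, by simp [height]⟩
    ext n
    simp [mem_toSet]

end OList

/-! ### Evaluation of guards and updates -/

section Simulation

variable {α Y Q : Type} [DecidableEq α] [DecidableEq Y] [DecidableEq Q] [Fintype Y]

theorem checkGuard_val {m : Y → OList} (hm : ∀ y, (m y).Valid) (φ : Guard Y) :
    (checkGuard m φ).val = true ↔ (setLang Y).sat φ fun y => (m y).toSet := by
  induction φ with
  | tt => simp [checkGuard, setLang, Form.Holds]
  | ff => simp [checkGuard, setLang, Form.Holds]
  | atom c => exact OList.test_val (hm c.2) c.1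
  | neg φ ih =>
    simp only [checkGuard, Timed.bind_val, Timed.pure_val, setLang, Form.Holds] at *
    rw [← ih]; simp
  | and φ ψ ih1 ih2 =>
    simp only [checkGuard, Timed.bind_val, Timed.pure_val, setLang, Form.Holds] at *
    rw [← ih1, ← ih2]; simp
  | or φ ψ ih1 ih2 =>
    simp only [checkGuard, Timed.bind_val, Timed.pure_val, setLang, Form.Holds] at *
    rw [← ih1, ← ih2]; simp

theorem checkGuard_time (m : Y → OList) (φ : Guard Y) : (checkGuard m φ).time = φ.size := by
  induction φ <;> simp_all [checkGuard, Form.size] <;> omega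

theorem findTrans_none {m : Y → OList} {l : List (Trans α Q (Guard Y) (Y → SetTerm Y))}
    (h : (findTrans m l).val = none) : ∀ δ ∈ l, (checkGuard m δ.guard).val ≠ true := by
  induction l with
  | nil => simp
  | cons a l ih =>
    by_cases ha : (checkGuard m a.guard).val = true
    · simp [findTrans, ha] at h
    · simp only [findTrans, Timed.bind_val, if_neg ha] at h
      simpa using ⟨by simpa using ha, by simpa using ih h⟩

theorem findTrans_some {m : Y → OList} {l : List (Trans α Q (Guard Y) (Y → SetTerm Y))}
    {δ : Trans α Q (Guard Y) (Y → SetTerm Y)}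
    (h : (findTrans m l).val = some δ) : δ ∈ l ∧ (checkGuard m δ.guard).val = true := by
  induction l with
  | nil => simp [findTrans] at h
  | cons a l ih =>
    by_cases ha : (checkGuard m a.guard).val = true
    · simp only [findTrans, Timed.bind_val, if_pos ha, Timed.pure_val, Option.some.injEq] at h
      subst h
      exact ⟨by simp, ha⟩
    · simp only [findTrans, Timed.bind_val, if_neg ha] at h
      exact ⟨List.mem_cons_of_mem _ (ih h).1, (ih h).2⟩

theorem findTrans_time (m : Y → OList) (l : List (Trans α Q (Guard Y) (Y → SetTerm Y))) :
    (findTrans m l).time ≤ (l.map fun δ => 1 + δ.guard.size).sum := by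
  induction l with
  | nil => simp [findTrans]
  | cons a l ih =>
    by_cases ha : (checkGuard m a.guard).val = true
    · simp [findTrans, ha, checkGuard_time]
    · simp only [findTrans, Timed.bind_time, if_neg ha, checkGuard_time, spend_time,
        List.map_cons, List.sum_cons]
      omega

/-- All filters of the r-term keep the elements below a bound. -/
def RTerm.LtOnly {Y : Type} : RTerm Y → Prop
  | .zero => True
  | .one => True
  | .var _ => True
  | .succ t => t.LtOnly
  | .filt (.lt _) t => t.LtOnly
  | .filt (.ge _) _ => False

theorem RTerm.eval_congr {s s' : Y → Set ℕ} (t : RTerm Y)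
    (h : ∀ y, t.reg = some y → s y = s' y) : t.eval s = t.eval s' := by
  induction t with
  | zero => rfl
  | one => rfl
  | var y => exact h y rfl
  | succ t ih => simp only [RTerm.eval, ih h]
  | filt p t ih => simp only [RTerm.eval, ih h]

/-- The total height of the lists in a memory. -/
def potential (m : Y → OList) : ℕ := ∑ y, (m y).height

theorem potential_update_le (m : Y → OList) (y : Y) (l : OList) :
    potential (Function.update m y l) ≤ potential m + l.height := by
  unfold potential
  rw [← Finset.add_sum_erase _ _ (Finset.mem_univ y), ← Finset.add_sum_erase
    (a := y) (f := fun y => (m y).height) _ (Finset.mem_univ y)]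
  have : ∑ x ∈ Finset.univ.erase y, (Function.update m y l x).height =
      ∑ x ∈ Finset.univ.erase y, (m x).height :=
    Finset.sum_congr rfl fun x hx => by
      rw [Function.update_of_ne (Finset.ne_of_mem_erase hx)]
  simp only [Function.update_self, this]
  omega

theorem potential_update_empty (m : Y → OList) (y : Y) :
    (m y).height + potential (Function.update m y OList.empty) = potential m := by
  unfold potential
  rw [← Finset.add_sum_erase _ _ (Finset.mem_univ y), ← Finset.add_sum_erase
    (a := y) (f := fun y => (m y).height) _ (Finset.mem_univ y)]
  have : ∑ x ∈ Finset.univ.erase y, (Function.update m y OList.empty x).height =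
      ∑ x ∈ Finset.univ.erase y, (m x).height :=
    Finset.sum_congr rfl fun x hx => by
      rw [Function.update_of_ne (Finset.ne_of_mem_erase hx)]
  simp only [Function.update_self, this, OList.height_empty]
  omega

/-- Amortised cost: the height of the moved list leaves the potential and reappears in the result.
Each symbol needs at most `3`: the constant `1` takes one step and creates a list of height `2`,
while an increment costs one step and one unit of height, and a filter one unit. -/
theorem computeTerm_spec {m : Y → OList} (hm : ∀ y, (m y).Valid) (t : RTerm Y)
    (ht : t.LtOnly) :
    (computeTerm t m).val.1.Valid ∧ (∀ y, ((computeTerm t m).val.2 y).Valid) ∧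
    (computeTerm t m).val.1.toSet = t.eval (fun y => (m y).toSet) ∧
    (∀ y, t.reg ≠ some y → (computeTerm t m).val.2 y = m y) ∧
    (computeTerm t m).time + (computeTerm t m).val.1.height +
      potential (computeTerm t m).val.2 ≤ potential m + 3 * t.size := by
  induction t with
  | zero =>
    refine ⟨⟨by simp [computeTerm], by simp [computeTerm]⟩, hm, ?_, fun _ _ => rfl, ?_⟩
    · ext n; simp [computeTerm, OList.mem_toSet, RTerm.eval]
    · simp [computeTerm, OList.height, RTerm.size]; omega
  | one =>
    refine ⟨⟨by simp [computeTerm], by simp [computeTerm]⟩, hm, ?_, fun _ _ => rfl, ?_⟩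
    · ext n
      simp only [computeTerm, Timed.bind_val, Timed.pure_val, OList.mem_toSet, RTerm.eval,
        List.mem_singleton, Set.mem_singleton_iff]
      omega
    · simp [computeTerm, OList.height, RTerm.size]; omega
  | var y =>
    refine ⟨hm y, ?_, rfl, ?_, ?_⟩
    · intro z
      by_cases hz : z = y
      · subst hz; simpa [computeTerm] using OList.valid_empty
      · simpa [computeTerm, hz] using hm z
    · intro z hz
      have : z ≠ y := fun h => hz (by rw [h]; rfl)
      simp [computeTerm, this]
    · have := potential_update_empty m y
      simp only [computeTerm, Timed.bind_time, Timed.bind_val, Timed.pure_val, Timed.pure_time,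
        spend_time, RTerm.size]
      omega
  | succ t ih =>
    obtain ⟨h1, h2, h3, h4, h5⟩ := ih ht
    simp only [computeTerm, Timed.bind_time, Timed.bind_val, Timed.pure_val, Timed.pure_time,
        spend_time, RTerm.size]
    refine ⟨⟨h1.sorted, ?_⟩, h2, ?_, h4, ?_⟩
    · intro z hz
      have := h1.nonneg z hz
      push_cast
      omega
    · rw [RTerm.eval, ← h3]
      ext n
      simp only [OList.mem_toSet, Set.mem_image]
      constructor
      · intro hn
        have := h1.nonneg _ hn
        push_cast at this hn
        exact ⟨n - 1, by convert hn using 1; omega, by omega⟩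
      · rintro ⟨k, hk, rfl⟩
        push_cast
        convert hk using 1
        omega
    · have : (OList.mk ((computeTerm t m).val.1.off + 1) (computeTerm t m).val.1.items).height ≤
          (computeTerm t m).val.1.height + 1 := by
        rw [OList.height_le_iff]
        intro z hz
        have := OList.lt_height (l := (computeTerm t m).val.1) hz
        have := h1.nonneg z hz
        show (z + (((computeTerm t m).val.1.off + 1 : ℕ) : ℤ)).toNat + 1 ≤ _
        push_cast
        omega
      omega
  | filt p t ih =>
    cases p with
    | ge k => exact absurd ht (by simp [RTerm.LtOnly])
    | lt k =>
      obtain ⟨h1, h2, h3, h4, h5⟩ := ih ht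
      obtain ⟨f1, f2, f3⟩ := OList.filter_lt_spec h1 k
      simp only [computeTerm, Timed.bind_time, Timed.bind_val, Timed.pure_val, Timed.pure_time,
        RTerm.size]
      refine ⟨f1, h2, ?_, h4, ?_⟩
      · rw [f2, RTerm.eval, h3]
      · omega

/-- Evaluating an r-term empties its register. The pairwise condition guarantees that no later
r-term of the union reads that register again, so all of them see the original memory. -/
theorem computeUnion_spec (ts : List (RTerm Y)) : ∀ {m : Y → OList}, (∀ y, (m y).Valid) →
    (∀ t ∈ ts, t.LtOnly) →
    (ts.Pairwise fun t t' => ∀ y, t.reg = some y → t'.reg ≠ some y) →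
    (computeUnion ts m).val.1.Valid ∧ (∀ y, ((computeUnion ts m).val.2 y).Valid) ∧
    (computeUnion ts m).val.1.toSet = {n | ∃ t ∈ ts, n ∈ t.eval fun y => (m y).toSet} ∧
    (∀ y, (∀ t ∈ ts, t.reg ≠ some y) → (computeUnion ts m).val.2 y = m y) ∧
    (computeUnion ts m).time + (computeUnion ts m).val.1.height +
      potential (computeUnion ts m).val.2 ≤
        potential m + 1 + (ts.map fun t => 3 * t.size + 1).sum := by
  induction ts with
  | nil =>
    intro m hm _ _
    refine ⟨OList.valid_empty, hm, ?_, fun _ _ => rfl, ?_⟩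
    · simp [computeUnion]
    · simp [computeUnion]; omega
  | cons t ts ih =>
    intro m hm hl hp
    obtain ⟨hp1, hp2⟩ := List.pairwise_cons.1 hp
    obtain ⟨a1, a2, a3, a4, a5⟩ := computeTerm_spec hm t (hl t (by simp))
    obtain ⟨b1, b2, b3, b4, b5⟩ := ih a2 (fun t' ht' => hl t' (by simp [ht'])) hp2
    obtain ⟨c1, c2, c3⟩ := OList.merge_spec a1 b1
    simp only [computeUnion, Timed.bind_time, Timed.bind_val, Timed.pure_val, Timed.pure_time]
    refine ⟨c1, b2, ?_, ?_, ?_⟩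
    · rw [c2, a3, b3]
      ext n
      simp only [Set.mem_union, Set.mem_ofPred_eq, List.mem_cons, exists_eq_or_imp]
      refine or_congr_right (exists_congr fun t' => and_congr_right fun ht' => ?_)
      rw [RTerm.eval_congr t' fun y hy => by
        rw [a4 y fun h => hp1 t' ht' y h hy]]
    · intro y hy
      rw [b4 y fun t' ht' => hy t' (by simp [ht']), a4 y (hy t (by simp))]
    · simp only [List.map_cons, List.sum_cons]
      omega

/-- The number of steps that suffice to evaluate an update, without the work on list items. -/
def updateCost (u : Y → SetTerm Y) (y : Y) : ℕ := 2 + ∑ t ∈ u y, (3 * t.size + 1)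

/-- Every register occurs in at most one r-term of at most one assignment. -/
def NonRepl (u : Y → SetTerm Y) : Prop :=
  ∀ (z x x' : Y) (t t' : RTerm Y), t ∈ u x → t' ∈ u x' →
    t.reg = some z → t'.reg = some z → x = x' ∧ t = t'

/-- Non-replication is used twice: inside one assignment it gives the hypothesis of
`computeUnion_spec`, and across assignments it ensures that a register emptied for `y` is not needed
by a later one. -/
theorem computeUpdate_spec {u : Y → SetTerm Y} (hl : ∀ y, ∀ t ∈ u y, t.LtOnly)
    (hu : NonRepl u) : ∀ (ys : List Y) (old new : Y → OList), ys.Nodup →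
    (∀ y, (old y).Valid) → (∀ y, (new y).Valid) →
    (∀ y, ((computeUpdate u ys old new).val y).Valid) ∧
    (∀ y ∈ ys, ((computeUpdate u ys old new).val y).toSet =
      {n | ∃ t ∈ u y, n ∈ t.eval fun z => (old z).toSet}) ∧
    (∀ y ∉ ys, (computeUpdate u ys old new).val y = new y) ∧
    (computeUpdate u ys old new).time + potential (computeUpdate u ys old new).val ≤
      potential old + potential new + (ys.map (updateCost u)).sum := by
  intro ys
  induction ys with
  | nil =>
    intro old new _ ho hn
    refine ⟨hn, by simp, fun _ _ => rfl, ?_⟩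
    simp [computeUpdate]
  | cons y ys ih =>
    intro old new hnd ho hn
    obtain ⟨hy, hnd'⟩ := List.nodup_cons.1 hnd
    have hpw : (u y).toList.Pairwise fun t t' => ∀ z, t.reg = some z → t'.reg ≠ some z := by
      refine (Finset.nodup_toList (u y)).imp_of_mem ?_
      intro t t' ht ht' hne z hz hz'
      exact hne (hu z y y t t' (by simpa using ht) (by simpa using ht') hz hz').2
    obtain ⟨a1, a2, a3, a4, a5⟩ := computeUnion_spec (u y).toList ho
      (fun t ht => hl y t (by simpa using ht)) hpw
    have hn' : ∀ z, (Function.update new y (computeUnion (u y).toList old).val.1 z).Valid := by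
      intro z
      by_cases hz : z = y
      · subst hz; simpa using a1
      · simpa [hz] using hn z
    obtain ⟨b1, b2, b3, b4⟩ := ih (computeUnion (u y).toList old).val.2
      (Function.update new y (computeUnion (u y).toList old).val.1) hnd' a2 hn'
    simp only [computeUpdate, Timed.bind_time, Timed.bind_val, spend_time]
    refine ⟨b1, ?_, ?_, ?_⟩
    · intro z hz
      rcases List.mem_cons.1 hz with rfl | hz
      · rw [b3 z hy, Function.update_self, a3]
        simp
      · rw [b2 z hz]
        ext n
        refine exists_congr fun t => and_congr_right fun ht => ?_
        rw [RTerm.eval_congr t fun w hw => by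
          rw [a4 w fun t' ht' hw' => by
            have := (hu w z y t t' ht (by simpa using ht') hw hw').1
            exact hy (this ▸ hz)]]
    · intro z hz
      rw [List.mem_cons, not_or] at hz
      rw [b3 z hz.2, Function.update_of_ne hz.1]
    · have := potential_update_le new y (computeUnion (u y).toList old).val.1
      have e : ((u y).toList.map fun t => 3 * t.size + 1).sum = ∑ t ∈ u y, (3 * t.size + 1) :=
        Finset.sum_map_toList _ _
      simp only [List.map_cons, List.sum_cons]
      rw [e] at a5
      have : updateCost u y = 2 + ∑ t ∈ u y, (3 * t.size + 1) := rfl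
      omega

/-! ### Correctness and cost of the simulation -/

/-- At most one transition is enabled. -/
def Deterministic (A : CSA α Y Q) : Prop :=
  ∀ δ ∈ A.trans, ∀ δ' ∈ A.trans, ∀ s : Y → Set ℕ, δ.src = δ'.src → δ.letter = δ'.letter →
    (setLang Y).sat δ.guard s → (setLang Y).sat δ'.guard s → δ = δ'

/-- The potential telescopes along the word: each letter adds at most `U` to it in exchange for the
list operations, `G` bounds the search, and a final `G` the evaluation of the final condition. -/
theorem simulateFrom_spec {A : CSA α Y Q} (hdet : Deterministic A) (hnr : NonReplicating A)
    (hlt : ∀ δ ∈ A.trans, ∀ y, ∀ t ∈ δ.update y, t.LtOnly)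
    (htgt : ∀ δ ∈ A.trans, δ.tgt ∈ A.states) {G U : ℕ}
    (hG : ∀ q a, ∑ δ ∈ A.trans.filter (fun δ => δ.src = q ∧ δ.letter = a),
      (1 + δ.guard.size) ≤ G)
    (hF : ∀ q ∈ A.states, (A.final q).size ≤ G)
    (hU : ∀ δ ∈ A.trans, ∑ y, updateCost δ.update y ≤ U) (w : List α) :
    ∀ (q : Q) (m : Y → OList), q ∈ A.states → (∀ y, (m y).Valid) →
      ((simulateFrom A w q m).val = true ↔
        ∃ c', RegAut.Run (setLang Y) A (q, fun y => (m y).toSet) w c' ∧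
          (setLang Y).sat (A.final c'.1) c'.2) ∧
      (simulateFrom A w q m).time ≤ potential m + w.length * (1 + G + U) + G := by
  induction w with
  | nil =>
    intro q m hq hm
    refine ⟨?_, ?_⟩
    · rw [simulateFrom, checkGuard_val hm]
      constructor
      · exact fun h => ⟨_, RegAut.Run.nil _, h⟩
      · rintro ⟨c', h, h'⟩
        cases h
        exact h'
    · rw [simulateFrom, checkGuard_time]
      have := hF q hq
      simp; omega
  | cons a w ih =>
    intro q m hq hm
    have hft := findTrans_time m (A.trans.filter fun δ => δ.src = q ∧ δ.letter = a).toList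
    rw [Finset.sum_map_toList] at hft
    have hft := hft.trans (hG q a)
    cases ho : (findTrans m (A.trans.filter fun δ => δ.src = q ∧ δ.letter = a).toList).val with
    | none =>
      have hn := findTrans_none ho
      refine ⟨?_, ?_⟩
      · simp only [simulateFrom, Timed.bind_val, ho, Timed.pure_val, Bool.false_eq_true,
          false_iff]
        rintro ⟨c', h, -⟩
        cases h with
        | cons hstep _ =>
          obtain ⟨δ, hδ, h1, h2, h3, -⟩ := hstep
          refine hn δ (by simpa using ⟨hδ, h1, h2⟩) ?_
          rw [checkGuard_val hm]
          exact h3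
      · simp only [simulateFrom, Timed.bind_time, ho, Timed.pure_time, spend_time,
          List.length_cons]
        have : 1 * (1 + G + U) ≤ (w.length + 1) * (1 + G + U) := Nat.mul_le_mul_right _ (by omega)
        omega
    | some δ =>
      obtain ⟨hδ, hg⟩ := findTrans_some ho
      simp only [Finset.mem_toList, Finset.mem_filter] at hδ
      obtain ⟨hδ, h1, h2⟩ := hδ
      rw [checkGuard_val hm] at hg
      obtain ⟨c1, c2, -, c4⟩ := computeUpdate_spec (hlt δ hδ) (hnr δ hδ) Finset.univ.toList m
        (fun _ => OList.empty) (Finset.nodup_toList _) hm fun _ => OList.valid_empty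
      have hpe : potential (fun _ : Y => OList.empty) = 0 := by simp [potential]
      rw [Finset.sum_map_toList, hpe] at c4
      have c4 := c4.trans (Nat.add_le_add_left (hU δ hδ) _)
      obtain ⟨i1, i2⟩ := ih δ.tgt _ (htgt δ hδ) c1
      have hs : (fun y => ((computeUpdate δ.update Finset.univ.toList m
          fun _ => OList.empty).val y).toSet) =
          fun y => (setLang Y).eval (δ.update y) fun y => (m y).toSet := by
        funext y
        exact c2 y (by simp)
      refine ⟨?_, ?_⟩
      · simp only [simulateFrom, Timed.bind_val, ho]
        rw [i1, hs]
        constructor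
        · rintro ⟨c', hr, hf⟩
          exact ⟨c', RegAut.Run.cons ⟨δ, hδ, h1, h2, hg, rfl⟩ hr, hf⟩
        · rintro ⟨c', hr, hf⟩
          cases hr with
          | cons hstep hr =>
            obtain ⟨δ', hδ', h1', h2', h3', rfl⟩ := hstep
            -- The search commits to the first enabled transition; determinism says that an
            -- arbitrary run takes the same one.
            obtain rfl := hdet δ hδ δ' hδ' _ (h1.trans h1'.symm) (h2.trans h2'.symm) hg h3'
            exact ⟨c', hr, hf⟩
      · simp only [simulateFrom, Timed.bind_time, ho, spend_time, List.length_cons]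
        have : (w.length + 1) * (1 + G + U) = w.length * (1 + G + U) + (1 + G + U) := by ring
        omega

end Simulation

/-! ### Structure of marked regexes -/

namespace Regex

variable {β : Type}

/-- The number of letters is positive below every counting operator. -/
def CountPos : Regex β → Prop
  | eps => True
  | char _ => True
  | cat r s => r.CountPos ∧ s.CountPos
  | alt r s => r.CountPos ∧ s.CountPos
  | star r => r.CountPos
  | count r _ _ _ _ => r.chars ≠ 0 ∧ r.CountPos

theorem chars_norm (r : Regex β) : r.norm.chars = r.chars := by
  induction r with
  | count r lo hi hpos hle ih =>
    simp only [norm]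
    split_ifs <;> simp_all [chars]
  | _ => simp_all [norm, chars]

theorem noCount_norm (r : Regex β) (h : r.NoCount) : r.norm.NoCount := by
  induction r with
  | count r lo hi hpos hle ih => exact h.elim
  | _ => simp_all [norm, NoCount]

theorem NoCount.flat {r : Regex β} (h : r.NoCount) : r.Flat := by
  induction r with
  | count r lo hi hpos hle ih => exact h.elim
  | _ => simp_all [Flat, NoCount]

theorem flat_norm (r : Regex β) (h : r.Flat) : r.norm.Flat := by
  induction r with
  | count r lo hi hpos hle ih =>
    have h1 := noCount_norm r h
    have h2 := h1.flat
    simp only [norm]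
    split_ifs <;> simp_all [Flat]
  | _ => simp_all [norm, Flat]

theorem countPos_norm (r : Regex β) : r.norm.CountPos := by
  induction r with
  | count r lo hi hpos hle ih =>
    simp only [norm]
    split_ifs <;> simp_all [CountPos, chars_norm]
  | _ => simp_all [norm, CountPos]

theorem chars_mark (r : Regex β) (n : ℕ) : (r.mark n).chars = r.chars := by
  induction r generalizing n <;> simp_all [mark, chars]

theorem noCount_mark (r : Regex β) (h : r.NoCount) (n : ℕ) : (r.mark n).NoCount := by
  induction r generalizing n <;> simp_all [mark, NoCount]

theorem flat_mark (r : Regex β) (h : r.Flat) (n : ℕ) : (r.mark n).Flat := by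
  induction r generalizing n with
  | count r lo hi hpos hle ih => exact noCount_mark r h n
  | _ => simp_all [mark, Flat]

theorem countPos_mark (r : Regex β) (h : r.CountPos) (n : ℕ) : (r.mark n).CountPos := by
  induction r generalizing n <;> simp_all [mark, CountPos, chars_mark]

variable [DecidableEq β]

/-- No letter occurs twice. -/
def Linear : Regex β → Prop
  | eps => True
  | char _ => True
  | cat r s => r.Linear ∧ s.Linear ∧ Disjoint r.letters s.letters
  | alt r s => r.Linear ∧ s.Linear ∧ Disjoint r.letters s.letters
  | star r => r.Linear
  | count r _ _ _ _ => r.Linear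

theorem mem_letters_mark {r : Regex β} {n : ℕ} {p : β × ℕ} (h : p ∈ (r.mark n).letters) :
    n ≤ p.2 ∧ p.2 < n + r.chars := by
  induction r generalizing n with
  | eps => simp [mark, letters] at h
  | char b =>
    simp only [mark, letters, Finset.mem_singleton] at h
    subst h
    simp [chars]
  | cat r s ihr ihs =>
    simp only [mark, letters, Finset.mem_union] at h
    simp only [chars]
    rcases h with h | h
    · have := ihr h; omega
    · have := ihs h; omega
  | alt r s ihr ihs =>
    simp only [mark, letters, Finset.mem_union] at h
    simp only [chars]
    rcases h with h | h
    · have := ihr h; omega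
    · have := ihs h; omega
  | star r ih => exact ih h
  | count r lo hi hpos hle ih => exact ih h

theorem disjoint_mark (r s : Regex β) (n : ℕ) :
    Disjoint (r.mark n).letters (s.mark (n + r.chars)).letters := by
  rw [Finset.disjoint_left]
  intro p h1 h2
  have := mem_letters_mark h1
  have := mem_letters_mark h2
  omega

theorem linear_mark (r : Regex β) (n : ℕ) : (r.mark n).Linear := by
  induction r generalizing n with
  | eps => trivial
  | char b => trivial
  | cat r s ihr ihs => exact ⟨ihr _, ihs _, disjoint_mark r s n⟩
  | alt r s ihr ihs => exact ⟨ihr _, ihs _, disjoint_mark r s n⟩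
  | star r ih => exact ih n
  | count r lo hi hpos hle ih => exact ih n

theorem card_letters {r : Regex β} (h : r.Linear) : r.letters.card = r.chars := by
  induction r with
  | eps => rfl
  | char b => rfl
  | cat r s ihr ihs =>
    rw [letters, Finset.card_union_of_disjoint h.2.2, ihr h.1, ihs h.2.1, chars]
  | alt r s ihr ihs =>
    rw [letters, Finset.card_union_of_disjoint h.2.2, ihr h.1, ihs h.2.1, chars]
  | star r ih => exact ih h
  | count r lo hi hpos hle ih => exact ih h

/-! ### Sub-expressions, first and last letters, nesting. -/

theorem self_mem_subs (r : Regex β) : r ∈ r.subs := by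
  cases r <;> simp [subs]

theorem subs_trans {r s : Regex β} (h : r ∈ s.subs) : r.subs ⊆ s.subs := by
  induction s with
  | eps => simp only [subs, Finset.mem_singleton] at h; subst h; rfl
  | char b => simp only [subs, Finset.mem_singleton] at h; subst h; rfl
  | cat s t ihs iht =>
    simp only [subs, Finset.mem_insert, Finset.mem_union] at h
    rcases h with rfl | h | h
    · rfl
    · exact (ihs h).trans fun x hx => by simp [subs, hx]
    · exact (iht h).trans fun x hx => by simp [subs, hx]
  | alt s t ihs iht =>
    simp only [subs, Finset.mem_insert, Finset.mem_union] at h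
    rcases h with rfl | h | h
    · rfl
    · exact (ihs h).trans fun x hx => by simp [subs, hx]
    · exact (iht h).trans fun x hx => by simp [subs, hx]
  | star s ih =>
    simp only [subs, Finset.mem_insert] at h
    rcases h with rfl | h
    · rfl
    · exact (ih h).trans fun x hx => by simp [subs, hx]
  | count s lo hi hpos hle ih =>
    simp only [subs, Finset.mem_insert] at h
    rcases h with rfl | h
    · rfl
    · exact (ih h).trans fun x hx => by simp [subs, hx]

/-- A property that passes to immediate sub-expressions passes to all sub-expressions. -/
theorem of_mem_subs {P : Regex β → Prop} (h1 : ∀ r s, P (cat r s) → P r ∧ P s)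
    (h2 : ∀ r s, P (alt r s) → P r ∧ P s) (h3 : ∀ r, P (star r) → P r)
    (h4 : ∀ r lo hi hpos hle, P (count r lo hi hpos hle) → P r) {r s : Regex β}
    (h : r ∈ s.subs) (hs : P s) : P r := by
  induction s with
  | eps => simp only [subs, Finset.mem_singleton] at h; subst h; exact hs
  | char b => simp only [subs, Finset.mem_singleton] at h; subst h; exact hs
  | cat s t ihs iht =>
    simp only [subs, Finset.mem_insert, Finset.mem_union] at h
    rcases h with rfl | h | h
    · exact hs
    · exact ihs h (h1 _ _ hs).1
    · exact iht h (h1 _ _ hs).2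
  | alt s t ihs iht =>
    simp only [subs, Finset.mem_insert, Finset.mem_union] at h
    rcases h with rfl | h | h
    · exact hs
    · exact ihs h (h2 _ _ hs).1
    · exact iht h (h2 _ _ hs).2
  | star s ih =>
    simp only [subs, Finset.mem_insert] at h
    rcases h with rfl | h
    · exact hs
    · exact ih h (h3 _ hs)
  | count s lo hi hpos hle ih =>
    simp only [subs, Finset.mem_insert] at h
    rcases h with rfl | h
    · exact hs
    · exact ih h (h4 _ _ _ _ _ hs)

theorem Linear.of_mem_subs {r s : Regex β} (h : r ∈ s.subs) (hs : s.Linear) : r.Linear :=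
  Regex.of_mem_subs (P := Linear) (fun _ _ h => ⟨h.1, h.2.1⟩) (fun _ _ h => ⟨h.1, h.2.1⟩)
    (fun _ h => h) (fun _ _ _ _ _ h => h) h hs

theorem CountPos.of_mem_subs {r s : Regex β} (h : r ∈ s.subs) (hs : s.CountPos) : r.CountPos :=
  Regex.of_mem_subs (P := CountPos) (fun _ _ h => h) (fun _ _ h => h)
    (fun _ h => h) (fun _ _ _ _ _ h => h.2) h hs

theorem Flat.of_mem_subs {r s : Regex β} (h : r ∈ s.subs) (hs : s.Flat) : r.Flat :=
  Regex.of_mem_subs (P := Flat) (fun _ _ h => h) (fun _ _ h => h)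
    (fun _ h => h) (fun _ _ _ _ _ h => NoCount.flat h) h hs

theorem NoCount.of_mem_subs {r s : Regex β} (h : r ∈ s.subs) (hs : s.NoCount) : r.NoCount :=
  Regex.of_mem_subs (P := NoCount) (fun _ _ h => h) (fun _ _ h => h)
    (fun _ h => h) (fun _ _ _ _ _ h => h.elim) h hs

theorem letters_subset {r s : Regex β} (h : r ∈ s.subs) : r.letters ⊆ s.letters :=
  Regex.of_mem_subs (P := fun t => t.letters ⊆ s.letters)
    (fun _ _ h => Finset.union_subset_iff.1 h) (fun _ _ h => Finset.union_subset_iff.1 h)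
    (fun _ h => h) (fun _ _ _ _ _ h => h) h subset_rfl

theorem followCat_subset {r s : Regex β} (h : r ∈ s.subs) : r.followCat ⊆ s.followCat :=
  Regex.of_mem_subs (P := fun t => t.followCat ⊆ s.followCat)
    (fun _ _ h => Finset.union_subset_iff.1 (Finset.union_subset_iff.1 h).1)
    (fun _ _ h => Finset.union_subset_iff.1 h)
    (fun _ h => h) (fun _ _ _ _ _ h => h) h subset_rfl

theorem first_subset (r : Regex β) : r.first ⊆ r.letters := by
  induction r with
  | cat r s ihr ihs =>
    simp only [first, letters]
    split_ifs
    · exact Finset.union_subset_union ihr ihs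
    · exact ihr.trans Finset.subset_union_left
  | alt r s ihr ihs => exact Finset.union_subset_union ihr ihs
  | _ => simp_all [first, letters]

theorem last_subset (r : Regex β) : r.last ⊆ r.letters := by
  induction r with
  | cat r s ihr ihs =>
    simp only [last, letters]
    split_ifs
    · exact Finset.union_subset_union ihr ihs
    · exact ihs.trans Finset.subset_union_right
  | alt r s ihr ihs => exact Finset.union_subset_union ihr ihs
  | _ => simp_all [last, letters]

theorem followCat_letters {r : Regex β} {p q : β} (h : (p, q) ∈ r.followCat) :
    p ∈ r.letters ∧ q ∈ r.letters := by
  induction r with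
  | cat r s ihr ihs =>
    simp only [followCat, Finset.mem_union, Finset.mem_product] at h
    simp only [letters, Finset.mem_union]
    rcases h with (h | h) | h
    · have := ihr h; tauto
    · have := ihs h; tauto
    · have := last_subset _ h.1; have := first_subset _ h.2; tauto
  | alt r s ihr ihs =>
    simp only [followCat, Finset.mem_union] at h
    simp only [letters, Finset.mem_union]
    rcases h with h | h
    · have := ihr h; tauto
    · have := ihs h; tauto
  | _ => simp_all [followCat, letters]

theorem exists_cat_of_followCat {r : Regex β} {p q : β} (h : (p, q) ∈ r.followCat) :
    ∃ s t, cat s t ∈ r.subs ∧ p ∈ s.last ∧ q ∈ t.first := by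
  induction r with
  | eps => simp [followCat] at h
  | char b => simp [followCat] at h
  | cat r s ihr ihs =>
    simp only [followCat, Finset.mem_union, Finset.mem_product] at h
    rcases h with (h | h) | h
    · obtain ⟨u, v, h1, h2⟩ := ihr h
      exact ⟨u, v, by simp [subs, h1], h2⟩
    · obtain ⟨u, v, h1, h2⟩ := ihs h
      exact ⟨u, v, by simp [subs, h1], h2⟩
    · exact ⟨r, s, by simp [subs], h⟩
  | alt r s ihr ihs =>
    simp only [followCat, Finset.mem_union] at h
    rcases h with h | h
    · obtain ⟨u, v, h1, h2⟩ := ihr h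
      exact ⟨u, v, by simp [subs, h1], h2⟩
    · obtain ⟨u, v, h1, h2⟩ := ihs h
      exact ⟨u, v, by simp [subs, h1], h2⟩
  | star r ih =>
    obtain ⟨u, v, h1, h2⟩ := ih h
    exact ⟨u, v, by simp [subs, h1], h2⟩
  | count r lo hi hpos hle ih =>
    obtain ⟨u, v, h1, h2⟩ := ih h
    exact ⟨u, v, by simp [subs, h1], h2⟩

theorem followCat_of_cat {r s t : Regex β} (h : cat s t ∈ r.subs) {p q : β} (hp : p ∈ s.last)
    (hq : q ∈ t.first) : (p, q) ∈ r.followCat :=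
  followCat_subset h (by simp [followCat, hp, hq])

/-- No language denoted by these regexes is empty, so there is either the empty word or a letter to
begin with. -/
theorem nullable_or_first (r : Regex β) : r.nullable = true ∨ r.first.Nonempty := by
  induction r with
  | eps => exact Or.inl rfl
  | char b => exact Or.inr ⟨b, by simp [first]⟩
  | cat r s ihr ihs =>
    simp only [nullable, first, Bool.and_eq_true]
    rcases ihr with h | h
    · rw [if_pos h]
      rcases ihs with h' | h'
      · exact Or.inl ⟨h, h'⟩
      · exact Or.inr (h'.mono Finset.subset_union_right)
    · split_ifs
      · exact Or.inr (h.mono Finset.subset_union_left)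
      · exact Or.inr h
  | alt r s ihr ihs =>
    simp only [nullable, first, Bool.or_eq_true]
    rcases ihr with h | h
    · exact Or.inl (Or.inl h)
    · exact Or.inr (h.mono Finset.subset_union_left)
  | star r ih => exact Or.inl rfl
  | count r lo hi hpos hle ih =>
    simp only [nullable, first, Bool.or_eq_true]
    rcases ih with h | h
    · exact Or.inl (Or.inr h)
    · exact Or.inr h

theorem first_nonempty {r : Regex β} (h : r.letters.Nonempty) : r.first.Nonempty := by
  induction r with
  | cat r s ihr ihs =>
    rcases nullable_or_first r with h' | h'
    · simp only [first, if_pos h']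
      rw [letters, Finset.union_nonempty] at h
      rw [Finset.union_nonempty]
      exact h.imp ihr ihs
    · simp only [first]
      split_ifs
      · exact h'.mono Finset.subset_union_left
      · exact h'
  | alt r s ihr ihs =>
    rw [letters, Finset.union_nonempty] at h
    rw [first, Finset.union_nonempty]
    exact h.imp ihr ihs
  | _ => simp_all [first, letters]

/-- In a linear regex the two branches of a `cat` or `alt` share no letters, so two sub-expressions
with a common letter always lie in the same branch. -/
theorem laminar {r s t : Regex β} (hr : r.Linear) (hs : s ∈ r.subs) (ht : t ∈ r.subs) {p : β}
    (hps : p ∈ s.letters) (hpt : p ∈ t.letters) : s ∈ t.subs ∨ t ∈ s.subs := by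
  induction r with
  | eps =>
    simp only [subs, Finset.mem_singleton] at hs ht
    subst hs; subst ht; exact Or.inl (self_mem_subs _)
  | char b =>
    simp only [subs, Finset.mem_singleton] at hs ht
    subst hs; subst ht; exact Or.inl (self_mem_subs _)
  | cat u v ihu ihv =>
    have hd := Finset.disjoint_left.1 hr.2.2
    have hs' := hs
    have ht' := ht
    simp only [subs, Finset.mem_insert, Finset.mem_union] at hs ht
    rcases hs with rfl | hs | hs
    · exact Or.inr ht'
    · rcases ht with rfl | ht | ht
      · exact Or.inl hs'
      · exact ihu hr.1 hs ht
      · exact absurd (letters_subset ht hpt) (hd (letters_subset hs hps))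
    · rcases ht with rfl | ht | ht
      · exact Or.inl hs'
      · exact absurd (letters_subset hs hps) (hd (letters_subset ht hpt))
      · exact ihv hr.2.1 hs ht
  | alt u v ihu ihv =>
    have hd := Finset.disjoint_left.1 hr.2.2
    have hs' := hs
    have ht' := ht
    simp only [subs, Finset.mem_insert, Finset.mem_union] at hs ht
    rcases hs with rfl | hs | hs
    · exact Or.inr ht'
    · rcases ht with rfl | ht | ht
      · exact Or.inl hs'
      · exact ihu hr.1 hs ht
      · exact absurd (letters_subset ht hpt) (hd (letters_subset hs hps))
    · rcases ht with rfl | ht | ht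
      · exact Or.inl hs'
      · exact absurd (letters_subset hs hps) (hd (letters_subset ht hpt))
      · exact ihv hr.2.1 hs ht
  | star u ih =>
    have hs' := hs
    have ht' := ht
    simp only [subs, Finset.mem_insert] at hs ht
    rcases hs with rfl | hs
    · exact Or.inr ht'
    · rcases ht with rfl | ht
      · exact Or.inl hs'
      · exact ih hr hs ht
  | count u lo hi hpos hle ih =>
    have hs' := hs
    have ht' := ht
    simp only [subs, Finset.mem_insert] at hs ht
    rcases hs with rfl | hs
    · exact Or.inr ht'
    · rcases ht with rfl | ht
      · exact Or.inl hs'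
      · exact ih hr hs ht

/-- The letter `q` occurs only inside `t`, so if it can begin a word of `s` then `t` sits at the
front of `s`, and whatever begins `t` begins `s`. This is why the entries into a counted expression
are always available together. -/
theorem first_of_mem_subs {s t : Regex β} (hs : s.Linear) (ht : t ∈ s.subs) {q : β}
    (hq : q ∈ t.letters) (hqs : q ∈ s.first) : t.first ⊆ s.first ∧ q ∈ t.first := by
  induction s with
  | eps => simp [first] at hqs
  | char b =>
    simp only [subs, Finset.mem_singleton] at ht
    subst ht; exact ⟨subset_rfl, hqs⟩
  | cat u v ihu ihv =>
    have hd := Finset.disjoint_left.1 hs.2.2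
    simp only [subs, Finset.mem_insert, Finset.mem_union] at ht
    rcases ht with rfl | ht | ht
    · exact ⟨subset_rfl, hqs⟩
    · have hqu := letters_subset ht hq
      simp only [first] at hqs ⊢
      split_ifs at hqs ⊢
      · rcases Finset.mem_union.1 hqs with h | h
        · exact ⟨(ihu hs.1 ht h).1.trans Finset.subset_union_left, (ihu hs.1 ht h).2⟩
        · exact absurd (first_subset _ h) (hd hqu)
      · exact ihu hs.1 ht hqs
    · have hqv := letters_subset ht hq
      simp only [first] at hqs ⊢
      split_ifs at hqs ⊢
      · rcases Finset.mem_union.1 hqs with h | h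
        · exact absurd hqv (hd (first_subset _ h))
        · exact ⟨(ihv hs.2.1 ht h).1.trans Finset.subset_union_right, (ihv hs.2.1 ht h).2⟩
      · exact absurd hqv (hd (first_subset _ hqs))
  | alt u v ihu ihv =>
    have hd := Finset.disjoint_left.1 hs.2.2
    simp only [subs, Finset.mem_insert, Finset.mem_union] at ht
    rcases ht with rfl | ht | ht
    · exact ⟨subset_rfl, hqs⟩
    · have hqu := letters_subset ht hq
      simp only [first] at hqs ⊢
      rcases Finset.mem_union.1 hqs with h | h
      · exact ⟨(ihu hs.1 ht h).1.trans Finset.subset_union_left, (ihu hs.1 ht h).2⟩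
      · exact absurd (first_subset _ h) (hd hqu)
    · have hqv := letters_subset ht hq
      simp only [first] at hqs ⊢
      rcases Finset.mem_union.1 hqs with h | h
      · exact absurd hqv (hd (first_subset _ h))
      · exact ⟨(ihv hs.2.1 ht h).1.trans Finset.subset_union_right, (ihv hs.2.1 ht h).2⟩
  | star u ih =>
    simp only [subs, Finset.mem_insert] at ht
    rcases ht with rfl | ht
    · exact ⟨subset_rfl, hqs⟩
    · exact ih hs ht hqs
  | count u lo hi hpos hle ih =>
    simp only [subs, Finset.mem_insert] at ht
    rcases ht with rfl | ht
    · exact ⟨subset_rfl, hqs⟩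
    · exact ih hs ht hqs

/-- One step between letters of a word of the language, by a concatenation or an iteration. -/
def Follow (r : Regex β) (p q : β) : Prop :=
  (p, q) ∈ r.followCat ∨ ∃ s ∈ r.subs, s.isIter = true ∧ p ∈ s.last ∧ q ∈ s.first

theorem Follow.mono {r s : Regex β} (h : r ∈ s.subs) {p q : β} (hf : r.Follow p q) :
    s.Follow p q := by
  rcases hf with hf | ⟨t, ht, hf⟩
  · exact Or.inl (followCat_subset h hf)
  · exact Or.inr ⟨t, subs_trans h ht, hf⟩

/-- Every occurrence can be continued to the end of the expression. It provides the liveness field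
of `FlatCA`, which excludes dead states inside the scope of a counter. -/
theorem exists_path_last (r : Regex β) {p : β} (hp : p ∈ r.letters) :
    ∃ q ∈ r.last, Relation.ReflTransGen r.Follow p q := by
  induction r generalizing p with
  | eps => simp [letters] at hp
  | char b => exact ⟨p, hp, .refl⟩
  | cat r s ihr ihs =>
    have hr : r ∈ (cat r s).subs := by simp [subs, self_mem_subs]
    have hs : s ∈ (cat r s).subs := by simp [subs, self_mem_subs]
    have key : ∀ {p}, p ∈ s.letters →
        ∃ q ∈ (cat r s).last, Relation.ReflTransGen (cat r s).Follow p q := by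
      intro p hp
      obtain ⟨q, hq, h⟩ := ihs hp
      refine ⟨q, ?_, h.lift id fun _ _ => Follow.mono hs⟩
      simp only [last]
      split_ifs
      · exact Finset.mem_union_right _ hq
      · exact hq
    rcases Finset.mem_union.1 hp with hp | hp
    · obtain ⟨q, hq, h⟩ := ihr hp
      have h := h.lift id fun _ _ => Follow.mono hr
      rcases nullable_or_first s with hn | ⟨q', hq'⟩
      · exact ⟨q, by simp [last, hn, hq], h⟩
      · obtain ⟨q'', hq'', h'⟩ := key (first_subset _ hq')
        exact ⟨q'', hq'', (h.tail (Or.inl (by simp [followCat, hq, hq']))).trans h'⟩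
    · exact key hp
  | alt r s ihr ihs =>
    rcases Finset.mem_union.1 hp with hp | hp
    · obtain ⟨q, hq, h⟩ := ihr hp
      exact ⟨q, Finset.mem_union_left _ hq, h.lift id fun _ _ =>
        Follow.mono (by simp [subs, self_mem_subs])⟩
    · obtain ⟨q, hq, h⟩ := ihs hp
      exact ⟨q, Finset.mem_union_right _ hq, h.lift id fun _ _ =>
        Follow.mono (by simp [subs, self_mem_subs])⟩
  | star r ih =>
    obtain ⟨q, hq, h⟩ := ih hp
    exact ⟨q, hq, h.lift id fun _ _ => Follow.mono (by simp [subs, self_mem_subs])⟩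
  | count r lo hi hpos hle ih =>
    obtain ⟨q, hq, h⟩ := ih hp
    exact ⟨q, hq, h.lift id fun _ _ => Follow.mono (by simp [subs, self_mem_subs])⟩

theorem exists_eq_count {M T : Regex β} (h : T ∈ M.counted) :
    ∃ r lo hi hpos hle, T = count r lo hi hpos hle ∧ T ∈ M.subs := by
  simp only [counted, Finset.mem_filter] at h
  obtain ⟨h1, h2⟩ := h
  cases T <;> simp_all [isCount]

theorem counted_not_mem_noCount {M T r : Regex β} (h : T ∈ M.counted) (hr : r.NoCount) :
    T ∉ r.subs := by
  intro hT
  obtain ⟨s, lo, hi, hpos, hle, rfl, -⟩ := exists_eq_count h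
  exact NoCount.of_mem_subs hT hr

theorem counted_eq_of_mem_subs {M T T' : Regex β} (hM : M.Flat) (h : T ∈ M.counted)
    (h' : T' ∈ M.counted) (hs : T ∈ T'.subs) : T = T' := by
  obtain ⟨r, lo, hi, hpos, hle, rfl, hm⟩ := exists_eq_count h'
  have hf : r.NoCount := Flat.of_mem_subs hm hM
  simp only [subs, Finset.mem_insert] at hs
  exact hs.resolve_right (counted_not_mem_noCount h hf)

/-- The decisive consequence of flatness: two counted sub-expressions with a common letter are
nested by linearity, and nested ones coincide. Scopes of distinct counters are disjoint. -/
theorem counted_eq_of_letters {M T T' : Regex β} (hM : M.Flat) (hL : M.Linear)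
    (h : T ∈ M.counted) (h' : T' ∈ M.counted) {p : β} (hp : p ∈ T.letters)
    (hp' : p ∈ T'.letters) : T = T' := by
  rcases laminar hL (Finset.mem_filter.1 h).1 (Finset.mem_filter.1 h').1 hp hp' with h1 | h1
  · exact counted_eq_of_mem_subs hM h h' h1
  · exact (counted_eq_of_mem_subs hM h' h h1).symm

end Regex

/-! ### Counting automata of regexes with flat counting -/

/-- The guard `x ≥ k`, as a conjunction. -/
def geGuard {X : Type} (lo : X → ℕ) (x : X) : Guard X := .and (.atom (.ge (lo x), x)) .tt

/-- The guard `x < k`, as a conjunction. -/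
def ltGuard {X : Type} (hi : X → ℕ∞) (x : X) : Guard X := .and (.atom (.lt (hi x), x)) .tt

/-- What the augmented determinization uses of the counting automata of regexes with flat
counting: every counter `x` has a scope `mem x`, where it is kept along the true guard, it is set to
`1` at the states `fst x`, and it is tested or incremented only at the states `lst x`. -/
structure FlatCA {α X Q : Type} (A : CA α X Q) where
  lo : X → ℕ
  hi : X → ℕ∞
  q₀ : Q
  lab : Q → Option α
  mem : X → Finset Q
  fst : X → Finset Q
  lst : X → Finset Q
  hi_pos : ∀ x, 0 < hi x
  fst_nonempty : ∀ x, (fst x).Nonempty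
  fst_subset : ∀ x, fst x ⊆ mem x
  lst_subset : ∀ x, lst x ⊆ mem x
  mem_inj : ∀ {x y q}, q ∈ mem x → q ∈ mem y → x = y
  lab_q₀ : lab q₀ = none
  not_mem : ∀ x, q₀ ∉ mem x
  lab_tgt : ∀ d ∈ A.trans, lab d.tgt = some d.letter
  update_zero : ∀ d ∈ A.trans, ∀ x, d.tgt ∉ mem x → d.update x = .zero
  update_mem : ∀ d ∈ A.trans, ∀ x, d.tgt ∈ mem x →
    (d.update x = .one ∧ d.tgt ∈ fst x ∧ ∀ q ∈ fst x, ∃ d' ∈ A.trans, d'.src = d.src ∧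
      d'.tgt = q ∧ d'.guard = d.guard ∧ d'.update x = .one) ∨
    (d.update x = .var x ∧ d.guard = .tt ∧ d.src ∈ mem x) ∨
    (d.update x = .succ (.var x) ∧ d.guard = ltGuard hi x ∧ d.src ∈ lst x ∧ d.tgt ∈ fst x)
  guard_cases : ∀ d ∈ A.trans, d.guard = .tt ∨
    ∃ x, d.src ∈ lst x ∧ (d.guard = geGuard lo x ∨ d.guard = ltGuard hi x)
  exists_inc : ∀ x, ∀ p ∈ lst x, ∀ q ∈ fst x, ∃ d ∈ A.trans, d.src = p ∧ d.tgt = q ∧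
    d.guard = ltGuard hi x ∧ d.update x = .succ (.var x)
  live : ∀ x, ∀ p ∈ mem x, ∃ q ∈ lst x, Relation.ReflTransGen
    (fun p q => ∃ d ∈ A.trans, d.src = p ∧ d.tgt = q ∧ d.update x = .var x) p q
  init_eq : A.init = {(q₀, fun _ => 0)}
  final_cases : ∀ q, A.final q = .tt ∨ A.final q = .ff ∨
    ∃ x, q ∈ lst x ∧ A.final q = geGuard lo x

/-- At most one counter satisfies the condition, so the conjunction has at most one proper conjunct.
The trailing `.tt` comes from `Form.conj` and explains the shape of `geGuard` and `ltGuard`. -/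
theorem conj_filter_cases {X : Type} [Fintype X] (P : X → Prop) [DecidablePred P]
    (g : X → Guard X) (h : ∀ x y, P x → P y → x = y) :
    (Form.conj ((Finset.univ.filter P).toList.map g) = .tt ∧ ∀ x, ¬ P x) ∨
    ∃ x, P x ∧ Form.conj ((Finset.univ.filter P).toList.map g) = .and (g x) .tt := by
  by_cases hx : ∃ x, P x
  · obtain ⟨x, hx⟩ := hx
    have : Finset.univ.filter P = {x} := by
      ext y
      simp only [Finset.mem_filter, Finset.mem_univ, true_and, Finset.mem_singleton]
      exact ⟨fun hy => h _ _ hy hx, fun hy => hy ▸ hx⟩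
    refine Or.inr ⟨x, hx, ?_⟩
    simp [this, Form.conj]
  · push Not at hx
    refine Or.inl ⟨?_, hx⟩
    simp [hx, Form.conj]

namespace Regex

variable {α : Type} [DecidableEq α]

/-- The states for the occurrences in a set. -/
def posSet (M : Regex (α × ℕ)) (s : Finset (α × ℕ)) : Finset (Option M.Pos) :=
  (Finset.univ.filter fun p : M.Pos => p.1 ∈ s).image some

theorem mem_posSet {M : Regex (α × ℕ)} {s : Finset (α × ℕ)} {q : Option M.Pos} :
    q ∈ M.posSet s ↔ ∃ p : M.Pos, q = some p ∧ p.1 ∈ s := by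
  simp [posSet, eq_comm, and_comm]

theorem some_mem_posSet {M : Regex (α × ℕ)} {s : Finset (α × ℕ)} {p : M.Pos} :
    some p ∈ M.posSet s ↔ p.1 ∈ s := by
  simp [posSet]

/-! ### The automaton of a linear regex as a `FlatCA`. -/

section Glushkov

variable {M : Regex (α × ℕ)}

theorem mem_glushkov_trans {d : Trans α (Option M.Pos) (Guard M.Ctr) (M.Ctr → CTerm M.Ctr)} :
    d ∈ M.glushkov.trans ↔ (∃ q : M.Pos, q.1 ∈ M.first ∧ d = M.startTrans q) ∨
      (∃ p q : M.Pos, (p.1, q.1) ∈ M.followCat ∧ d = M.catTrans p q) ∨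
      ∃ S ∈ M.iterated, ∃ p q : M.Pos, p.1 ∈ S.last ∧ q.1 ∈ S.first ∧ d = M.iterTrans S p q := by
  simp only [glushkov, Finset.mem_union, Finset.mem_image, Finset.mem_filter, Finset.mem_univ,
    true_and, Finset.mem_biUnion, Prod.exists, or_assoc]
  refine or_congr ?_ (or_congr ?_ ?_)
  · exact exists_congr fun q => and_congr_right fun _ => eq_comm
  · exact exists_congr fun p => exists_congr fun q => and_congr_right fun _ => eq_comm
  · refine exists_congr fun S => and_congr_right fun _ => exists_congr fun p =>
      exists_congr fun q => ?_
    rw [and_assoc, @eq_comm _ d]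

variable (hF : M.Flat) (hL : M.Linear)

include hF hL in
theorem ctr_eq {T T' : M.Ctr} {p : α × ℕ} (h : p ∈ T.1.letters) (h' : p ∈ T'.1.letters) :
    T = T' :=
  Subtype.ext (counted_eq_of_letters hF hL T.2 T'.2 h h')

theorem ctr_mem_subs (T : M.Ctr) : T.1 ∈ M.subs := (Finset.mem_filter.1 T.2).1

include hF hL in
theorem catTrans_guard (p q : M.Pos) :
    ((M.catTrans p q).guard = .tt ∧ ∀ T : M.Ctr, ¬ (p.1 ∈ T.1.last ∧ q.1 ∉ T.1.letters)) ∨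
    ∃ T : M.Ctr, (p.1 ∈ T.1.last ∧ q.1 ∉ T.1.letters) ∧
      (M.catTrans p q).guard = geGuard (fun T : M.Ctr => T.1.lower) T :=
  conj_filter_cases _ _ fun _ _ h h' => ctr_eq hF hL (last_subset _ h.1) (last_subset _ h'.1)

/-- Flatness leaves no counter properly inside `S`, so only the test of the upper bound remains. -/
theorem iterTrans_guard_counted (hF : M.Flat) {S : Regex (α × ℕ)} (hS : S ∈ M.counted)
    (p q : M.Pos) :
    (M.iterTrans S p q).guard = ltGuard (fun T : M.Ctr => T.1.upper) ⟨S, hS⟩ := by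
  have : (Finset.univ.filter fun T : M.Ctr => T.1 ∈ S.subs ∧ T.1 ≠ S ∧ p.1 ∈ T.1.last) = ∅ := by
    ext T
    simp only [Finset.mem_filter, Finset.mem_univ, true_and, Finset.notMem_empty, iff_false]
    exact fun h => h.2.1 (counted_eq_of_mem_subs hF T.2 hS h.1)
  simp only [iterTrans]
  rw [this, dif_pos hS]
  simp [Form.conj, ltGuard]

include hF hL in
theorem iterTrans_guard_star {S : Regex (α × ℕ)} (hS : S ∉ M.counted) (p q : M.Pos) :
    ((M.iterTrans S p q).guard = .tt ∧
      ∀ T : M.Ctr, ¬ (T.1 ∈ S.subs ∧ T.1 ≠ S ∧ p.1 ∈ T.1.last)) ∨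
    ∃ T : M.Ctr, (T.1 ∈ S.subs ∧ T.1 ≠ S ∧ p.1 ∈ T.1.last) ∧
      (M.iterTrans S p q).guard = geGuard (fun T : M.Ctr => T.1.lower) T := by
  simp only [iterTrans]
  rw [dif_neg hS, List.nil_append]
  exact conj_filter_cases _ _ fun _ _ h h' =>
    ctr_eq hF hL (last_subset _ h.2.2) (last_subset _ h'.2.2)

theorem mem_iterated_of_counted {S : Regex (α × ℕ)} (hS : S ∈ M.counted) : S ∈ M.iterated := by
  obtain ⟨r, lo, hi, hpos, hle, rfl, h⟩ := exists_eq_count hS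
  exact Finset.mem_filter.2 ⟨h, rfl⟩

theorem not_counted_self_cat {r s : Regex (α × ℕ)} : cat r s ∉ M.counted := by
  exact fun h => Bool.false_ne_true (Finset.mem_filter.1 h).2

/-- A concatenation that enters a counted expression from outside. -/
theorem entered_by_cat (hL : M.Linear) {T : M.Ctr} {p q : M.Pos} {r s : Regex (α × ℕ)}
    (hc : cat r s ∈ M.subs) (hp : p.1 ∈ r.last) (hq : q.1 ∈ s.first)
    (hqT : q.1 ∈ T.1.letters) (hpT : p.1 ∉ T.1.letters) :
    T.1.first ⊆ s.first ∧ q.1 ∈ T.1.first := by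
  have hlin := Linear.of_mem_subs hc hL
  have hqs : q.1 ∈ s.letters := first_subset _ hq
  rcases laminar hL (ctr_mem_subs T) hc hqT (by simp [letters, hqs]) with h | h
  · simp only [subs, Finset.mem_insert, Finset.mem_union] at h
    rcases h with h | h | h
    · exact absurd (h ▸ T.2) not_counted_self_cat
    · exact absurd hqs (Finset.disjoint_left.1 hlin.2.2 (letters_subset h hqT))
    · exact first_of_mem_subs hlin.2.1 h hqT hq
  · exact absurd (letters_subset h (by simp [letters, last_subset _ hp])) hpT

theorem catTrans_update_var {T : M.Ctr} {p q : M.Pos} (hp : p.1 ∈ T.1.letters)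
    (hq : q.1 ∈ T.1.letters) : (M.catTrans p q).update T = .var T := by
  simp [catTrans, hp, hq]

theorem catTrans_update_one {T : M.Ctr} {p q : M.Pos} (hp : p.1 ∉ T.1.letters)
    (hq : q.1 ∈ T.1.first) : (M.catTrans p q).update T = .one := by
  simp [catTrans, hp, hq]

theorem iterTrans_update_one {T : M.Ctr} {S : Regex (α × ℕ)} {p q : M.Pos} (hT : T.1 ∈ S.subs)
    (hne : T.1 ≠ S) (hq : q.1 ∈ T.1.first) : (M.iterTrans S p q).update T = .one := by
  simp [iterTrans, hT, hne, hq]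

theorem iterTrans_update_var {T : M.Ctr} {S : Regex (α × ℕ)} {p q : M.Pos} (hT : T.1 ∉ S.subs)
    (hp : p.1 ∈ T.1.letters) (hq : q.1 ∈ T.1.letters) :
    (M.iterTrans S p q).update T = .var T := by
  have hne : T.1 ≠ S := fun h => hT (h ▸ self_mem_subs _)
  simp [iterTrans, hT, hne, hq, hp]

/-- The body `r` of a counted expression contains no counter, so any step inside `r` is a
concatenation or an iteration of an expression not containing `T`; both keep the counter. -/
theorem exists_follow_trans (hF : M.Flat) {T : M.Ctr} {p q : α × ℕ} {r : Regex (α × ℕ)}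
    {lo : ℕ} {hi : ℕ∞} {hpos : 0 < hi} {hle : (lo : ℕ∞) ≤ hi}
    (hr : T.1 = count r lo hi hpos hle) (h : r.Follow p q) (hp : p ∈ M.letters)
    (hq : q ∈ M.letters) : p ∈ r.letters ∧ q ∈ r.letters ∧
      ∃ d ∈ M.glushkov.trans, d.src = some ⟨p, hp⟩ ∧ d.tgt = some ⟨q, hq⟩ ∧
        d.update T = .var T := by
  have hrT : r ∈ T.1.subs := by simp [hr, subs, self_mem_subs]
  have hrM : r ∈ M.subs := subs_trans (ctr_mem_subs T) hrT
  have hl : T.1.letters = r.letters := by rw [hr]; rfl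
  have hnc : r.NoCount := by
    have := Flat.of_mem_subs (ctr_mem_subs T) hF
    rw [hr] at this
    exact this
  rcases h with h | ⟨S, hS, hi, h1, h2⟩
  · obtain ⟨hp', hq'⟩ := followCat_letters h
    refine ⟨hp', hq', M.catTrans ⟨p, hp⟩ ⟨q, hq⟩, ?_, rfl, rfl, ?_⟩
    · rw [mem_glushkov_trans]
      exact Or.inr (Or.inl ⟨_, _, followCat_subset hrM h, rfl⟩)
    · exact catTrans_update_var (by rwa [hl]) (by rwa [hl])
  · have hp' := letters_subset hS (last_subset _ h1)
    have hq' := letters_subset hS (first_subset _ h2)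
    refine ⟨hp', hq', M.iterTrans S ⟨p, hp⟩ ⟨q, hq⟩, ?_, rfl, rfl, ?_⟩
    · rw [mem_glushkov_trans]
      exact Or.inr (Or.inr ⟨S, by simp [iterated, subs_trans hrM hS, hi], _, _, h1, h2, rfl⟩)
    · refine iterTrans_update_var (fun h => ?_) (by rwa [hl]) (by rwa [hl])
      exact counted_not_mem_noCount T.2 hnc (subs_trans hS h)

/-- The automaton of a linear regex with flat counting. -/
def glushkovFlat (hF : M.Flat) (hL : M.Linear) (hC : M.CountPos) : FlatCA M.glushkov where
  lo T := T.1.lower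
  hi T := T.1.upper
  q₀ := none
  lab q := q.map fun p => p.1.1
  mem T := M.posSet T.1.letters
  fst T := M.posSet T.1.first
  lst T := M.posSet T.1.last
  hi_pos T := by
    obtain ⟨r, lo, hi, hpos, hle, h, -⟩ := exists_eq_count T.2
    rw [h]; exact hpos
  fst_nonempty T := by
    obtain ⟨r, lo, hi, hpos, hle, h, -⟩ := exists_eq_count T.2
    have hlin := Linear.of_mem_subs (ctr_mem_subs T) hL
    have hcp := CountPos.of_mem_subs (ctr_mem_subs T) hC
    have : T.1.letters.Nonempty := by
      rw [← Finset.card_pos, card_letters hlin]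
      rw [h] at hcp ⊢
      exact Nat.pos_of_ne_zero hcp.1
    obtain ⟨q, hq⟩ := first_nonempty this
    exact ⟨some ⟨q, letters_subset (ctr_mem_subs T) (first_subset _ hq)⟩,
      some_mem_posSet.2 hq⟩
  fst_subset T q hq := by
    obtain ⟨p, rfl, hp⟩ := mem_posSet.1 hq
    exact some_mem_posSet.2 (first_subset _ hp)
  lst_subset T q hq := by
    obtain ⟨p, rfl, hp⟩ := mem_posSet.1 hq
    exact some_mem_posSet.2 (last_subset _ hp)
  mem_inj {T T' q} h h' := by
    obtain ⟨p, rfl, hp⟩ := mem_posSet.1 h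
    exact ctr_eq hF hL hp (some_mem_posSet.1 h')
  lab_q₀ := rfl
  not_mem T h := by
    obtain ⟨p, hp, -⟩ := mem_posSet.1 h
    exact absurd hp (by simp)
  lab_tgt d hd := by
    rcases mem_glushkov_trans.1 hd with ⟨q, -, rfl⟩ | ⟨p, q, -, rfl⟩ | ⟨S, -, p, q, -, -, rfl⟩ <;>
      rfl
  update_zero d hd T hT := by
    rcases mem_glushkov_trans.1 hd with ⟨q, -, rfl⟩ | ⟨p, q, -, rfl⟩ | ⟨S, hS, p, q, -, hq, rfl⟩
    · have : q.1 ∉ T.1.letters := fun h => hT (some_mem_posSet.2 h)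
      simp [startTrans, this]
    · have h1 : q.1 ∉ T.1.letters := fun h => hT (some_mem_posSet.2 h)
      have h2 : q.1 ∉ T.1.first := fun h => h1 (first_subset _ h)
      simp [catTrans, h1, h2]
    · have h1 : q.1 ∉ T.1.letters := fun h => hT (some_mem_posSet.2 h)
      have h2 : q.1 ∉ T.1.first := fun h => h1 (first_subset _ h)
      have h3 : T.1 ≠ S := fun h => h2 (h ▸ hq)
      simp [iterTrans, h1, h2, h3]
  update_mem d hd T hT := by
    rcases mem_glushkov_trans.1 hd with ⟨q, hq, rfl⟩ | ⟨p, q, hpq, rfl⟩ |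
      ⟨S, hS, p, q, hp, hq, rfl⟩
    · have h1 : q.1 ∈ T.1.letters := some_mem_posSet.1 hT
      obtain ⟨h2, h3⟩ := first_of_mem_subs hL (ctr_mem_subs T) h1 hq
      refine Or.inl ⟨by simp [startTrans, h1], some_mem_posSet.2 h3, fun q' hq' => ?_⟩
      obtain ⟨q', rfl, -⟩ := mem_posSet.1 hq'
      replace hq' := some_mem_posSet.1 hq'
      refine ⟨M.startTrans q', mem_glushkov_trans.2 (Or.inl ⟨q', h2 hq', rfl⟩), rfl, rfl, rfl, ?_⟩
      simp [startTrans, first_subset _ hq']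
    · have h1 : q.1 ∈ T.1.letters := some_mem_posSet.1 hT
      by_cases h2 : p.1 ∈ T.1.letters
      · refine Or.inr (Or.inl ⟨catTrans_update_var h2 h1, ?_, some_mem_posSet.2 h2⟩)
        -- A tested counter would have `p` in its scope, hence be `T`; but `q` does not leave `T`.
        rcases catTrans_guard hF hL p q with h | ⟨T', h, -⟩
        · exact h.1
        · exact absurd h1 (ctr_eq hF hL h2 (last_subset _ h.1) ▸ h.2)
      · obtain ⟨r, s, hc, hp, hq⟩ := exists_cat_of_followCat hpq
        obtain ⟨h3, h4⟩ := entered_by_cat hL hc hp hq h1 h2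
        refine Or.inl ⟨catTrans_update_one h2 h4, some_mem_posSet.2 h4, fun q' hq' => ?_⟩
        obtain ⟨q', rfl, -⟩ := mem_posSet.1 hq'
        replace hq' := some_mem_posSet.1 hq'
        refine ⟨M.catTrans p q', mem_glushkov_trans.2 (Or.inr (Or.inl
          ⟨p, q', followCat_of_cat hc hp (h3 hq'), rfl⟩)), rfl, rfl, ?_,
          catTrans_update_one h2 hq'⟩
        -- The guard depends on the target only through the counters that are left. Such a counter
        -- contains `p`, so it differs from `T`, and by disjointness it contains neither `q` nor
        -- `q'`.
        have : ∀ T' : M.Ctr, (p.1 ∈ T'.1.last ∧ q'.1 ∉ T'.1.letters) ↔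
            (p.1 ∈ T'.1.last ∧ q.1 ∉ T'.1.letters) := by
          intro T'
          refine and_congr_right fun hpT' => ?_
          have hne : T ≠ T' := fun h => h2 (h ▸ last_subset _ hpT')
          exact iff_of_true (fun h => hne (ctr_eq hF hL (first_subset _ hq') h))
            fun h => hne (ctr_eq hF hL h1 h)
        simp only [catTrans, this]
    · have h1 : q.1 ∈ T.1.letters := some_mem_posSet.1 hT
      have hSM : S ∈ M.subs := (Finset.mem_filter.1 hS).1
      by_cases h2 : T.1 = S
      · subst h2
        refine Or.inr (Or.inr ⟨by simp [iterTrans], iterTrans_guard_counted hF T.2 p q,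
          some_mem_posSet.2 hp, some_mem_posSet.2 hq⟩)
      · rcases laminar hL (ctr_mem_subs T) hSM h1 (first_subset _ hq) with h3 | h3
        · obtain ⟨h4, h5⟩ := first_of_mem_subs (Linear.of_mem_subs hSM hL) h3 h1 hq
          refine Or.inl ⟨iterTrans_update_one h3 h2 h5, some_mem_posSet.2 h5, fun q' hq' => ?_⟩
          obtain ⟨q', rfl, -⟩ := mem_posSet.1 hq'
          replace hq' := some_mem_posSet.1 hq'
          exact ⟨M.iterTrans S p q', mem_glushkov_trans.2 (Or.inr (Or.inr
            ⟨S, hS, p, q', hp, h4 hq', rfl⟩)), rfl, rfl, rfl, iterTrans_update_one h3 h2 hq'⟩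
        · have h4 : p.1 ∈ T.1.letters := letters_subset h3 (last_subset _ hp)
          by_cases h5 : T.1 ∈ S.subs
          · by_cases h6 : S ∈ M.counted
            · exact absurd (counted_eq_of_mem_subs hF T.2 h6 h5) h2
            · obtain ⟨r, lo, hi, hpos, hle, hr, -⟩ := exists_eq_count T.2
              have hnc : r.NoCount := by
                have := Flat.of_mem_subs (ctr_mem_subs T) hF
                rw [hr] at this
                exact this
              rw [hr] at h3
              simp only [subs, Finset.mem_insert] at h3
              rcases h3 with h3 | h3
              · exact absurd (hr.trans h3.symm) h2
              · exact absurd (subs_trans h3 h5) (counted_not_mem_noCount T.2 hnc)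
          -- Here `S` lies properly inside `T`: it cannot be counted, and no counter inside `S` can
          -- be tested, since its scope would meet that of `T`. So the guard is true.
          · refine Or.inr (Or.inl ⟨iterTrans_update_var h5 h4 h1, ?_, some_mem_posSet.2 h4⟩)
            by_cases h6 : S ∈ M.counted
            · exact absurd (counted_eq_of_mem_subs hF h6 T.2 h3).symm h2
            · rcases iterTrans_guard_star hF hL h6 p q with h | ⟨T', h, -⟩
              · exact h.1
              · exact absurd h.1 (ctr_eq hF hL h4 (last_subset _ h.2.2) ▸ h5)
  guard_cases d hd := by
    rcases mem_glushkov_trans.1 hd with ⟨q, -, rfl⟩ | ⟨p, q, -, rfl⟩ | ⟨S, hS, p, q, hp, hq, rfl⟩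
    · exact Or.inl rfl
    · rcases catTrans_guard hF hL p q with h | ⟨T, h, h'⟩
      · exact Or.inl h.1
      · exact Or.inr ⟨T, some_mem_posSet.2 h.1, Or.inl h'⟩
    · by_cases h : S ∈ M.counted
      · exact Or.inr ⟨⟨S, h⟩, some_mem_posSet.2 hp, Or.inr (iterTrans_guard_counted hF h p q)⟩
      · rcases iterTrans_guard_star hF hL h p q with h | ⟨T, h, h'⟩
        · exact Or.inl h.1
        · exact Or.inr ⟨T, some_mem_posSet.2 h.2.2, Or.inl h'⟩
  exists_inc T p hp q hq := by
    obtain ⟨p, rfl, -⟩ := mem_posSet.1 hp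
    replace hp := some_mem_posSet.1 hp
    obtain ⟨q, rfl, -⟩ := mem_posSet.1 hq
    replace hq := some_mem_posSet.1 hq
    exact ⟨M.iterTrans T.1 p q, mem_glushkov_trans.2 (Or.inr (Or.inr
      ⟨T.1, mem_iterated_of_counted T.2, p, q, hp, hq, rfl⟩)), rfl, rfl,
      iterTrans_guard_counted hF T.2 p q, by simp [iterTrans]⟩
  live T p hp := by
    obtain ⟨p, rfl, -⟩ := mem_posSet.1 hp
    replace hp := some_mem_posSet.1 hp
    obtain ⟨r, lo, hi, hpos, hle, hr, -⟩ := exists_eq_count T.2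
    have hl : T.1.letters = r.letters := by rw [hr]; rfl
    have hl' : T.1.last = r.last := by rw [hr]; rfl
    rw [hl] at hp
    obtain ⟨q, hq, hpath⟩ := exists_path_last r hp
    have hrM : r.letters ⊆ M.letters := hl ▸ letters_subset (ctr_mem_subs T)
    refine ⟨some ⟨q, hrM (last_subset _ hq)⟩, some_mem_posSet.2 (hl' ▸ hq), ?_⟩
    obtain ⟨p, hpM⟩ := p
    simp only at hpath hp
    induction hpath using Relation.ReflTransGen.head_induction_on with
    | refl => exact .refl
    | head hst _ ih =>
      rename_i u v _
      have hv : v ∈ r.letters := by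
        rcases hst with h | ⟨S, hS, -, -, h2⟩
        · exact (followCat_letters h).2
        · exact letters_subset hS (first_subset _ h2)
      exact .head (exists_follow_trans hF hr hst hpM (hrM hv)).2.2 (ih (hrM hv) hv)
  init_eq := rfl
  final_cases q := by
    cases q with
    | none =>
      simp only [glushkov]
      split_ifs
      · exact Or.inl rfl
      · exact Or.inr (Or.inl rfl)
    | some p =>
      simp only [glushkov]
      split_ifs
      · rcases conj_filter_cases (fun T : M.Ctr => p.1 ∈ T.1.last)
          (fun T => .atom (.ge T.1.lower, T))
          (fun _ _ h h' => ctr_eq hF hL (last_subset _ h) (last_subset _ h')) with h | ⟨T, h, h'⟩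
        · exact Or.inl h.1
        · exact Or.inr (Or.inr ⟨T, some_mem_posSet.2 h, h'⟩)
      · exact Or.inr (Or.inl rfl)

end Glushkov

end Regex

/-! ### Transitions of the counter-subset construction -/

section Subset

variable {α X Q : Type} [DecidableEq α] [DecidableEq X] [DecidableEq Q]
  [Fintype X] [Fintype Q]

theorem Form.holds_conj {B : Type} (v : B → Prop) (l : List (Form B)) :
    (Form.conj l).Holds v ↔ ∀ φ ∈ l, φ.Holds v := by
  induction l with
  | nil => simp [Form.conj, Form.Holds]
  | cons a l ih =>
    rw [List.forall_mem_cons, ← ih]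
    rfl

theorem Form.holds_disj {B : Type} (v : B → Prop) (l : List (Form B)) :
    (Form.disj l).Holds v ↔ ∃ φ ∈ l, φ.Holds v := by
  induction l with
  | nil => simp [Form.disj, Form.Holds]
  | cons a l ih =>
    simp only [List.exists_mem_cons_iff, ← ih]
    rfl

theorem Form.holds_subst {B C : Type} (f : B → Form C) (v : C → Prop) (φ : Form B) :
    (φ.subst f).Holds v ↔ φ.Holds fun b => (f b).Holds v := by
  induction φ <;> simp_all [Form.subst, Form.Holds]

/-- The conjunction of the members of `Ψ`, positive for the members of `Γ` and negated for the
others. -/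
noncomputable def minterm {Y : Type} [DecidableEq Y] (Ψ Γ : Finset (Guard Y)) : Guard Y :=
  Form.conj (Ψ.toList.map fun φ => if φ ∈ Γ then φ else .neg φ)

/-- A memory satisfies exactly the minterm of those guards that it makes true. Determinism, and the
existence of an enabled transition, both rest on this. -/
theorem sat_minterm {Y : Type} [DecidableEq Y] {Ψ Γ : Finset (Guard Y)} {s : Y → Set ℕ} :
    (setLang Y).sat (minterm Ψ Γ) s ↔ ∀ φ ∈ Ψ, (φ ∈ Γ ↔ (setLang Y).sat φ s) := by
  simp only [setLang, minterm, Form.holds_conj, List.forall_mem_map, Finset.mem_toList]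
  refine forall_congr' fun φ => forall_congr' fun _ => ?_
  split_ifs with h <;> simp [h, Form.Holds]

variable (A : CA α X Q)

/-- The guards of the constituent transitions. -/
def subsetGuards (P : Finset Q) (a : α) : Finset (Guard (X × Q)) :=
  (constituents A P a).image fun δ => δ.guard

/-- The transition of the counter-subset construction for the minterm given by `Γ`. -/
noncomputable def subsetOf (P : Finset Q) (a : α) (Γ : Finset (Guard (X × Q))) :
    Trans α (Finset Q) (Guard (X × Q)) (X × Q → SetTerm (X × Q)) where
  src := P
  letter := a
  guard := minterm (subsetGuards A P a) Γ
  update y := ((constituents A P a).filter fun δ => δ.guard ∈ Γ).biUnion fun δ => δ.update y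
  tgt := ((constituents A P a).filter fun δ => δ.guard ∈ Γ).image fun δ => δ.tgt

variable {A}

/-- A constituent guard is a conjunct of the minterm, positively or negatively. Compatibility with a
satisfiable minterm therefore just means being taken positively, and the semantic filter can be
replaced by membership in `Γ`. -/
theorem mem_subsetTrans {P : Finset Q} {a : α}
    {δ : Trans α (Finset Q) (Guard (X × Q)) (X × Q → SetTerm (X × Q))} :
    δ ∈ subsetTrans A P a ↔ ∃ Γ ⊆ subsetGuards A P a,
      Satisfiable (minterm (subsetGuards A P a) Γ) ∧ δ = subsetOf A P a Γ := by
  have key : ∀ Γ, Satisfiable (minterm (subsetGuards A P a) Γ) →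
      ∀ c ∈ constituents A P a,
        (Satisfiable (.and (minterm (subsetGuards A P a) Γ) c.guard) ↔ c.guard ∈ Γ) := by
    rintro Γ ⟨s, hs⟩ c hc
    have hmem : c.guard ∈ subsetGuards A P a := Finset.mem_image_of_mem _ hc
    constructor
    · rintro ⟨s', h1, h2⟩
      exact (sat_minterm.1 h1 _ hmem).2 h2
    · exact fun h => ⟨s, hs, (sat_minterm.1 hs _ hmem).1 h⟩
  have key2 : ∀ Γ, Satisfiable (minterm (subsetGuards A P a) Γ) →
      (Trans.mk P a (minterm (subsetGuards A P a) Γ)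
        (fun y => (open Classical in (constituents A P a).filter fun δ =>
          Satisfiable (.and (minterm (subsetGuards A P a) Γ) δ.guard)).biUnion fun δ => δ.update y)
        ((open Classical in (constituents A P a).filter fun δ =>
          Satisfiable (.and (minterm (subsetGuards A P a) Γ) δ.guard)).image fun δ => δ.tgt)) =
        subsetOf A P a Γ := by
    intro Γ hΓ
    have : (open Classical in (constituents A P a).filter fun δ =>
          Satisfiable (.and (minterm (subsetGuards A P a) Γ) δ.guard)) =
        (constituents A P a).filter fun δ => δ.guard ∈ Γ := by
      ext c
      simp only [Finset.mem_filter]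
      exact and_congr_right fun hc => key Γ hΓ c hc
    rw [subsetOf, ← this]
  simp only [subsetTrans, minterms, Finset.mem_image, Finset.mem_filter, Finset.mem_powerset]
  constructor
  · rintro ⟨ψ, ⟨⟨Γ, hΓ, rfl⟩, hs⟩, rfl⟩
    exact ⟨Γ, hΓ, hs, key2 Γ hs⟩
  · rintro ⟨Γ, hΓ, hs, rfl⟩
    exact ⟨_, ⟨⟨Γ, hΓ, rfl⟩, hs⟩, key2 Γ hs⟩

variable (A) in
/-- The `a`-transitions from `P` whose set versions have guards in `Γ`. -/
def moves (P : Finset Q) (a : α) (Γ : Finset (Guard (X × Q))) :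
    Finset (Trans α Q (Guard X) (X → CTerm X)) :=
  A.trans.filter fun d => d.src ∈ P ∧ d.letter = a ∧ indexGuard d.src d.guard ∈ Γ

theorem mem_moves {P : Finset Q} {a : α} {Γ : Finset (Guard (X × Q))}
    {d : Trans α Q (Guard X) (X → CTerm X)} :
    d ∈ moves A P a Γ ↔ d ∈ A.trans ∧ d.src ∈ P ∧ d.letter = a ∧ indexGuard d.src d.guard ∈ Γ :=
  Finset.mem_filter

theorem mem_subsetGuards {P : Finset Q} {a : α} {φ : Guard (X × Q)} :
    φ ∈ subsetGuards A P a ↔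
      ∃ d ∈ A.trans, d.src ∈ P ∧ d.letter = a ∧ indexGuard d.src d.guard = φ := by
  simp only [subsetGuards, constituents, Finset.image_image, Finset.mem_image, Finset.mem_filter,
    Function.comp, setVersion, and_assoc]

theorem mem_subsetOf_tgt {P : Finset Q} {a : α} {Γ : Finset (Guard (X × Q))} {r : Q} :
    r ∈ (subsetOf A P a Γ).tgt ↔ ∃ d ∈ moves A P a Γ, d.tgt = r := by
  simp only [subsetOf, constituents, Finset.mem_image, Finset.mem_filter, mem_moves]
  constructor
  · rintro ⟨_, ⟨⟨d, h1, rfl⟩, h2⟩, rfl⟩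
    exact ⟨d, ⟨h1.1, h1.2.1, h1.2.2, h2⟩, rfl⟩
  · rintro ⟨d, ⟨h1, h2, h3, h4⟩, rfl⟩
    exact ⟨_, ⟨⟨d, ⟨h1, h2, h3⟩, rfl⟩, h4⟩, rfl⟩

theorem mem_subsetOf_update {P : Finset Q} {a : α} {Γ : Finset (Guard (X × Q))} {x : X} {r : Q}
    {t : RTerm (X × Q)} :
    t ∈ (subsetOf A P a Γ).update (x, r) ↔
      ∃ d ∈ moves A P a Γ, d.tgt = r ∧ t = filterTerm d.guard d.src (d.update x) := by
  simp only [subsetOf, constituents, Finset.mem_biUnion, Finset.mem_image, Finset.mem_filter,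
    mem_moves]
  constructor
  · rintro ⟨_, ⟨⟨d, h1, rfl⟩, h2⟩, h3⟩
    simp only [setVersion] at h3
    split_ifs at h3 with h
    · exact ⟨d, ⟨h1.1, h1.2.1, h1.2.2, h2⟩, h.symm, by simpa using h3⟩
    · simp at h3
  · rintro ⟨d, ⟨h1, h2, h3, h4⟩, rfl, rfl⟩
    exact ⟨_, ⟨⟨d, ⟨h1, h2, h3⟩, rfl⟩, h4⟩, by simp [setVersion]⟩

end Subset

/-! ### Sharing, postponing and grouping -/

section Augmented

variable {α X Q : Type} [DecidableEq α] [DecidableEq X] [DecidableEq Q]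
  [Fintype X] [Fintype Q]

/-- The unmarked members. -/
def plain (S : Finset (MState Q)) : Finset Q := Finset.univ.filter fun q => (q, false) ∈ S

/-- The states whose marked versions are members. -/
def marked (S : Finset (MState Q)) : Finset Q := Finset.univ.filter fun q => (q, true) ∈ S

@[simp] theorem mem_plain {S : Finset (MState Q)} {q : Q} : q ∈ plain S ↔ (q, false) ∈ S := by
  simp [plain]

@[simp] theorem mem_marked {S : Finset (MState Q)} {q : Q} : q ∈ marked S ↔ (q, true) ∈ S := by
  simp [marked]

/-- The set with the given unmarked and marked members. -/
def ofPair (U V : Finset Q) : Finset (MState Q) := U ×ˢ {false} ∪ V ×ˢ {true}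

@[simp] theorem mem_ofPair_false {U V : Finset Q} {q : Q} : (q, false) ∈ ofPair U V ↔ q ∈ U := by
  simp [ofPair]

@[simp] theorem mem_ofPair_true {U V : Finset Q} {q : Q} : (q, true) ∈ ofPair U V ↔ q ∈ V := by
  simp [ofPair]

@[simp] theorem plain_ofPair (U V : Finset Q) : plain (ofPair U V) = U := by ext; simp

@[simp] theorem marked_ofPair (U V : Finset Q) : marked (ofPair U V) = V := by ext; simp

theorem ofPair_nonempty {U V : Finset Q} : (ofPair U V).Nonempty ↔ U.Nonempty ∨ V.Nonempty := by
  constructor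
  · rintro ⟨⟨q, b⟩, h⟩
    cases b
    · exact Or.inl ⟨q, by simpa using h⟩
    · exact Or.inr ⟨q, by simpa using h⟩
  · rintro (⟨q, h⟩ | ⟨q, h⟩)
    · exact ⟨(q, false), by simpa using h⟩
    · exact ⟨(q, true), by simpa using h⟩

/-- A pair without unmarked states is replaced by its marked states, with the mark removed. -/
def normPair (U V : Finset Q) : Finset (MState Q) := if U = ∅ then ofPair V ∅ else ofPair U V

theorem finc_injective {hi : X → ℕ∞} {x y : X} {t t' : RTerm (Shared X Q)}
    (h : finc hi x t = finc hi y t') : t = t' := by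
  simp only [finc, RTerm.succ.injEq, RTerm.filt.injEq] at h
  exact h.2

section Grouping

variable {hi : X → ℕ∞} {Act : Finset (Shared X Q)} {v : X × Q → SetTerm (Shared X Q)}
  {Z O : X → Finset Q} {K B : X → Finset (MState Q) → Finset Q}

/-- The r-term for the register `x_S` after postponing. -/
def groupTerm (hi : X → ℕ∞) (K : X → Finset (MState Q) → Finset Q) (x : X)
    (S : Finset (MState Q)) : RTerm (Shared X Q) :=
  if K x S = ∅ then finc hi x (.var (x, S)) else .var (x, S)

theorem groupTerm_reg (hi : X → ℕ∞) (K : X → Finset (MState Q) → Finset Q) (x : X)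
    (S : Finset (MState Q)) : (groupTerm hi K x S).reg = some (x, S) := by
  unfold groupTerm
  split_ifs <;> rfl

/-- The r-terms of an update in which registers are kept or incremented. -/
def UpdateSpec (hi : X → ℕ∞) (Act : Finset (Shared X Q)) (Z O : X → Finset Q)
    (K B : X → Finset (MState Q) → Finset Q) (v : X × Q → SetTerm (Shared X Q)) : Prop :=
  ∀ x r t, t ∈ v (x, r) ↔ (t = .zero ∧ r ∈ Z x) ∨ (t = .one ∧ r ∈ O x) ∨
    (∃ S, (x, S) ∈ Act ∧ t = .var (x, S) ∧ r ∈ K x S) ∨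
    ∃ S, (x, S) ∈ Act ∧ t = finc hi x (.var (x, S)) ∧ r ∈ B x S

theorem UpdateSpec.var_mem (hv : UpdateSpec hi Act Z O K B v) {x y : X} {r : Q}
    {S : Finset (MState Q)} :
    RTerm.var (y, S) ∈ v (x, r) ↔ y = x ∧ (x, S) ∈ Act ∧ r ∈ K x S := by
  rw [hv]
  simp only [finc, RTerm.var.injEq, Prod.mk.injEq, reduceCtorEq, false_and, and_false,
    exists_false, or_false, false_or]
  constructor
  · rintro ⟨S', h1, ⟨rfl, rfl⟩, h2⟩
    exact ⟨rfl, h1, h2⟩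
  · rintro ⟨rfl, h1, h2⟩
    exact ⟨S, h1, ⟨rfl, rfl⟩, h2⟩

theorem UpdateSpec.finc_mem (hv : UpdateSpec hi Act Z O K B v) {x y : X} {r : Q}
    {S : Finset (MState Q)} :
    finc hi y (RTerm.var (y, S)) ∈ v (x, r) ↔ y = x ∧ (x, S) ∈ Act ∧ r ∈ B x S := by
  rw [hv]
  constructor
  · rintro (⟨h, -⟩ | ⟨h, -⟩ | ⟨S', -, h, -⟩ | ⟨S', h1, h, h2⟩)
    · simp [finc] at h
    · simp [finc] at h
    · simp [finc] at h
    · have := finc_injective h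
      simp only [RTerm.var.injEq, Prod.mk.injEq] at this
      obtain ⟨rfl, rfl⟩ := this
      exact ⟨rfl, h1, h2⟩
  · rintro ⟨rfl, h1, h2⟩
    exact Or.inr (Or.inr (Or.inr ⟨S, h1, rfl, h2⟩))

theorem UpdateSpec.mem_conflict (hv : UpdateSpec hi Act Z O K B v) {x : X}
    {S : Finset (MState Q)} :
    finc hi x (.var (x, S)) ∈ conflict hi v ↔
      (x, S) ∈ Act ∧ (K x S).Nonempty ∧ (B x S).Nonempty := by
  simp only [conflict, Finset.mem_image, Finset.mem_filter, Finset.mem_univ, true_and,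
    Finset.mem_biUnion, Prod.exists]
  constructor
  · rintro ⟨y, S', ⟨⟨y1, r1, h1⟩, y2, r2, h2⟩, h⟩
    have := finc_injective h
    simp only [RTerm.var.injEq, Prod.mk.injEq] at this
    obtain ⟨rfl, rfl⟩ := this
    obtain ⟨rfl, ha, hb⟩ := hv.finc_mem.1 h1
    obtain ⟨rfl, -, hk⟩ := hv.var_mem.1 h2
    exact ⟨ha, ⟨_, hk⟩, ⟨_, hb⟩⟩
  · rintro ⟨ha, ⟨r2, hk⟩, ⟨r1, hb⟩⟩
    exact ⟨x, S, ⟨⟨x, r1, hv.finc_mem.2 ⟨rfl, ha, hb⟩⟩, x, r2, hv.var_mem.2 ⟨rfl, ha, hk⟩⟩, rfl⟩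

theorem not_mem_conflict {t : RTerm (Shared X Q)} (h : ∀ z, t ≠ finc hi z.1 (.var z)) :
    t ∉ conflict hi v := by
  simp only [conflict, Finset.mem_image, not_exists, not_and]
  exact fun z _ hz => h z hz.symm

/-- After postponing, each register occurs in one shape only. If it is kept somewhere, its
increments become marks; if it is kept nowhere, the increment is carried out and no mark is needed.
`groupTerm` and `normPair` encode the two cases. -/
theorem UpdateSpec.mem_postponed (hv : UpdateSpec hi Act Z O K B v) {x : X} {m : MState Q}
    {t : RTerm (Shared X Q)} :
    t ∈ postponedUpdate hi v x m ↔ (t = .zero ∧ m ∈ ofPair (Z x) ∅) ∨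
      (t = .one ∧ m ∈ ofPair (O x) ∅) ∨
      ∃ S, (x, S) ∈ Act ∧ t = groupTerm hi K x S ∧ m ∈ normPair (K x S) (B x S) := by
  obtain ⟨r, b⟩ := m
  cases b with
  | true =>
    simp only [postponedUpdate, if_true, Finset.mem_image, Finset.mem_filter, Finset.mem_univ,
      true_and, Finset.mem_inter, mem_ofPair_true, Finset.notMem_empty, and_false, false_or,
      Prod.exists]
    constructor
    · rintro ⟨y, S, ⟨h1, h2⟩, rfl⟩
      obtain ⟨rfl, ha, hb⟩ := hv.finc_mem.1 h1
      obtain ⟨-, hk, -⟩ := hv.mem_conflict.1 h2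
      have := hk.ne_empty
      refine ⟨S, ha, by simp [groupTerm, this], by simpa [normPair, this] using hb⟩
    · rintro ⟨S, ha, rfl, h⟩
      by_cases hk : K x S = ∅
      · simp [normPair, hk] at h
      · simp only [normPair, hk, if_false, mem_ofPair_true] at h
        exact ⟨x, S, ⟨hv.finc_mem.2 ⟨rfl, ha, h⟩, hv.mem_conflict.2
          ⟨ha, Finset.nonempty_iff_ne_empty.2 hk, ⟨r, h⟩⟩⟩, by simp [groupTerm, hk]⟩
  | false =>
    simp only [postponedUpdate, Bool.false_eq_true, if_false, Finset.mem_sdiff, mem_ofPair_false]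
    rw [hv]
    constructor
    · rintro ⟨h | h | ⟨S, ha, rfl, hk⟩ | ⟨S, ha, rfl, hb⟩, hc⟩
      · exact Or.inl h
      · exact Or.inr (Or.inl h)
      · have : K x S ≠ ∅ := Finset.ne_empty_of_mem hk
        exact Or.inr (Or.inr ⟨S, ha, by simp [groupTerm, this], by simpa [normPair, this] using hk⟩)
      · rw [hv.mem_conflict] at hc
        have : K x S = ∅ := by
          by_contra hk
          exact hc ⟨ha, Finset.nonempty_iff_ne_empty.2 hk, ⟨r, hb⟩⟩
        exact Or.inr (Or.inr ⟨S, ha, by simp [groupTerm, this], by simpa [normPair, this] using hb⟩)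
    · rintro (⟨rfl, h⟩ | ⟨rfl, h⟩ | ⟨S, ha, rfl, h⟩)
      · exact ⟨Or.inl ⟨rfl, h⟩, not_mem_conflict fun z => by simp [finc]⟩
      · exact ⟨Or.inr (Or.inl ⟨rfl, h⟩), not_mem_conflict fun z => by simp [finc]⟩
      · by_cases hk : K x S = ∅
        · simp only [normPair, hk, if_true, mem_ofPair_false] at h
          simp only [groupTerm, hk, if_true]
          refine ⟨Or.inr (Or.inr (Or.inr ⟨S, ha, rfl, h⟩)), ?_⟩
          rw [hv.mem_conflict, hk]
          simp
        · simp only [normPair, hk, if_false, mem_ofPair_false] at h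
          simp only [groupTerm, hk, if_false]
          exact ⟨Or.inr (Or.inr (Or.inl ⟨S, ha, rfl, h⟩)),
            not_mem_conflict fun z => by simp [finc]⟩

theorem mem_lval {up : X → MState Q → SetTerm (Shared X Q)} {x : X} {t : RTerm (Shared X Q)}
    {m : MState Q} : m ∈ lval up x t ↔ t ∈ up x m := by
  simp [lval]

theorem mem_groupedUpdate {up : X → MState Q → SetTerm (Shared X Q)} {x : X}
    {S : Finset (MState Q)} {t : RTerm (Shared X Q)} :
    t ∈ groupedUpdate up (x, S) ↔ lval up x t = S ∧ S.Nonempty := by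
  simp only [groupedUpdate, Finset.mem_filter, Finset.mem_biUnion, Finset.mem_univ, true_and]
  rw [and_comm]
  refine and_congr_right fun h => ?_
  subst h
  exact exists_congr fun m => mem_lval.symm

theorem mem_nextActive {up : X → MState Q → SetTerm (Shared X Q)} {x : X}
    {S : Finset (MState Q)} :
    (x, S) ∈ nextActive up ↔ ∃ t, t ∈ groupedUpdate up (x, S) := by
  simp only [nextActive, Finset.mem_biUnion, Finset.mem_image, Finset.mem_univ, true_and,
    mem_groupedUpdate, Prod.mk.injEq]
  constructor
  · rintro ⟨y, t, ⟨m, hm⟩, rfl, rfl⟩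
    exact ⟨t, rfl, m, mem_lval.2 hm⟩
  · rintro ⟨t, rfl, m, hm⟩
    exact ⟨x, t, ⟨m, mem_lval.1 hm⟩, rfl, rfl⟩

/-- A term `groupTerm hi K x S` determines `S` through its register and differs from the constants,
so its set of l-values is that of a single old register. -/
theorem UpdateSpec.mem_grouped (hv : UpdateSpec hi Act Z O K B v) {x : X}
    {S' : Finset (MState Q)} {t : RTerm (Shared X Q)} :
    t ∈ groupedUpdate (postponedUpdate hi v) (x, S') ↔ S'.Nonempty ∧
      ((t = .zero ∧ S' = ofPair (Z x) ∅) ∨ (t = .one ∧ S' = ofPair (O x) ∅) ∨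
      ∃ S, (x, S) ∈ Act ∧ t = groupTerm hi K x S ∧ S' = normPair (K x S) (B x S)) := by
  have h0 : ∀ S, groupTerm hi K x S ≠ .zero := fun S h => by
    have := groupTerm_reg hi K x S; rw [h] at this; simp [RTerm.reg] at this
  have h1 : ∀ S, groupTerm hi K x S ≠ .one := fun S h => by
    have := groupTerm_reg hi K x S; rw [h] at this; simp [RTerm.reg] at this
  have h2 : ∀ S S', groupTerm hi K x S = groupTerm hi K x S' → S = S' := fun S S' h => by
    have := groupTerm_reg hi K x S; rw [h, groupTerm_reg] at this; simpa using this.symm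
  have l0 : lval (postponedUpdate hi v) x .zero = ofPair (Z x) ∅ := by
    ext m
    rw [mem_lval, hv.mem_postponed]
    simp [fun S => (h0 S).symm]
  have l1 : lval (postponedUpdate hi v) x .one = ofPair (O x) ∅ := by
    ext m
    rw [mem_lval, hv.mem_postponed]
    simp [fun S => (h1 S).symm]
  have l2 : ∀ S, (x, S) ∈ Act →
      lval (postponedUpdate hi v) x (groupTerm hi K x S) = normPair (K x S) (B x S) := by
    intro S hS
    ext m
    rw [mem_lval, hv.mem_postponed]
    simp only [h0, h1, false_and, false_or]
    constructor
    · rintro ⟨S', -, h, hm⟩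
      rwa [h2 _ _ h]
    · exact fun hm => ⟨S, hS, rfl, hm⟩
  rw [mem_groupedUpdate, and_comm]
  refine and_congr_right fun hne => ⟨?_, ?_⟩
  · rintro rfl
    obtain ⟨m, hm⟩ := hne
    rw [mem_lval, hv.mem_postponed] at hm
    rcases hm with ⟨rfl, -⟩ | ⟨rfl, -⟩ | ⟨S, hS, rfl, -⟩
    · exact Or.inl ⟨rfl, l0⟩
    · exact Or.inr (Or.inl ⟨rfl, l1⟩)
    · exact Or.inr (Or.inr ⟨S, hS, rfl, l2 S hS⟩)
  · rintro (⟨rfl, rfl⟩ | ⟨rfl, rfl⟩ | ⟨S, hS, rfl, rfl⟩)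
    · exact l0
    · exact l1
    · exact l2 S hS

end Grouping

/-! ### The steps of the augmented determinization of a flat automaton -/

section Steps

variable (D : Finset (Trans α Q (Guard X) (X → CTerm X)))

/-- Where transitions in `D` set the counter to `0`. -/
def zeroSet (x : X) : Finset Q := (D.filter fun d => d.update x = .zero).image fun d => d.tgt

/-- Where transitions in `D` set the counter to `1`. -/
def oneSet (x : X) : Finset Q := (D.filter fun d => d.update x = .one).image fun d => d.tgt

/-- Where transitions in `D` that start in `U` keep the counter. -/
def keepSet (x : X) (U : Finset Q) : Finset Q :=
  (D.filter fun d => d.update x = .var x ∧ d.src ∈ U).image fun d => d.tgt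

/-- Where transitions in `D` that start in `U` increment the counter. -/
def incSet (x : X) (U : Finset Q) : Finset Q :=
  (D.filter fun d => d.update x = .succ (.var x) ∧ d.src ∈ U).image fun d => d.tgt

variable {D}

theorem mem_zeroSet {x : X} {r : Q} :
    r ∈ zeroSet D x ↔ ∃ d ∈ D, d.update x = .zero ∧ d.tgt = r := by
  simp [zeroSet, and_assoc]

theorem mem_oneSet {x : X} {r : Q} :
    r ∈ oneSet D x ↔ ∃ d ∈ D, d.update x = .one ∧ d.tgt = r := by
  simp [oneSet, and_assoc]

theorem mem_keepSet {x : X} {U : Finset Q} {r : Q} :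
    r ∈ keepSet D x U ↔ ∃ d ∈ D, d.update x = .var x ∧ d.src ∈ U ∧ d.tgt = r := by
  simp [keepSet, and_assoc]

theorem mem_incSet {x : X} {U : Finset Q} {r : Q} :
    r ∈ incSet D x U ↔ ∃ d ∈ D, d.update x = .succ (.var x) ∧ d.src ∈ U ∧ d.tgt = r := by
  simp [incSet, and_assoc]

variable (D) in
/-- The successor of the index of a register. -/
def nextSet (x : X) (S : Finset (MState Q)) : Finset (MState Q) :=
  normPair (keepSet D x (plain S)) (incSet D x (plain S) ∪ keepSet D x (marked S))

variable (D) in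
/-- The r-term for a register in an update. -/
def nextTerm (hi : X → ℕ∞) (x : X) (S : Finset (MState Q)) : RTerm (Shared X Q) :=
  if keepSet D x (plain S) = ∅ then finc hi x (.var (x, S)) else .var (x, S)

theorem shareTerm_var {hi : X → ℕ∞} {Act : Finset (Shared X Q)} {x : X} {q : Q}
    {t : RTerm (Shared X Q)} :
    t ∈ shareTerm hi Act (.var (x, q)) ↔
      (∃ S, (x, S) ∈ Act ∧ q ∈ plain S ∧ t = .var (x, S)) ∨
      ∃ S, (x, S) ∈ Act ∧ q ∈ marked S ∧ t = finc hi x (.var (x, S)) := by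
  simp only [shareTerm, RTerm.reg, RTerm.map, Finset.mem_union, Finset.mem_image,
    Finset.mem_filter, Prod.exists, mem_plain, mem_marked]
  refine or_congr ⟨?_, ?_⟩ ⟨?_, ?_⟩
  · rintro ⟨y, S, ⟨h1, rfl, h2⟩, rfl⟩; exact ⟨S, h1, h2, rfl⟩
  · rintro ⟨S, h1, h2, rfl⟩; exact ⟨x, S, ⟨h1, rfl, h2⟩, rfl⟩
  · rintro ⟨y, S, ⟨h1, rfl, h2⟩, rfl⟩; exact ⟨S, h1, h2, rfl⟩
  · rintro ⟨S, h1, h2, rfl⟩; exact ⟨x, S, ⟨h1, rfl, h2⟩, rfl⟩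

theorem shareTerm_inc {hi : X → ℕ∞} {Act : Finset (Shared X Q)} {x : X} {q : Q}
    {t : RTerm (Shared X Q)} :
    t ∈ shareTerm hi Act (.succ (.filt (.lt (hi x)) (.var (x, q)))) ↔
      (∃ S, (x, S) ∈ Act ∧ q ∈ plain S ∧ t = finc hi x (.var (x, S))) ∨
      ∃ S, (x, S) ∈ Act ∧ q ∈ marked S ∧ t = finc hi x (finc hi x (.var (x, S))) := by
  simp only [shareTerm, RTerm.reg, RTerm.map, Finset.mem_union, Finset.mem_image,
    Finset.mem_filter, Prod.exists, mem_plain, mem_marked]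
  refine or_congr ⟨?_, ?_⟩ ⟨?_, ?_⟩
  · rintro ⟨y, S, ⟨h1, rfl, h2⟩, rfl⟩; exact ⟨S, h1, h2, rfl⟩
  · rintro ⟨S, h1, h2, rfl⟩; exact ⟨x, S, ⟨h1, rfl, h2⟩, rfl⟩
  · rintro ⟨y, S, ⟨h1, rfl, h2⟩, rfl⟩; exact ⟨S, h1, h2, rfl⟩
  · rintro ⟨S, h1, h2, rfl⟩; exact ⟨x, S, ⟨h1, rfl, h2⟩, rfl⟩

variable {A : CA α X Q} (F : FlatCA A)

theorem FlatCA.update_cases {d : Trans α Q (Guard X) (X → CTerm X)} (hd : d ∈ A.trans) (x : X) :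
    (d.update x = .zero ∧ d.tgt ∉ F.mem x) ∨ (d.update x = .one ∧ d.tgt ∈ F.fst x) ∨
    (d.update x = .var x ∧ d.guard = .tt ∧ d.src ∈ F.mem x ∧ d.tgt ∈ F.mem x) ∨
    (d.update x = .succ (.var x) ∧ d.guard = ltGuard F.hi x ∧ d.src ∈ F.lst x ∧
      d.tgt ∈ F.fst x) := by
  by_cases h : d.tgt ∈ F.mem x
  · rcases F.update_mem d hd x h with h | h | h
    · exact Or.inr (Or.inl ⟨h.1, h.2.1⟩)
    · exact Or.inr (Or.inr (Or.inl ⟨h.1, h.2.1, h.2.2, ‹_›⟩))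
    · exact Or.inr (Or.inr (Or.inr h))
  · exact Or.inl ⟨F.update_zero d hd x h, h⟩

/-- A kept counter has a true guard, hence no filter; an incremented one is filtered by its own
upper bound. So only plain, singly and doubly incremented registers arise, besides constants. A
single increment comes from an increment at an unmarked state or from keeping a marked one. -/
theorem FlatCA.mem_sharedUpdate {P : Finset Q} {a : α} {Γ : Finset (Guard (X × Q))}
    {Act : Finset (Shared X Q)} {x : X} {r : Q} {t : RTerm (Shared X Q)} :
    t ∈ sharedUpdate F.hi Act (subsetOf A P a Γ).update (x, r) ↔
      (t = .zero ∧ r ∈ zeroSet (moves A P a Γ) x) ∨ (t = .one ∧ r ∈ oneSet (moves A P a Γ) x) ∨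
      (∃ S, (x, S) ∈ Act ∧ t = .var (x, S) ∧ r ∈ keepSet (moves A P a Γ) x (plain S)) ∨
      (∃ S, (x, S) ∈ Act ∧ t = finc F.hi x (.var (x, S)) ∧
        r ∈ incSet (moves A P a Γ) x (plain S) ∪ keepSet (moves A P a Γ) x (marked S)) ∨
      ∃ S, (x, S) ∈ Act ∧ t = finc F.hi x (finc F.hi x (.var (x, S))) ∧
        r ∈ incSet (moves A P a Γ) x (marked S) := by
  simp only [sharedUpdate, Finset.mem_biUnion, mem_subsetOf_update, Finset.mem_union, mem_zeroSet,
    mem_oneSet, mem_keepSet, mem_incSet]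
  have e1 : ∀ d : Trans α Q (Guard X) (X → CTerm X), d.update x = .var x → d.guard = .tt →
      filterTerm d.guard d.src (d.update x) = (.var (x, d.src) : RTerm (X × Q)) := by
    intro d h1 h2
    simp [h1, h2, filterTerm, Form.atoms]
  have e2 : ∀ d : Trans α Q (Guard X) (X → CTerm X), d.update x = .succ (.var x) → d.guard = ltGuard F.hi x →
      filterTerm d.guard d.src (d.update x) =
        (.succ (.filt (.lt (F.hi x)) (.var (x, d.src))) : RTerm (X × Q)) := by
    intro d h1 h2
    simp [h1, h2, filterTerm, Form.atoms, ltGuard]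
  constructor
  · rintro ⟨_, ⟨d, hd, rfl, rfl⟩, ht⟩
    rcases F.update_cases (mem_moves.1 hd).1 x with h | h | h | h
    · rw [h.1] at ht
      simp only [filterTerm, shareTerm, RTerm.reg, RTerm.map, Finset.mem_singleton] at ht
      exact Or.inl ⟨ht, d, hd, h.1, rfl⟩
    · rw [h.1] at ht
      simp only [filterTerm, shareTerm, RTerm.reg, RTerm.map, Finset.mem_singleton] at ht
      exact Or.inr (Or.inl ⟨ht, d, hd, h.1, rfl⟩)
    · rw [e1 d h.1 h.2.1, shareTerm_var] at ht
      rcases ht with ⟨S, h1, h2, rfl⟩ | ⟨S, h1, h2, rfl⟩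
      · exact Or.inr (Or.inr (Or.inl ⟨S, h1, rfl, d, hd, h.1, h2, rfl⟩))
      · exact Or.inr (Or.inr (Or.inr (Or.inl ⟨S, h1, rfl, Or.inr ⟨d, hd, h.1, h2, rfl⟩⟩)))
    · rw [e2 d h.1 h.2.1, shareTerm_inc] at ht
      rcases ht with ⟨S, h1, h2, rfl⟩ | ⟨S, h1, h2, rfl⟩
      · exact Or.inr (Or.inr (Or.inr (Or.inl ⟨S, h1, rfl, Or.inl ⟨d, hd, h.1, h2, rfl⟩⟩)))
      · exact Or.inr (Or.inr (Or.inr (Or.inr ⟨S, h1, rfl, d, hd, h.1, h2, rfl⟩)))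
  · have v1 : ∀ d ∈ moves A P a Γ, d.update x = .var x → d.guard = .tt := by
      intro d hd hu
      rcases F.update_cases (mem_moves.1 hd).1 x with h | h | h | h
      · simp [h.1] at hu
      · simp [h.1] at hu
      · exact h.2.1
      · simp [h.1] at hu
    have v2 : ∀ d ∈ moves A P a Γ, d.update x = .succ (.var x) → d.guard = ltGuard F.hi x := by
      intro d hd hu
      rcases F.update_cases (mem_moves.1 hd).1 x with h | h | h | h
      · simp [h.1] at hu
      · simp [h.1] at hu
      · simp [h.1] at hu
      · exact h.2.1
    rintro (⟨rfl, d, hd, h1, rfl⟩ | ⟨rfl, d, hd, h1, rfl⟩ | ⟨S, h1, rfl, d, hd, h2, h3, rfl⟩ |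
      ⟨S, h1, rfl, ⟨d, hd, h2, h3, rfl⟩ | ⟨d, hd, h2, h3, rfl⟩⟩ | ⟨S, h1, rfl, d, hd, h2, h3, rfl⟩)
    · exact ⟨_, ⟨d, hd, rfl, rfl⟩, by simp [h1, filterTerm, shareTerm, RTerm.reg, RTerm.map]⟩
    · exact ⟨_, ⟨d, hd, rfl, rfl⟩, by simp [h1, filterTerm, shareTerm, RTerm.reg, RTerm.map]⟩
    · exact ⟨_, ⟨d, hd, rfl, rfl⟩, by
        rw [e1 d h2 (v1 d hd h2), shareTerm_var]; exact Or.inl ⟨S, h1, h3, rfl⟩⟩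
    · exact ⟨_, ⟨d, hd, rfl, rfl⟩, by
        rw [e2 d h2 (v2 d hd h2), shareTerm_inc]; exact Or.inl ⟨S, h1, h3, rfl⟩⟩
    · exact ⟨_, ⟨d, hd, rfl, rfl⟩, by
        rw [e1 d h2 (v1 d hd h2), shareTerm_var]; exact Or.inr ⟨S, h1, h3, rfl⟩⟩
    · exact ⟨_, ⟨d, hd, rfl, rfl⟩, by
        rw [e2 d h2 (v2 d hd h2), shareTerm_inc]; exact Or.inr ⟨S, h1, h3, rfl⟩⟩

/-- Incrementing at a marked state is precisely what creates a double increment. -/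
theorem FlatCA.incSet_marked {P : Finset Q} {a : α} {Γ : Finset (Guard (X × Q))}
    {Act : Finset (Shared X Q)}
    (hd : ¬ DoubleInc F.hi (sharedUpdate F.hi Act (subsetOf A P a Γ).update))
    {x : X} {S : Finset (MState Q)} (hS : (x, S) ∈ Act) :
    incSet (moves A P a Γ) x (marked S) = ∅ := by
  rw [Finset.eq_empty_iff_forall_notMem]
  intro r hr
  exact hd ⟨(x, r), x, .var (x, S), F.mem_sharedUpdate.2
    (Or.inr (Or.inr (Or.inr (Or.inr ⟨S, hS, rfl, hr⟩))))⟩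

theorem FlatCA.updateSpec {P : Finset Q} {a : α} {Γ : Finset (Guard (X × Q))}
    {Act : Finset (Shared X Q)}
    (hd : ¬ DoubleInc F.hi (sharedUpdate F.hi Act (subsetOf A P a Γ).update)) :
    UpdateSpec F.hi Act (zeroSet (moves A P a Γ)) (oneSet (moves A P a Γ))
      (fun x S => keepSet (moves A P a Γ) x (plain S))
      (fun x S => incSet (moves A P a Γ) x (plain S) ∪ keepSet (moves A P a Γ) x (marked S))
      (sharedUpdate F.hi Act (subsetOf A P a Γ).update) := by
  intro x r t
  rw [F.mem_sharedUpdate]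
  refine or_congr_right (or_congr_right (or_congr_right (or_iff_left ?_)))
  rintro ⟨S, hS, -, hr⟩
  rw [F.incSet_marked hd hS] at hr
  simp at hr

/-- The whole step in closed form: constants create one register each, and every active register
moves to the index `nextSet`. The later analysis sees updates only through this description. -/
theorem FlatCA.mem_augTrans_update {P : Finset Q} {a : α} {Γ : Finset (Guard (X × Q))}
    {Act : Finset (Shared X Q)}
    (hd : ¬ DoubleInc F.hi (sharedUpdate F.hi Act (subsetOf A P a Γ).update))
    {x : X} {S' : Finset (MState Q)} {t : RTerm (Shared X Q)} :
    t ∈ (augTrans F.hi Act (subsetOf A P a Γ)).update (x, S') ↔ S'.Nonempty ∧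
      ((t = .zero ∧ S' = ofPair (zeroSet (moves A P a Γ) x) ∅) ∨
      (t = .one ∧ S' = ofPair (oneSet (moves A P a Γ) x) ∅) ∨
      ∃ S, (x, S) ∈ Act ∧ t = nextTerm (moves A P a Γ) F.hi x S ∧
        S' = nextSet (moves A P a Γ) x S) :=
  (F.updateSpec hd).mem_grouped

theorem mem_augTrans_active {hi : X → ℕ∞} {Act : Finset (Shared X Q)}
    {δ : Trans α (Finset Q) (Guard (X × Q)) (X × Q → SetTerm (X × Q))} {x : X}
    {S' : Finset (MState Q)} :
    (x, S') ∈ (augTrans hi Act δ).tgt.2 ↔ ∃ t, t ∈ (augTrans hi Act δ).update (x, S') :=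
  mem_nextActive

end Steps

end Augmented

/-! ### Runs, letter by letter -/

namespace RegAut

variable {α X Q G T D : Type} {𝓛 : RegLang X G T D} {A : RegAut α X Q G T D}

theorem run_snoc {c c'' : Q × (X → D)} {w : List α} {a : α} :
    Run 𝓛 A c (w ++ [a]) c'' ↔ ∃ c', Run 𝓛 A c w c' ∧ Step 𝓛 A c' a c'' := by
  induction w generalizing c with
  | nil =>
    constructor
    · intro h
      cases h with
      | cons h1 h2 => cases h2; exact ⟨c, .nil c, h1⟩
    · rintro ⟨c', h, h'⟩
      cases h
      exact .cons h' (.nil _)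
  | cons b w ih =>
    constructor
    · intro h
      cases h with
      | cons h1 h2 =>
        obtain ⟨c', h3, h4⟩ := ih.1 h2
        exact ⟨c', .cons h1 h3, h4⟩
    · rintro ⟨c', h, h'⟩
      cases h with
      | cons h1 h2 => exact .cons h1 (ih.2 ⟨c', h2, h'⟩)

/-- The configurations that are reached by reading a word. -/
def Reached (𝓛 : RegLang X G T D) (A : RegAut α X Q G T D) (w : List α) : Set (Q × (X → D)) :=
  {c' | ∃ c ∈ A.init, Run 𝓛 A c w c'}

theorem mem_reached_nil {c : Q × (X → D)} : c ∈ Reached 𝓛 A [] ↔ c ∈ A.init := by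
  constructor
  · rintro ⟨c', h, hr⟩
    cases hr
    exact h
  · exact fun h => ⟨c, h, .nil c⟩

theorem mem_reached_snoc {c : Q × (X → D)} {w : List α} {a : α} :
    c ∈ Reached 𝓛 A (w ++ [a]) ↔ ∃ c' ∈ Reached 𝓛 A w, Step 𝓛 A c' a c := by
  constructor
  · rintro ⟨c₀, h, hr⟩
    obtain ⟨c', h1, h2⟩ := run_snoc.1 hr
    exact ⟨c', ⟨c₀, h, h1⟩, h2⟩
  · rintro ⟨c', ⟨c₀, h, h1⟩, h2⟩
    exact ⟨c₀, h, run_snoc.2 ⟨c', h1, h2⟩⟩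

theorem mem_lang {w : List α} :
    w ∈ A.lang 𝓛 ↔ ∃ c ∈ Reached 𝓛 A w, 𝓛.sat (A.final c.1) c.2 := by
  constructor
  · rintro ⟨c, h, c', h1, h2⟩
    exact ⟨c', ⟨c, h, h1⟩, h2⟩
  · rintro ⟨c', ⟨c, h, h1⟩, h2⟩
    exact ⟨c, h, c', h1, h2⟩

end RegAut

/-! ### The augmented automaton -/

section Aug

variable {α X Q : Type} [DecidableEq α] [DecidableEq X] [DecidableEq Q]
  [Fintype X] [Fintype Q]

/-- The automaton of the augmented determinization. -/
noncomputable def augAut [Fintype α] (A : CA α X Q) (hi : X → ℕ∞) (q₀ : Q) :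
    CSA α (Shared X Q) (AugState X Q) :=
  open Classical in
  { states := Finset.univ.filter (AugReach A hi q₀)
    trans := (Finset.univ.filter (AugReach A hi q₀)).biUnion fun s =>
      Finset.univ.biUnion fun a => (subsetTrans A s.1 a).image (augTrans hi s.2)
    init := {((({q₀}, augInit X q₀) : AugState X Q),
      fun z => if z ∈ augInit X q₀ then {0} else ∅)}
    final := fun s => (subsetFinal A s.1).subst (shareAtom s.2) }

theorem augDet_eq_some [Fintype α] {A : CA α X Q} {hi : X → ℕ∞} {q₀ : Q}
    {B : CSA α (Shared X Q) (AugState X Q)} (h : augDet A hi q₀ = some B) :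
    ¬ Aborts A hi q₀ ∧ B = augAut A hi q₀ := by
  unfold augDet at h
  split_ifs at h with h'
  exact ⟨h', (Option.some.inj h).symm⟩

variable {A : CA α X Q}

theorem mem_augAut_states [Fintype α] {hi : X → ℕ∞} {q₀ : Q} {s : AugState X Q} :
    s ∈ (augAut A hi q₀).states ↔ AugReach A hi q₀ s := by
  simp [augAut]

theorem mem_augAut_trans [Fintype α] {hi : X → ℕ∞} {q₀ : Q}
    {δ : Trans α (AugState X Q) (Guard (Shared X Q)) (Shared X Q → SetTerm (Shared X Q))} :
    δ ∈ (augAut A hi q₀).trans ↔ ∃ P Act a Γ, AugReach A hi q₀ (P, Act) ∧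
      Γ ⊆ subsetGuards A P a ∧ Satisfiable (minterm (subsetGuards A P a) Γ) ∧
      δ = augTrans hi Act (subsetOf A P a Γ) := by
  simp only [augAut, Finset.mem_biUnion, Finset.mem_filter, Finset.mem_univ, true_and,
    Finset.mem_image, mem_subsetTrans]
  constructor
  · rintro ⟨⟨P, Act⟩, h, a, _, ⟨Γ, h1, h2, rfl⟩, rfl⟩
    exact ⟨P, Act, a, Γ, h, h1, h2, rfl⟩
  · rintro ⟨P, Act, a, Γ, h, h1, h2, rfl⟩
    exact ⟨(P, Act), h, a, _, ⟨Γ, h1, h2, rfl⟩, rfl⟩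

theorem not_doubleInc {hi : X → ℕ∞} {q₀ : Q} (hA : ¬ Aborts A hi q₀) {P : Finset Q}
    {Act : Finset (Shared X Q)} (h : AugReach A hi q₀ (P, Act)) {a : α}
    {Γ : Finset (Guard (X × Q))} (h1 : Γ ⊆ subsetGuards A P a)
    (h2 : Satisfiable (minterm (subsetGuards A P a) Γ)) :
    ¬ DoubleInc hi (sharedUpdate hi Act (subsetOf A P a Γ).update) := fun hd =>
  hA ⟨P, Act, h, a, _, mem_subsetTrans.2 ⟨Γ, h1, h2, rfl⟩, hd⟩

theorem reach_next {hi : X → ℕ∞} {q₀ : Q} {P : Finset Q}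
    {Act : Finset (Shared X Q)} (h : AugReach A hi q₀ (P, Act)) {a : α}
    {Γ : Finset (Guard (X × Q))} (h1 : Γ ⊆ subsetGuards A P a)
    (h2 : Satisfiable (minterm (subsetGuards A P a) Γ)) :
    AugReach A hi q₀ (augTrans hi Act (subsetOf A P a Γ)).tgt :=
  h.step (mem_subsetTrans.2 ⟨Γ, h1, h2, rfl⟩)

variable (F : FlatCA A)

/-! ### Non-replication, determinism, invariants of active registers. -/

namespace FlatCA

/-- Every old register occurs in the one term `nextTerm`, which is assigned to the one index
`nextSet`. -/
theorem nonReplicating [Fintype α] (hA : ¬ Aborts A F.hi F.q₀) :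
    NonReplicating (augAut A F.hi F.q₀) := by
  rintro δ hδ z ⟨x, S1⟩ ⟨x', S2⟩ t t' ht ht' hz hz'
  obtain ⟨P, Act, a, Γ, h, h1, h2, rfl⟩ := mem_augAut_trans.1 hδ
  have hd := not_doubleInc hA h h1 h2
  rw [F.mem_augTrans_update hd] at ht ht'
  have hreg : ∀ x S, (nextTerm (moves A P a Γ) F.hi x S).reg = some (x, S) := fun x S => by
    unfold nextTerm; split_ifs <;> rfl
  rcases ht.2 with ⟨rfl, -⟩ | ⟨rfl, -⟩ | ⟨S, -, rfl, rfl⟩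
  · simp [RTerm.reg] at hz
  · simp [RTerm.reg] at hz
  rcases ht'.2 with ⟨rfl, -⟩ | ⟨rfl, -⟩ | ⟨S', -, rfl, rfl⟩
  · simp [RTerm.reg] at hz'
  · simp [RTerm.reg] at hz'
  rw [hreg] at hz hz'
  obtain rfl := Option.some.inj hz
  simp only [Option.some.injEq, Prod.mk.injEq] at hz'
  obtain ⟨rfl, rfl⟩ := hz'
  exact ⟨rfl, rfl⟩

theorem ltOnly [Fintype α] (hA : ¬ Aborts A F.hi F.q₀) :
    ∀ δ ∈ (augAut A F.hi F.q₀).trans, ∀ y, ∀ t ∈ δ.update y, t.LtOnly := by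
  rintro δ hδ ⟨x, S1⟩ t ht
  obtain ⟨P, Act, a, Γ, h, h1, h2, rfl⟩ := mem_augAut_trans.1 hδ
  rw [F.mem_augTrans_update (not_doubleInc hA h h1 h2)] at ht
  rcases ht.2 with ⟨rfl, -⟩ | ⟨rfl, -⟩ | ⟨S, -, rfl, rfl⟩
  · trivial
  · trivial
  · unfold nextTerm; split_ifs <;> trivial

/-- The set that the active registers store for the unmarked copies of a state. -/
def plainVal (Act : Finset (Shared X Q)) (s : Shared X Q → Set ℕ) (y : X × Q) : Set ℕ :=
  {n | ∃ S, (y.1, S) ∈ Act ∧ (y.2, false) ∈ S ∧ n ∈ s (y.1, S)}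

theorem sat_share {Act : Finset (Shared X Q)} {s : Shared X Q → Set ℕ} {φ : Guard (X × Q)} :
    (setLang _).sat (φ.subst (shareAtom Act)) s ↔ (setLang _).sat φ (plainVal Act s) := by
  simp only [setLang, Form.holds_subst]
  have : (fun c : CPred × (X × Q) => (shareAtom Act c).Holds
      fun c => ∃ n ∈ s c.2, c.1.Holds n) =
      fun c => ∃ n ∈ plainVal Act s c.2, c.1.Holds n := by
    funext c
    obtain ⟨p, x, q⟩ := c
    simp only [shareAtom, Form.holds_disj, List.mem_map, Finset.mem_toList, Finset.mem_filter,
      eq_iff_iff, plainVal, Set.mem_ofPred_eq]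
    constructor
    · rintro ⟨_, ⟨⟨y, S⟩, ⟨h1, rfl, h2⟩, rfl⟩, n, hn, hp⟩
      exact ⟨n, ⟨S, h1, h2, hn⟩, hp⟩
    · rintro ⟨n, ⟨S, h1, h2, hn⟩, hp⟩
      exact ⟨_, ⟨(x, S), ⟨h1, rfl, h2⟩, rfl⟩, n, hn, hp⟩
  rw [this]

/-- The set `Γ` can be read off from the memory as the set of guards true in it. -/
theorem deterministic [Fintype α] (hi : X → ℕ∞) (q₀ : Q) : Deterministic (augAut A hi q₀) := by
  rintro δ hδ δ' hδ' s hsrc hlet hs hs'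
  obtain ⟨P, Act, a, Γ, h, h1, h2, rfl⟩ := mem_augAut_trans.1 hδ
  obtain ⟨P', Act', a', Γ', h', h1', h2', rfl⟩ := mem_augAut_trans.1 hδ'
  obtain ⟨hP, hAct⟩ := Prod.mk.inj hsrc
  obtain rfl : P = P' := hP
  obtain rfl : Act = Act' := hAct
  obtain rfl : a = a' := hlet
  have e : ∀ Γ, (setLang (Shared X Q)).sat (augTrans hi Act (subsetOf A P a Γ)).guard s ↔
      ∀ φ ∈ subsetGuards A P a, (φ ∈ Γ ↔ (setLang _).sat φ (plainVal Act s)) := fun Γ =>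
    sat_share.trans sat_minterm
  rw [e] at hs hs'
  have : Γ = Γ' := by
    ext φ
    constructor
    · intro hφ
      exact (hs' φ (h1 hφ)).2 ((hs φ (h1 hφ)).1 hφ)
    · intro hφ
      exact (hs φ (h1' hφ)).2 ((hs' φ (h1' hφ)).1 hφ)
  rw [this]

/-- The indices of active registers consist of states in the scope of the counter, except that
one register is responsible for all states outside the scope. -/
theorem reach_inv (hA : ¬ Aborts A F.hi F.q₀) {P : Finset Q} {Act : Finset (Shared X Q)}
    (h : AugReach A F.hi F.q₀ (P, Act)) :
    (∀ x S, (x, S) ∈ Act → S.Nonempty ∧ (∀ m ∈ S, m.1 ∈ P) ∧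
      ((∀ m ∈ S, m.1 ∈ F.mem x) ∨ S = ofPair (P \ F.mem x) ∅)) ∧
    ∀ x, (P \ F.mem x).Nonempty → (x, ofPair (P \ F.mem x) ∅) ∈ Act := by
  generalize hs : (P, Act) = s at h
  induction h generalizing P Act with
  | init =>
    obtain ⟨rfl, rfl⟩ := Prod.mk.inj hs
    have e : ∀ x, ({F.q₀} : Finset Q) \ F.mem x = {F.q₀} := fun x => by
      simpa using F.not_mem x
    have e2 : ({(F.q₀, false)} : Finset (MState Q)) = ofPair {F.q₀} ∅ := by simp [ofPair]
    refine ⟨?_, ?_⟩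
    · intro x S hS
      simp only [augInit, Finset.mem_image, Finset.mem_univ, true_and, Prod.mk.injEq] at hS
      obtain ⟨x, rfl, rfl⟩ := hS
      refine ⟨by simp, by simp, Or.inr ?_⟩
      rw [e, e2]
    · intro x _
      rw [e, ← e2]
      simp [augInit]
  | @step P₀ Act₀ a δ h0 hδ ih =>
    obtain ⟨ih1, ih2⟩ := ih rfl
    obtain ⟨Γ, h1, h2, rfl⟩ := mem_subsetTrans.1 hδ
    obtain ⟨hP, hAct⟩ := Prod.mk.inj hs
    have hd := not_doubleInc hA h0 h1 h2
    have hP' : ∀ r, r ∈ P ↔ ∃ d ∈ moves A P₀ a Γ, d.tgt = r := fun r => by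
      rw [hP]; exact mem_subsetOf_tgt
    -- Outside its scope a counter is always reset to `0`, and inside it never is; so the register
    -- created by the constant `0` is responsible for exactly the states of `P` outside the scope.
    have hz : ∀ x, zeroSet (moves A P₀ a Γ) x = P \ F.mem x := by
      intro x
      ext r
      rw [mem_zeroSet, Finset.mem_sdiff, hP']
      constructor
      · rintro ⟨d, hd, hu, rfl⟩
        refine ⟨⟨d, hd, rfl⟩, ?_⟩
        rcases F.update_cases (mem_moves.1 hd).1 x with h | h | h | h
        · exact h.2
        all_goals simp [h.1] at hu
      · rintro ⟨⟨d, hd, rfl⟩, hr⟩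
        exact ⟨d, hd, F.update_zero d (mem_moves.1 hd).1 x hr, rfl⟩
    have ho : ∀ x, ∀ r ∈ oneSet (moves A P₀ a Γ) x, r ∈ P ∧ r ∈ F.mem x := by
      intro x r hr
      obtain ⟨d, hd, hu, rfl⟩ := mem_oneSet.1 hr
      refine ⟨(hP' _).2 ⟨d, hd, rfl⟩, ?_⟩
      rcases F.update_cases (mem_moves.1 hd).1 x with h | h | h | h
      · simp [h.1] at hu
      · exact F.fst_subset x h.2
      all_goals simp [h.1] at hu
    have hk : ∀ x U, ∀ r ∈ keepSet (moves A P₀ a Γ) x U, r ∈ P ∧ r ∈ F.mem x := by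
      intro x U r hr
      obtain ⟨d, hd, hu, -, rfl⟩ := mem_keepSet.1 hr
      refine ⟨(hP' _).2 ⟨d, hd, rfl⟩, ?_⟩
      rcases F.update_cases (mem_moves.1 hd).1 x with h | h | h | h
      · simp [h.1] at hu
      · simp [h.1] at hu
      · exact h.2.2.2
      · simp [h.1] at hu
    have hinc : ∀ x U, ∀ r ∈ incSet (moves A P₀ a Γ) x U, r ∈ P ∧ r ∈ F.mem x := by
      intro x U r hr
      obtain ⟨d, hd, hu, -, rfl⟩ := mem_incSet.1 hr
      refine ⟨(hP' _).2 ⟨d, hd, rfl⟩, ?_⟩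
      rcases F.update_cases (mem_moves.1 hd).1 x with h | h | h | h
      · simp [h.1] at hu
      · simp [h.1] at hu
      · simp [h.1] at hu
      · exact F.fst_subset x h.2.2.2
    refine ⟨?_, ?_⟩
    · intro x S' hS'
      rw [hAct] at hS'
      obtain ⟨t, ht⟩ := mem_augTrans_active.1 hS'
      obtain ⟨hne, ht⟩ := (F.mem_augTrans_update hd).1 ht
      refine ⟨hne, ?_⟩
      rcases ht with ⟨-, rfl⟩ | ⟨-, rfl⟩ | ⟨S, -, -, rfl⟩
      · rw [hz]
        refine ⟨?_, Or.inr rfl⟩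
        rintro ⟨q, b⟩ hm
        cases b
        · simp only [mem_ofPair_false, Finset.mem_sdiff] at hm
          exact hm.1
        · simp at hm
      · have : ∀ m ∈ ofPair (oneSet (moves A P₀ a Γ) x) ∅, m.1 ∈ P ∧ m.1 ∈ F.mem x := by
          rintro ⟨q, b⟩ hm
          cases b
          · exact ho x q (by simpa using hm)
          · simp at hm
        exact ⟨fun m hm => (this m hm).1, Or.inl fun m hm => (this m hm).2⟩
      · have : ∀ m ∈ nextSet (moves A P₀ a Γ) x S, m.1 ∈ P ∧ m.1 ∈ F.mem x := by
          have hb : ∀ r ∈ incSet (moves A P₀ a Γ) x (plain S) ∪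
              keepSet (moves A P₀ a Γ) x (marked S), r ∈ P ∧ r ∈ F.mem x := by
            intro r hr
            rcases Finset.mem_union.1 hr with hr | hr
            · exact hinc _ _ _ hr
            · exact hk _ _ _ hr
          rintro ⟨q, b⟩ hm
          unfold nextSet normPair at hm
          split_ifs at hm
          · cases b
            · exact hb q (by simpa using hm)
            · simp at hm
          · cases b
            · exact hk x (plain S) q (by simpa using hm)
            · exact hb q (by simpa using hm)
        exact ⟨fun m hm => (this m hm).1, Or.inl fun m hm => (this m hm).2⟩
    · intro x hx
      rw [hAct]
      refine mem_augTrans_active.2 ⟨.zero, (F.mem_augTrans_update hd).2 ⟨?_, Or.inl ⟨rfl, ?_⟩⟩⟩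
      · exact ofPair_nonempty.2 (Or.inl hx)
      · rw [hz]

-- All guards are positive, and the full set `ℕ` in every register contains a witness for each atom,
-- `0` being one for `x < hi x` as `hi x > 0`. Thus the construction really explores the step in
-- which every transition is enabled.
include F in
theorem satisfiable_full (P : Finset Q) (a : α) :
    Satisfiable (minterm (subsetGuards A P a) (subsetGuards A P a)) := by
  refine ⟨fun _ => Set.univ, sat_minterm.2 fun φ hφ => iff_of_true hφ ?_⟩
  obtain ⟨d, hd, -, -, rfl⟩ := mem_subsetGuards.1 hφ
  rcases F.guard_cases d hd with h | ⟨x, -, h | h⟩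
  · rw [h]; trivial
  · rw [h]
    exact ⟨⟨F.lo x, trivial, le_refl (F.lo x)⟩, trivial⟩
  · rw [h]
    exact ⟨⟨0, trivial, by simpa [CPred.Holds] using F.hi_pos x⟩, trivial⟩

/-- A true guard is positive in every satisfiable minterm, so keeping a counter never depends on the
memory. -/
theorem tt_mem {P : Finset Q} {a : α} {Γ : Finset (Guard (X × Q))}
    (h2 : Satisfiable (minterm (subsetGuards A P a) Γ))
    {d : Trans α Q (Guard X) (X → CTerm X)} (hd : d ∈ A.trans) (hs : d.src ∈ P)
    (ha : d.letter = a) (hg : d.guard = .tt) : d ∈ moves A P a Γ := by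
  obtain ⟨s, hs'⟩ := h2
  refine mem_moves.2 ⟨hd, hs, ha, ?_⟩
  refine (sat_minterm.1 hs' _ (mem_subsetGuards.2 ⟨d, hd, hs, ha, rfl⟩)).2 ?_
  rw [hg]
  trivial

/-- No marked state is one where the counter can be tested or incremented. -/
theorem marked_not_mem_lst (hA : ¬ Aborts A F.hi F.q₀) {P : Finset Q} {Act : Finset (Shared X Q)}
    (h : AugReach A F.hi F.q₀ (P, Act)) {x : X} {S : Finset (MState Q)} (hS : (x, S) ∈ Act)
    {q : Q} (hq : (q, true) ∈ S) : q ∉ F.lst x := by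
  intro hl
  obtain ⟨q', hq'⟩ := F.fst_nonempty x
  -- An increment transition leaves `q`. The minterm with all guards positive enables it, and on the
  -- marked state `q` it would cause a double increment.
  obtain ⟨d, hd, h1, h2, h3, h4⟩ := F.exists_inc x q hl q' hq'
  have hP : q ∈ P := ((F.reach_inv hA h).1 x S hS).2.1 _ hq
  have hm : d ∈ moves A P d.letter (subsetGuards A P d.letter) :=
    mem_moves.2 ⟨hd, h1 ▸ hP, rfl, mem_subsetGuards.2 ⟨d, hd, h1 ▸ hP, rfl, rfl⟩⟩
  have := F.incSet_marked (not_doubleInc hA h subset_rfl (F.satisfiable_full P d.letter)) hS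
  have hmem : q' ∈ incSet (moves A P d.letter (subsetGuards A P d.letter)) x (marked S) :=
    mem_incSet.2 ⟨d, hm, h4, by simpa [h1] using hq, h2⟩
  rw [this] at hmem
  simp at hmem

/-- The set that the active registers store for a state. -/
def val (Act : Finset (Shared X Q)) (s : Shared X Q → Set ℕ) (x : X) (q : Q) : Set ℕ :=
  {n | ∃ S, (x, S) ∈ Act ∧ (((q, false) ∈ S ∧ n ∈ s (x, S)) ∨
    ((q, true) ∈ S ∧ ∃ k ∈ s (x, S), (k : ℕ∞) < F.hi x ∧ n = k + 1))}

/-- Guards are translated without looking at marks. This loses nothing where a counter is tested,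
since such states are never marked. -/
theorem val_eq_plainVal (hA : ¬ Aborts A F.hi F.q₀) {P : Finset Q} {Act : Finset (Shared X Q)}
    (h : AugReach A F.hi F.q₀ (P, Act)) (s : Shared X Q → Set ℕ) {x : X} {q : Q}
    (hq : q ∈ F.lst x) : F.val Act s x q = plainVal Act s (x, q) := by
  ext n
  constructor
  · rintro ⟨S, hS, ⟨h1, h2⟩ | ⟨h1, -⟩⟩
    · exact ⟨S, hS, h1, h2⟩
    · exact absurd hq (F.marked_not_mem_lst hA h hS h1)
  · rintro ⟨S, hS, h1, h2⟩
    exact ⟨S, hS, Or.inl ⟨h1, h2⟩⟩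

/-- `val` already applies postponed increments, so it is immaterial whether an increment is carried
out in the r-term or turned into a mark. -/
theorem mem_val_next {P : Finset Q} {a : α} {Γ : Finset (Guard (X × Q))}
    {Act : Finset (Shared X Q)}
    (hd : ¬ DoubleInc F.hi (sharedUpdate F.hi Act (subsetOf A P a Γ).update))
    {s : Shared X Q → Set ℕ} {x : X} {r : Q} {n : ℕ} :
    n ∈ F.val (augTrans F.hi Act (subsetOf A P a Γ)).tgt.2
      (fun y => (setLang (Shared X Q)).eval
        ((augTrans F.hi Act (subsetOf A P a Γ)).update y) s) x r ↔
      (r ∈ zeroSet (moves A P a Γ) x ∧ n = 0) ∨ (r ∈ oneSet (moves A P a Γ) x ∧ n = 1) ∨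
      ∃ S, (x, S) ∈ Act ∧ ((r ∈ keepSet (moves A P a Γ) x (plain S) ∧ n ∈ s (x, S)) ∨
        (r ∈ incSet (moves A P a Γ) x (plain S) ∪ keepSet (moves A P a Γ) x (marked S) ∧
          ∃ k ∈ s (x, S), (k : ℕ∞) < F.hi x ∧ n = k + 1)) := by
  have e : ∀ S' k, k ∈ (setLang (Shared X Q)).eval
      ((augTrans F.hi Act (subsetOf A P a Γ)).update (x, S')) s ↔
      ∃ t ∈ (augTrans F.hi Act (subsetOf A P a Γ)).update (x, S'), k ∈ t.eval s :=
    fun _ _ => Iff.rfl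
  have efinc : ∀ S k, k ∈ (finc F.hi x (.var (x, S)) : RTerm (Shared X Q)).eval s ↔
      ∃ j ∈ s (x, S), (j : ℕ∞) < F.hi x ∧ k = j + 1 := by
    intro S k
    simp only [finc, RTerm.eval, Set.mem_image, Set.mem_ofPred_eq, CPred.Holds, and_assoc]
    exact exists_congr fun j => and_congr_right fun _ => and_congr_right fun _ => eq_comm
  simp only [val, Set.mem_ofPred_eq, mem_augTrans_active, e, F.mem_augTrans_update hd]
  constructor
  · rintro ⟨S', -, ⟨hr, t, ⟨-, ht⟩, hn⟩ | ⟨hr, k, ⟨t, ⟨-, ht⟩, hn⟩, hk, rfl⟩⟩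
    · rcases ht with ⟨rfl, rfl⟩ | ⟨rfl, rfl⟩ | ⟨S, hS, rfl, rfl⟩
      · exact Or.inl ⟨by simpa using hr, hn⟩
      · exact Or.inr (Or.inl ⟨by simpa using hr, hn⟩)
      · refine Or.inr (Or.inr ⟨S, hS, ?_⟩)
        unfold nextSet normPair at hr
        unfold nextTerm at hn
        split_ifs at hr hn
        · exact Or.inr ⟨by simpa using hr, (efinc S n).1 hn⟩
        · exact Or.inl ⟨by simpa using hr, hn⟩
    · rcases ht with ⟨rfl, rfl⟩ | ⟨rfl, rfl⟩ | ⟨S, hS, rfl, rfl⟩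
      · simp at hr
      · simp at hr
      · refine Or.inr (Or.inr ⟨S, hS, ?_⟩)
        unfold nextSet normPair at hr
        unfold nextTerm at hn
        split_ifs at hr hn
        · simp at hr
        · exact Or.inr ⟨by simpa using hr, k, hn, hk, rfl⟩
  · have key : ∀ (S' : Finset (MState Q)) (b : Bool), (r, b) ∈ S' → S'.Nonempty := fun S' b h => ⟨_, h⟩
    rintro (⟨hr, rfl⟩ | ⟨hr, rfl⟩ | ⟨S, hS, ⟨hr, hn⟩ | ⟨hr, k, hn, hk, rfl⟩⟩)
    · have hr' : (r, false) ∈ ofPair (zeroSet (moves A P a Γ) x) ∅ := by simpa using hr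
      exact ⟨_, ⟨.zero, key _ _ hr', Or.inl ⟨rfl, rfl⟩⟩,
        Or.inl ⟨hr', .zero, ⟨key _ _ hr', Or.inl ⟨rfl, rfl⟩⟩, rfl⟩⟩
    · have hr' : (r, false) ∈ ofPair (oneSet (moves A P a Γ) x) ∅ := by simpa using hr
      exact ⟨_, ⟨.one, key _ _ hr', Or.inr (Or.inl ⟨rfl, rfl⟩)⟩,
        Or.inl ⟨hr', .one, ⟨key _ _ hr', Or.inr (Or.inl ⟨rfl, rfl⟩)⟩, rfl⟩⟩
    · have hne : keepSet (moves A P a Γ) x (plain S) ≠ ∅ := Finset.ne_empty_of_mem hr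
      have hr' : (r, false) ∈ nextSet (moves A P a Γ) x S := by
        simpa [nextSet, normPair, hne] using hr
      have ht : ∃ S₁, (x, S₁) ∈ Act ∧ nextTerm (moves A P a Γ) F.hi x S =
          nextTerm (moves A P a Γ) F.hi x S₁ ∧
          nextSet (moves A P a Γ) x S = nextSet (moves A P a Γ) x S₁ := ⟨S, hS, rfl, rfl⟩
      refine ⟨_, ⟨_, key _ _ hr', Or.inr (Or.inr ht)⟩,
        Or.inl ⟨hr', _, ⟨key _ _ hr', Or.inr (Or.inr ht)⟩, ?_⟩⟩
      rw [nextTerm, if_neg hne]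
      exact hn
    · by_cases hne : keepSet (moves A P a Γ) x (plain S) = ∅
      · have hr' : (r, false) ∈ nextSet (moves A P a Γ) x S := by
          simpa [nextSet, normPair, hne] using hr
        have ht : ∃ S₁, (x, S₁) ∈ Act ∧ nextTerm (moves A P a Γ) F.hi x S =
            nextTerm (moves A P a Γ) F.hi x S₁ ∧
            nextSet (moves A P a Γ) x S = nextSet (moves A P a Γ) x S₁ := ⟨S, hS, rfl, rfl⟩
        refine ⟨_, ⟨_, key _ _ hr', Or.inr (Or.inr ht)⟩,
          Or.inl ⟨hr', _, ⟨key _ _ hr', Or.inr (Or.inr ht)⟩, ?_⟩⟩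
        rw [nextTerm, if_pos hne, efinc]
        exact ⟨k, hn, hk, rfl⟩
      · have hr' : (r, true) ∈ nextSet (moves A P a Γ) x S := by
          simpa [nextSet, normPair, hne] using hr
        have ht : ∃ S₁, (x, S₁) ∈ Act ∧ nextTerm (moves A P a Γ) F.hi x S =
            nextTerm (moves A P a Γ) F.hi x S₁ ∧
            nextSet (moves A P a Γ) x S = nextSet (moves A P a Γ) x S₁ := ⟨S, hS, rfl, rfl⟩
        refine ⟨_, ⟨_, key _ _ hr', Or.inr (Or.inr ht)⟩,
          Or.inr ⟨hr', k, ⟨_, ⟨key _ _ hr', Or.inr (Or.inr ht)⟩, ?_⟩, hk, rfl⟩⟩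
        rw [nextTerm, if_neg hne]
        exact hn

/-! ### The language -/

/-- The state and memory of the augmented automaton represent the configurations in `C`. -/
def Represents (C : Set (Q × (X → ℕ))) (P : Finset Q) (Act : Finset (Shared X Q))
    (s : Shared X Q → Set ℕ) : Prop :=
  (∀ q, q ∈ P ↔ ∃ m, (q, m) ∈ C) ∧
  ∀ x, ∀ q ∈ P, ∀ n, n ∈ F.val Act s x q ↔ ∃ m, (q, m) ∈ C ∧ m x = n

/-- A guard concerns one counter, so some reached configuration at `q` satisfies it iff some value
of that counter at `q` does. With two counters, the separate sets of values would lose their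
correlation. -/
theorem Represents.sat_index {C : Set (Q × (X → ℕ))} {P : Finset Q} {Act : Finset (Shared X Q)}
    {s : Shared X Q → Set ℕ} (hr : F.Represents C P Act s) (hA : ¬ Aborts A F.hi F.q₀)
    (h : AugReach A F.hi F.q₀ (P, Act)) {q : Q} (hq : q ∈ P) {φ : Guard X}
    (hφ : φ = .tt ∨ φ = .ff ∨ ∃ x, q ∈ F.lst x ∧ ∃ p, φ = .and (.atom (p, x)) .tt) :
    (setLang _).sat (indexGuard q φ) (plainVal Act s) ↔
      ∃ m, (q, m) ∈ C ∧ (natLang X).sat φ m := by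
  rcases hφ with rfl | rfl | ⟨x, hx, p, rfl⟩
  · obtain ⟨m, hm⟩ := (hr.1 q).1 hq
    exact iff_of_true trivial ⟨m, hm, trivial⟩
  · exact iff_of_false id fun ⟨m, _, h⟩ => h
  · have e : (setLang _).sat (indexGuard q (.and (.atom (p, x)) .tt)) (plainVal Act s) ↔
        ∃ n ∈ plainVal Act s (x, q), p.Holds n :=
      ⟨fun h => h.1, fun h => ⟨h, trivial⟩⟩
    rw [e, ← F.val_eq_plainVal hA h s hx]
    constructor
    · rintro ⟨n, hn, hp⟩
      obtain ⟨m, hm, rfl⟩ := (hr.2 x q hq n).1 hn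
      exact ⟨m, hm, hp, trivial⟩
    · rintro ⟨m, hm, hp, -⟩
      exact ⟨m x, (hr.2 x q hq _).2 ⟨m, hm, rfl⟩, hp⟩

/-- The memory keeps, for each counter and state, the exact set of values in reached configurations.
This survives a step because a new value depends on the same counter only, and the guard is true or
tests that very counter whenever the old value matters. Where the counter is reset, the existence of
some enabling configuration suffices. -/
theorem exists_reached [Fintype α] (hA : ¬ Aborts A F.hi F.q₀) (w : List α) :
    ∃ P Act s, AugReach A F.hi F.q₀ (P, Act) ∧
      RegAut.Reached (setLang _) (augAut A F.hi F.q₀) w = {((P, Act), s)} ∧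
      F.Represents (RegAut.Reached (natLang X) A w) P Act s := by
  induction w using List.reverseRecOn with
  | nil =>
    refine ⟨{F.q₀}, augInit X F.q₀, fun z => if z ∈ augInit X F.q₀ then {0} else ∅,
      AugReach.init, ?_, ?_, ?_⟩
    · ext c
      rw [RegAut.mem_reached_nil]
      rfl
    · intro q
      simp only [RegAut.mem_reached_nil, F.init_eq, Finset.mem_singleton, Set.mem_singleton_iff,
        Prod.mk.injEq]
      exact ⟨fun h => ⟨_, h, rfl⟩, fun ⟨_, h, _⟩ => h⟩
    · intro x q hq n
      rw [Finset.mem_singleton] at hq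
      subst hq
      have hx : (x, {(F.q₀, false)}) ∈ augInit X F.q₀ := by simp [augInit]
      simp only [RegAut.mem_reached_nil, F.init_eq, Set.mem_singleton_iff, Prod.mk.injEq,
        true_and, val, Set.mem_ofPred_eq]
      constructor
      · rintro ⟨S, hS, ⟨-, h2⟩ | ⟨h1, -⟩⟩
        · rw [if_pos hS] at h2
          exact ⟨_, rfl, h2.symm⟩
        · simp only [augInit, Finset.mem_image, Finset.mem_univ, true_and, Prod.mk.injEq] at hS
          obtain ⟨x, rfl, rfl⟩ := hS
          simp at h1
      · rintro ⟨m, rfl, rfl⟩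
        exact ⟨_, hx, Or.inl ⟨by simp, by rw [if_pos hx]; rfl⟩⟩
  | append_singleton w a ih =>
    obtain ⟨P, Act, s, h, hB, hr⟩ := ih
    classical
    -- The guards that are true in the current memory; their minterm gives the unique enabled
    -- transition.
    set Γ : Finset (Guard (X × Q)) :=
      (subsetGuards A P a).filter fun φ => (setLang _).sat φ (plainVal Act s) with hΓ
    have h1 : Γ ⊆ subsetGuards A P a := Finset.filter_subset _ _
    have hsat : (setLang _).sat (minterm (subsetGuards A P a) Γ) (plainVal Act s) := by
      rw [sat_minterm]
      intro φ hφ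
      simp [hΓ, hφ]
    have h2 : Satisfiable (minterm (subsetGuards A P a) Γ) := ⟨_, hsat⟩
    have hdi := not_doubleInc hA h h1 h2
    set δ := augTrans F.hi Act (subsetOf A P a Γ) with hδ
    have hδB : δ ∈ (augAut A F.hi F.q₀).trans :=
      mem_augAut_trans.2 ⟨P, Act, a, Γ, h, h1, h2, rfl⟩
    have hmove : ∀ d ∈ A.trans, d.src ∈ P → d.letter = a → (d ∈ moves A P a Γ ↔
        ∃ m, (d.src, m) ∈ RegAut.Reached (natLang X) A w ∧ (natLang X).sat d.guard m) := by
      intro d hd hP ha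
      rw [← hr.sat_index F hA h hP (φ := d.guard), mem_moves, hΓ, Finset.mem_filter]
      · have := mem_subsetGuards.2 ⟨d, hd, hP, ha, rfl⟩
        tauto
      · rcases F.guard_cases d hd with h | ⟨x, hx, h | h⟩
        · exact Or.inl h
        · exact Or.inr (Or.inr ⟨x, hx, _, h⟩)
        · exact Or.inr (Or.inr ⟨x, hx, _, h⟩)
    have hnext : ∀ c, c ∈ RegAut.Reached (natLang X) A (w ++ [a]) ↔ ∃ d ∈ moves A P a Γ, ∃ m,
        (d.src, m) ∈ RegAut.Reached (natLang X) A w ∧ (natLang X).sat d.guard m ∧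
        c = (d.tgt, fun x => (d.update x).eval m) := by
      intro c
      rw [RegAut.mem_reached_snoc]
      constructor
      · rintro ⟨⟨q, m⟩, hm, d, hd, rfl, ha, hg, rfl⟩
        exact ⟨d, (hmove d hd ((hr.1 _).2 ⟨m, hm⟩) ha).2 ⟨m, hm, hg⟩, m, hm, hg, rfl⟩
      · rintro ⟨d, hd, m, hm, hg, rfl⟩
        exact ⟨_, hm, d, (mem_moves.1 hd).1, rfl, (mem_moves.1 hd).2.2.1, hg, rfl⟩
    refine ⟨δ.tgt.1, δ.tgt.2, fun y => (setLang _).eval (δ.update y) s,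
      reach_next h h1 h2, ?_, ?_, ?_⟩
    · ext c
      rw [RegAut.mem_reached_snoc, hB, Set.mem_singleton_iff]
      constructor
      · rintro ⟨c', hc', δ', hδ', e1, e2, e3, rfl⟩
        rw [Set.mem_singleton_iff] at hc'
        subst hc'
        have : δ' = δ := deterministic _ _ δ' hδ' δ hδB s e1 e2 e3 (sat_share.2 hsat)
        rw [this]
      · rintro rfl
        exact ⟨_, rfl, δ, hδB, rfl, rfl, sat_share.2 hsat, rfl⟩
    · intro r
      have e : r ∈ δ.tgt.1 ↔ ∃ d ∈ moves A P a Γ, d.tgt = r := mem_subsetOf_tgt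
      rw [e]
      simp only [hnext]
      constructor
      · rintro ⟨d, hd, rfl⟩
        obtain ⟨hd1, hd2, hd3, -⟩ := mem_moves.1 hd
        obtain ⟨m, hm, hg⟩ := (hmove d hd1 hd2 hd3).1 hd
        exact ⟨_, d, hd, m, hm, hg, rfl⟩
      · rintro ⟨_, d, hd, m, hm, hg, hc⟩
        exact ⟨d, hd, (Prod.mk.inj hc).1.symm⟩
    · intro x r _ n
      rw [F.mem_val_next hdi]
      simp only [hnext]
      have conf : ∀ d ∈ moves A P a Γ, ∃ m, (d.src, m) ∈ RegAut.Reached (natLang X) A w ∧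
          (natLang X).sat d.guard m := by
        intro d hd
        obtain ⟨hd1, hd2, hd3, -⟩ := mem_moves.1 hd
        exact (hmove d hd1 hd2 hd3).1 hd
      constructor
      · have hvar : ∀ d ∈ moves A P a Γ, d.update x = .var x → d.guard = .tt := by
          intro d hd hu
          rcases F.update_cases (mem_moves.1 hd).1 x with h | h | h | h
          · simp [h.1] at hu
          · simp [h.1] at hu
          · exact h.2.1
          · simp [h.1] at hu
        have hkeep : ∀ d ∈ moves A P a Γ, d.update x = .var x → n ∈ F.val Act s x d.src →
            ∃ m, (∃ d' ∈ moves A P a Γ, ∃ m', (d'.src, m') ∈ RegAut.Reached (natLang X) A w ∧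
              (natLang X).sat d'.guard m' ∧
              (d.tgt, m) = (d'.tgt, fun x => (d'.update x).eval m')) ∧ m x = n := by
          intro d hd hu hn
          obtain ⟨m, hm, rfl⟩ := (hr.2 x d.src (mem_moves.1 hd).2.1 n).1 hn
          exact ⟨_, ⟨d, hd, m, hm, by rw [hvar d hd hu]; trivial, rfl⟩, by simp [hu, CTerm.eval]⟩
        rintro (⟨hz, rfl⟩ | ⟨ho, rfl⟩ | ⟨S, hS, ⟨hk, hn⟩ | ⟨hk, k, hks, hkhi, rfl⟩⟩)
        · obtain ⟨d, hd, hu, rfl⟩ := mem_zeroSet.1 hz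
          obtain ⟨m, hm, hg⟩ := conf d hd
          exact ⟨_, ⟨d, hd, m, hm, hg, rfl⟩, by simp [hu, CTerm.eval]⟩
        · obtain ⟨d, hd, hu, rfl⟩ := mem_oneSet.1 ho
          obtain ⟨m, hm, hg⟩ := conf d hd
          exact ⟨_, ⟨d, hd, m, hm, hg, rfl⟩, by simp [hu, CTerm.eval]⟩
        · obtain ⟨d, hd, hu, hsrc, rfl⟩ := mem_keepSet.1 hk
          exact hkeep d hd hu ⟨S, hS, Or.inl ⟨mem_plain.1 hsrc, hn⟩⟩
        · rcases Finset.mem_union.1 hk with hk | hk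
          · obtain ⟨d, hd, hu, hsrc, rfl⟩ := mem_incSet.1 hk
            obtain ⟨m, hm, rfl⟩ := (hr.2 x d.src (mem_moves.1 hd).2.1 k).1
              ⟨S, hS, Or.inl ⟨mem_plain.1 hsrc, hks⟩⟩
            have hg : d.guard = ltGuard F.hi x := by
              rcases F.update_cases (mem_moves.1 hd).1 x with h | h | h | h
              · simp [h.1] at hu
              · simp [h.1] at hu
              · simp [h.1] at hu
              · exact h.2.1
            refine ⟨_, ⟨d, hd, m, hm, ?_, rfl⟩, by simp [hu, CTerm.eval]⟩
            rw [hg]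
            exact ⟨hkhi, trivial⟩
          · obtain ⟨d, hd, hu, hsrc, rfl⟩ := mem_keepSet.1 hk
            exact hkeep d hd hu ⟨S, hS, Or.inr ⟨mem_marked.1 hsrc, k, hks, hkhi, rfl⟩⟩
      · rintro ⟨_, ⟨d, hd, m, hm, hg, hc⟩, rfl⟩
        obtain ⟨rfl, rfl⟩ := Prod.mk.inj hc
        have hv : m x ∈ F.val Act s x d.src :=
          (hr.2 x d.src (mem_moves.1 hd).2.1 _).2 ⟨m, hm, rfl⟩
        rcases F.update_cases (mem_moves.1 hd).1 x with h' | h' | h' | h'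
        · exact Or.inl ⟨mem_zeroSet.2 ⟨d, hd, h'.1, rfl⟩, by simp [h'.1, CTerm.eval]⟩
        · exact Or.inr (Or.inl ⟨mem_oneSet.2 ⟨d, hd, h'.1, rfl⟩, by simp [h'.1, CTerm.eval]⟩)
        · obtain ⟨S, hS, ⟨h3, h4⟩ | ⟨h3, h4⟩⟩ := hv
          · exact Or.inr (Or.inr ⟨S, hS, Or.inl ⟨mem_keepSet.2 ⟨d, hd, h'.1, mem_plain.2 h3, rfl⟩,
              by simpa [h'.1, CTerm.eval] using h4⟩⟩)
          · exact Or.inr (Or.inr ⟨S, hS, Or.inr ⟨Finset.mem_union_right _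
              (mem_keepSet.2 ⟨d, hd, h'.1, mem_marked.2 h3, rfl⟩),
              by simpa [h'.1, CTerm.eval] using h4⟩⟩)
        · rw [F.val_eq_plainVal hA h s h'.2.2.1] at hv
          obtain ⟨S, hS, h3, h4⟩ := hv
          rw [h'.2.1] at hg
          exact Or.inr (Or.inr ⟨S, hS, Or.inr ⟨Finset.mem_union_left _
            (mem_incSet.2 ⟨d, hd, h'.1, mem_plain.2 h3, rfl⟩), m x, h4, hg.1,
            by simp [h'.1, CTerm.eval]⟩⟩)

theorem lang_eq [Fintype α] (hA : ¬ Aborts A F.hi F.q₀) :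
    (augAut A F.hi F.q₀).lang (setLang _) = A.lang (natLang X) := by
  ext w
  obtain ⟨P, Act, s, h, hB, hr⟩ := F.exists_reached hA w
  rw [RegAut.mem_lang, RegAut.mem_lang, hB]
  have e : (∃ c ∈ ({((P, Act), s)} : Set (AugState X Q × (Shared X Q → Set ℕ))),
      (setLang _).sat ((augAut A F.hi F.q₀).final c.1) c.2) ↔
      (setLang _).sat ((subsetFinal A P).subst (shareAtom Act)) s := by
    simp only [Set.mem_singleton_iff, exists_eq_left]
    rfl
  rw [e, sat_share]
  have e2 : (setLang _).sat (subsetFinal A P) (plainVal Act s) ↔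
      ∃ q ∈ P, (setLang _).sat (indexGuard q (A.final q)) (plainVal Act s) := by
    simp only [setLang, subsetFinal, Form.holds_disj, List.mem_map, Finset.mem_toList]
    constructor
    · rintro ⟨_, ⟨q, hq, rfl⟩, h⟩; exact ⟨q, hq, h⟩
    · rintro ⟨q, hq, h⟩; exact ⟨_, ⟨q, hq, rfl⟩, h⟩
  rw [e2]
  have e3 : ∀ q ∈ P, ((setLang _).sat (indexGuard q (A.final q)) (plainVal Act s) ↔
      ∃ m, (q, m) ∈ RegAut.Reached (natLang X) A w ∧ (natLang X).sat (A.final q) m) := by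
    intro q hq
    refine hr.sat_index F hA h hq ?_
    rcases F.final_cases q with h | h | ⟨x, hx, h⟩
    · exact Or.inl h
    · exact Or.inr (Or.inl h)
    · exact Or.inr (Or.inr ⟨x, hx, _, h⟩)
  constructor
  · rintro ⟨q, hq, h⟩
    obtain ⟨m, hm, hs⟩ := (e3 q hq).1 h
    exact ⟨_, hm, hs⟩
  · rintro ⟨⟨q, m⟩, hm, hs⟩
    have hq := (hr.1 q).2 ⟨m, hm⟩
    exact ⟨q, hq, (e3 q hq).2 ⟨m, hm, hs⟩⟩

end FlatCA

end Aug

/-! ### Repetitions of one letter -/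

section Unary

variable {Q : Type} [DecidableEq Q] {K : Finset Q → Finset Q} {E L : Finset Q}

variable (K E L) in
/-- Among the runs that start in `E` and stay under the iterates of `K`, where an increment leads
back from `L` to `E`, there is one of length `n` with `c` increments, the last one `k` steps ago. -/
inductive Parse : ℕ → ℕ → ℕ → Prop where
  | start : Parse 0 0 0
  | keep {n c k : ℕ} : Parse n c k → (K^[k + 1] E).Nonempty → Parse (n + 1) c (k + 1)
  | inc {n c k : ℕ} : Parse n c k → (K^[k] E ∩ L).Nonempty → Parse (n + 1) (c + 1) 0

variable (K E L) in
/-- The pairs of sets of states in `R`, the second one with a postponed increment, are closed under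
the steps of the augmented determinization, and no increment is postponed twice. -/
structure PairSystem (R : Finset Q → Finset Q → Prop) : Prop where
  map_empty : K ∅ = ∅
  map_union : ∀ U V, K (U ∪ V) = K U ∪ K V
  start_nonempty : E.Nonempty
  disjoint : ∀ {U V}, R U V → Disjoint V L
  start : R E ∅
  step : ∀ {U V}, R U V → (K U).Nonempty → R (K U) (K V ∪ if (U ∩ L).Nonempty then E else ∅)
  step_norm : ∀ {U V}, R U V → K U = ∅ → (K V ∪ if (U ∩ L).Nonempty then E else ∅).Nonempty →
    R (K V ∪ if (U ∩ L).Nonempty then E else ∅) ∅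

namespace PairSystem

variable {R : Finset Q → Finset Q → Prop} (h : PairSystem K E L R)

include h

theorem mono {U V : Finset Q} (hUV : U ⊆ V) : K U ⊆ K V := by
  rw [← Finset.union_eq_right.2 hUV, h.map_union]
  exact Finset.subset_union_left

theorem iterate_nonempty_of_le {i j : ℕ} (hij : i ≤ j) (hj : (K^[j] E).Nonempty) :
    (K^[i] E).Nonempty := by
  rw [Finset.nonempty_iff_ne_empty]
  intro hi
  obtain ⟨k, rfl⟩ := Nat.exists_eq_add_of_le hij
  rw [Nat.add_comm, Function.iterate_add_apply, hi, Function.iterate_fixed h.map_empty] at hj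
  simp at hj

/-- `U` covers the runs with `c₀` increments and `V` those with one more. A run in `V` cannot
increment, as `V` is disjoint from `L`. When `U` dies out, normalisation makes `V` the new first
component and `c₀` grows by one. So all runs of equal length have increment counts within one of
each other. -/
theorem exists_pair (n : ℕ) (hn : ∃ c k, Parse K E L n c k) :
    ∃ U V c₀, R U V ∧ ∀ c k, Parse K E L n c k →
      (c = c₀ ∧ K^[k] E ⊆ U) ∨ (c = c₀ + 1 ∧ K^[k] E ⊆ V) := by
  induction n with
  | zero =>
    refine ⟨E, ∅, 0, h.start, fun c k hp => ?_⟩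
    cases hp
    exact Or.inl ⟨rfl, subset_rfl⟩
  | succ n ih =>
    obtain ⟨c₁, k₁, hp₁⟩ := hn
    obtain ⟨U, V, c₀, hR, hall⟩ : ∃ U V c₀, R U V ∧ ∀ c k, Parse K E L n c k →
      (c = c₀ ∧ K^[k] E ⊆ U) ∨ (c = c₀ + 1 ∧ K^[k] E ⊆ V) := by
      refine ih ?_
      cases hp₁ with
      | keep hp _ => exact ⟨_, _, hp⟩
      | inc hp _ => exact ⟨_, _, hp⟩
    have key : ∀ c k, Parse K E L (n + 1) c k → (K^[k] E).Nonempty ∧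
        ((c = c₀ ∧ K^[k] E ⊆ K U) ∨
        (c = c₀ + 1 ∧ K^[k] E ⊆ K V ∪ if (U ∩ L).Nonempty then E else ∅)) := by
      intro c k hp
      cases hp with
      | @keep _ _ k hp hne =>
        refine ⟨hne, ?_⟩
        rw [Function.iterate_succ_apply']
        rcases hall _ _ hp with ⟨hc, hs⟩ | ⟨hc, hs⟩
        · exact Or.inl ⟨hc, h.mono hs⟩
        · exact Or.inr ⟨hc, (h.mono hs).trans Finset.subset_union_left⟩
      | @inc _ c k hp hne =>
        refine ⟨h.start_nonempty, Or.inr ?_⟩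
        rcases hall _ _ hp with ⟨hc, hs⟩ | ⟨hc, hs⟩
        · rw [if_pos (hne.mono (Finset.inter_subset_inter_right hs)), hc]
          exact ⟨rfl, Finset.subset_union_right⟩
        · obtain ⟨q, hq⟩ := hne
          rw [Finset.mem_inter] at hq
          exact absurd hq.2 (Finset.disjoint_left.1 (h.disjoint hR) (hs hq.1))
    by_cases hU : (K U).Nonempty
    · exact ⟨_, _, c₀, h.step hR hU, fun c k hp => (key c k hp).2⟩
    · rw [Finset.not_nonempty_iff_eq_empty] at hU
      have key' : ∀ c k, Parse K E L (n + 1) c k →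
          c = c₀ + 1 ∧ K^[k] E ⊆ K V ∪ if (U ∩ L).Nonempty then E else ∅ := by
        intro c k hp
        obtain ⟨hne, ⟨-, hs⟩ | hs⟩ := key c k hp
        · rw [hU, Finset.subset_empty] at hs
          simp [hs] at hne
        · exact hs
      exact ⟨_, _, c₀ + 1, h.step_norm hR hU
        ((key _ _ hp₁).1.mono (key' _ _ hp₁).2), fun c k hp => Or.inl (key' c k hp)⟩

omit h in
theorem parse_keep {n c k : ℕ} (hp : Parse K E L n c 0)
    (hk : ∀ i ≤ k, (K^[i] E).Nonempty) : Parse K E L (n + k) c k := by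
  induction k with
  | zero => exact hp
  | succ k ih => exact (ih fun i hi => hk i (hi.trans k.le_succ)).keep (hk _ le_rfl)

/-- Repeating the cycle of `j` keeping steps and one increment. -/
theorem parse_mul {j : ℕ} (hj : (K^[j] E ∩ L).Nonempty) (i : ℕ) :
    Parse K E L ((j + 1) * i) i 0 := by
  induction i with
  | zero => exact .start
  | succ i ih =>
    refine (parse_keep (k := j) ih fun l hl => ?_).inc hj
    exact h.iterate_nonempty_of_le hl (hj.mono Finset.inter_subset_left)

/-- Two different hit times would give cycles of different lengths, and over a long enough word the
increment counts of the two periodic runs would differ by at least two. -/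
theorem hit_unique {i j : ℕ} (hi : (K^[i] E ∩ L).Nonempty) (hj : (K^[j] E ∩ L).Nonempty) :
    i = j := by
  -- Both runs have length `2 * (i + 1) * (j + 1)`, with `2 * (j + 1)` and `2 * (i + 1)` increments;
  -- the factor `2` turns a difference of one into a forbidden difference.
  have h1 := h.parse_mul hi ((j + 1) * 2)
  have h2 := h.parse_mul hj ((i + 1) * 2)
  rw [← mul_assoc] at h1 h2
  rw [mul_comm (j + 1) (i + 1)] at h2
  obtain ⟨U, V, c₀, -, hall⟩ := h.exists_pair _ ⟨_, _, h1⟩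
  rcases hall _ _ h1 with ⟨h3, -⟩ | ⟨h3, -⟩ <;> rcases hall _ _ h2 with ⟨h4, -⟩ | ⟨h4, -⟩ <;> omega

/-- Over `2 * j + 1` letters one run could avoid increments, another could increment at step `j + 1`
and then be `j` steps old. The latter belongs to the marked component, but it meets `L`. -/
theorem iterate_eq_empty {j : ℕ} (hj : (K^[j] E ∩ L).Nonempty) {k : ℕ} (hk : 2 * j + 1 ≤ k) :
    K^[k] E = ∅ := by
  by_contra hne
  have hall' := fun i (hi : i ≤ 2 * j + 1) =>
    h.iterate_nonempty_of_le (hi.trans hk) (Finset.nonempty_iff_ne_empty.2 hne)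
  have h1 : Parse K E L (0 + (2 * j + 1)) 0 (2 * j + 1) := parse_keep .start hall'
  have h2 : Parse K E L ((j + 1) * 1 + j) 1 j :=
    parse_keep (h.parse_mul hj 1) fun i hi => hall' i (by omega)
  rw [show (j + 1) * 1 + j = 0 + (2 * j + 1) by ring] at h2
  obtain ⟨U, V, c₀, hR, hall⟩ := h.exists_pair _ ⟨_, _, h1⟩
  obtain ⟨q, hq⟩ := hj
  rw [Finset.mem_inter] at hq
  rcases hall _ _ h1 with ⟨h3, h3'⟩ | ⟨h3, -⟩
  · rcases hall _ _ h2 with ⟨h4, -⟩ | ⟨-, h4⟩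
    · omega
    · exact Finset.disjoint_left.1 (h.disjoint hR) (h4 hq.1) hq.2
  · omega

/-- Before time `j` the union of the iterates grows strictly. If it stopped growing it would be
closed under `K`, and the state of `L` met at time `j` would have been met earlier, against
uniqueness. -/
theorem hit_lt_card {T : Finset Q} (hT : ∀ k, K^[k] E ⊆ T) {j : ℕ}
    (hj : (K^[j] E ∩ L).Nonempty) : j < T.card := by
  have hunion : ∀ k i, i ≤ k → K^[i] E ⊆ (Finset.range (k + 1)).biUnion fun i => K^[i] E :=
    fun k i hi => Finset.subset_biUnion_of_mem (fun i => K^[i] E) (Finset.mem_range_succ_iff.2 hi)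
  have hmono : ∀ s : Finset ℕ, K (s.biUnion fun i => K^[i] E) = s.biUnion fun i => K^[i + 1] E := by
    intro s
    induction s using Finset.induction_on with
    | empty => exact h.map_empty
    | insert i s _ ih =>
      rw [Finset.biUnion_insert, Finset.biUnion_insert, h.map_union, ih,
        Function.iterate_succ_apply']
  have hlt : ∀ k ≤ j, k < ((Finset.range (k + 1)).biUnion fun i => K^[i] E).card := by
    intro k
    induction k with
    | zero => exact fun _ => by simpa using h.start_nonempty
    | succ k ih =>
      intro hk
      refine lt_of_le_of_lt (ih (by omega)) (Finset.card_lt_card ?_)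
      rw [Finset.ssubset_iff_subset_ne]
      refine ⟨Finset.biUnion_subset_biUnion_of_subset_left _
        (Finset.range_subset_range.2 (by omega)), fun he => ?_⟩
      have hclosed : ∀ l, K^[l] E ⊆ (Finset.range (k + 1)).biUnion fun i => K^[i] E := by
        intro l
        induction l with
        | zero => exact hunion k 0 (Nat.zero_le k)
        | succ l ihl =>
          rw [Function.iterate_succ_apply']
          refine (h.mono ihl).trans ?_
          rw [hmono]
          refine Finset.biUnion_subset.2 fun i hi => ?_
          rw [he]
          exact hunion (k + 1) (i + 1) (by simpa using hi)
      obtain ⟨q, hq⟩ := hj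
      rw [Finset.mem_inter] at hq
      obtain ⟨i, hi, hqi⟩ := Finset.mem_biUnion.1 (hclosed j hq.1)
      have := h.hit_unique (i := i) (j := j) ⟨q, Finset.mem_inter.2 ⟨hqi, hq.2⟩⟩
        ⟨q, Finset.mem_inter.2 hq⟩
      rw [Finset.mem_range] at hi
      omega
  exact lt_of_lt_of_le (hlt j le_rfl)
    (Finset.card_le_card (Finset.biUnion_subset.2 fun i _ => hT i))

end PairSystem

end Unary

/-! ### Indices of active registers -/

section Indices

variable {α X Q : Type} [DecidableEq α] [DecidableEq X] [DecidableEq Q]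
  [Fintype X] [Fintype Q] {A : CA α X Q} (F : FlatCA A)

namespace FlatCA

/-- The states reached from `U` by transitions that read `a` and keep the counter. -/
def keepAll (_F : FlatCA A) (x : X) (a : α) (U : Finset Q) : Finset Q :=
  keepSet (A.trans.filter fun d => d.letter = a) x U

/-- The states with letter `a` where the counter is set to `1`. -/
def fstLab (x : X) (a : α) : Finset Q := (F.fst x).filter fun q => F.lab q = some a

/-- The states with letter `a` in the scope of the counter. -/
def memLab (x : X) (a : α) : Finset Q := (F.mem x).filter fun q => F.lab q = some a

/-- The states reached from `fstLab x a` after reading `aᵏ` and keeping the counter. -/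
def follow (x : X) (a : α) (k : ℕ) : Finset Q := (F.keepAll x a)^[k] (F.fstLab x a)

theorem mem_keepAll {x : X} {a : α} {U : Finset Q} {r : Q} :
    r ∈ F.keepAll x a U ↔
      ∃ d ∈ A.trans, d.letter = a ∧ d.update x = .var x ∧ d.src ∈ U ∧ d.tgt = r := by
  simp only [keepAll, mem_keepSet, Finset.mem_filter, and_assoc]

theorem keepAll_empty (x : X) (a : α) : F.keepAll x a ∅ = ∅ := by
  ext r
  simp [mem_keepAll]

theorem keepAll_union (x : X) (a : α) (U V : Finset Q) :
    F.keepAll x a (U ∪ V) = F.keepAll x a U ∪ F.keepAll x a V := by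
  ext r
  simp only [mem_keepAll, Finset.mem_union]
  constructor
  · rintro ⟨d, h1, h2, h3, h4 | h4, h5⟩
    · exact Or.inl ⟨d, h1, h2, h3, h4, h5⟩
    · exact Or.inr ⟨d, h1, h2, h3, h4, h5⟩
  · rintro (⟨d, h1, h2, h3, h4, h5⟩ | ⟨d, h1, h2, h3, h4, h5⟩)
    · exact ⟨d, h1, h2, h3, Or.inl h4, h5⟩
    · exact ⟨d, h1, h2, h3, Or.inr h4, h5⟩

theorem update_eq_var {d : Trans α Q (Guard X) (X → CTerm X)} (hd : d ∈ A.trans) {x : X}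
    (hu : d.update x = .var x) : d.guard = .tt ∧ d.src ∈ F.mem x ∧ d.tgt ∈ F.mem x := by
  rcases F.update_cases hd x with h | h | h | h
  · simp [h.1] at hu
  · simp [h.1] at hu
  · exact h.2
  · simp [h.1] at hu

theorem update_eq_succ {d : Trans α Q (Guard X) (X → CTerm X)} (hd : d ∈ A.trans) {x : X}
    (hu : d.update x = .succ (.var x)) :
    d.guard = ltGuard F.hi x ∧ d.src ∈ F.lst x ∧ d.tgt ∈ F.fst x := by
  rcases F.update_cases hd x with h | h | h | h
  · simp [h.1] at hu
  · simp [h.1] at hu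
  · simp [h.1] at hu
  · exact h.2

theorem keepAll_subset (x : X) (a : α) (U : Finset Q) : F.keepAll x a U ⊆ F.memLab x a := by
  intro r hr
  obtain ⟨d, hd, rfl, hu, -, rfl⟩ := F.mem_keepAll.1 hr
  exact Finset.mem_filter.2 ⟨(F.update_eq_var hd hu).2.2, F.lab_tgt d hd⟩

theorem fstLab_subset (x : X) (a : α) : F.fstLab x a ⊆ F.memLab x a :=
  Finset.filter_subset_filter _ (F.fst_subset x)

theorem follow_subset (x : X) (a : α) (k : ℕ) : F.follow x a k ⊆ F.memLab x a := by
  cases k with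
  | zero => exact F.fstLab_subset x a
  | succ k =>
    rw [follow, Function.iterate_succ_apply']
    exact F.keepAll_subset x a _

theorem follow_succ (x : X) (a : α) (k : ℕ) :
    F.follow x a (k + 1) = F.keepAll x a (F.follow x a k) :=
  Function.iterate_succ_apply' _ _ _

/-- Keeping requires no test, so it does not depend on the minterm. -/
theorem keepSet_moves {P : Finset Q} {a : α} {Γ : Finset (Guard (X × Q))}
    (h2 : Satisfiable (minterm (subsetGuards A P a) Γ)) (x : X) {U : Finset Q} (hU : U ⊆ P) :
    keepSet (moves A P a Γ) x U = F.keepAll x a U := by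
  ext r
  rw [mem_keepSet, mem_keepAll]
  constructor
  · rintro ⟨d, hd, hu, hs, rfl⟩
    exact ⟨d, (mem_moves.1 hd).1, (mem_moves.1 hd).2.2.1, hu, hs, rfl⟩
  · rintro ⟨d, hd, ha, hu, hs, rfl⟩
    exact ⟨d, tt_mem h2 hd (hU hs) ha (F.update_eq_var hd hu).1, hu, hs, rfl⟩

theorem incSet_moves_subset {P : Finset Q} {a : α} {Γ : Finset (Guard (X × Q))} (x : X)
    (U : Finset Q) : incSet (moves A P a Γ) x U ⊆ F.fstLab x a := by
  intro r hr
  obtain ⟨d, hd, hu, hs, rfl⟩ := mem_incSet.1 hr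
  obtain ⟨hd', -, rfl, -⟩ := mem_moves.1 hd
  exact Finset.mem_filter.2 ⟨(F.update_eq_succ hd' hu).2.2, F.lab_tgt d hd'⟩

/-- Increments from one source share a guard and lead to every entry state, so for a given letter
either all of them are taken or none. -/
theorem incSet_moves {P : Finset Q} {a : α} {Γ : Finset (Guard (X × Q))} (x : X) (U : Finset Q) :
    incSet (moves A P a Γ) x U = ∅ ∨
      (incSet (moves A P a Γ) x U = F.fstLab x a ∧ (U ∩ F.lst x).Nonempty) := by
  rcases Finset.eq_empty_or_nonempty (incSet (moves A P a Γ) x U) with h | ⟨r, hr⟩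
  · exact Or.inl h
  obtain ⟨d, hd, hu, hs, rfl⟩ := mem_incSet.1 hr
  replace ⟨hd, hP, ha, hg⟩ := mem_moves.1 hd
  subst ha
  obtain ⟨h1, h2, h3⟩ := F.update_eq_succ hd hu
  refine Or.inr ⟨?_, d.src, Finset.mem_inter.2 ⟨hs, h2⟩⟩
  refine (F.incSet_moves_subset x U).antisymm fun q hq => ?_
  obtain ⟨hq1, hq2⟩ := Finset.mem_filter.1 hq
  obtain ⟨d', hd', e1, e2, e3, e4⟩ := F.exists_inc x _ h2 q hq1
  have hl := F.lab_tgt d' hd'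
  rw [e2, hq2] at hl
  refine mem_incSet.2 ⟨d', mem_moves.2 ⟨hd', e1 ▸ hP, (Option.some.inj hl).symm, ?_⟩, e4,
    e1 ▸ hs, e2⟩
  rw [e1, e3, ← h1]
  exact hg

theorem incSet_moves_full {P : Finset Q} {a : α} (x : X) {U : Finset Q} (hU : U ⊆ P) :
    incSet (moves A P a (subsetGuards A P a)) x U =
      if (U ∩ F.lst x).Nonempty then F.fstLab x a else ∅ := by
  split_ifs with h
  · refine (F.incSet_moves_subset x U).antisymm fun q hq => ?_
    obtain ⟨p, hp⟩ := h
    obtain ⟨hp1, hp2⟩ := Finset.mem_inter.1 hp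
    obtain ⟨hq1, hq2⟩ := Finset.mem_filter.1 hq
    obtain ⟨d, hd, e1, e2, e3, e4⟩ := F.exists_inc x p hp2 q hq1
    have hl := F.lab_tgt d hd
    rw [e2, hq2] at hl
    have ha := (Option.some.inj hl).symm
    exact mem_incSet.2 ⟨d, mem_moves.2 ⟨hd, e1 ▸ hU hp1, ha,
      mem_subsetGuards.2 ⟨d, hd, e1 ▸ hU hp1, ha, rfl⟩⟩, e4, e1 ▸ hp1, e2⟩
  · rcases F.incSet_moves (P := P) (a := a) (Γ := subsetGuards A P a) x U with h' | h'
    · exact h'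
    · exact absurd h'.2 h

/-- Entries into a scope come in bundles with the same source and guard, one for each entry state.
Hence a fresh `1` always has the index `fstLab x a`. -/
theorem oneSet_moves {P : Finset Q} {a : α} {Γ : Finset (Guard (X × Q))} (x : X) :
    oneSet (moves A P a Γ) x = ∅ ∨ oneSet (moves A P a Γ) x = F.fstLab x a := by
  rcases Finset.eq_empty_or_nonempty (oneSet (moves A P a Γ) x) with h | ⟨r, hr⟩
  · exact Or.inl h
  have hsub : ∀ d ∈ A.trans, d.update x = .one → d.tgt ∈ F.fst x := by
    intro d hd hu
    rcases F.update_cases hd x with h | h | h | h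
    · simp [h.1] at hu
    · exact h.2
    · simp [h.1] at hu
    · simp [h.1] at hu
  obtain ⟨d, hd, hu, rfl⟩ := mem_oneSet.1 hr
  replace ⟨hd, hP, ha, hg⟩ := mem_moves.1 hd
  subst ha
  refine Or.inr (Finset.Subset.antisymm (fun q hq => ?_) fun q hq => ?_)
  · obtain ⟨d', hd', hu', rfl⟩ := mem_oneSet.1 hq
    obtain ⟨hd', -, ha, -⟩ := mem_moves.1 hd'
    exact Finset.mem_filter.2 ⟨hsub d' hd' hu', ha ▸ F.lab_tgt d' hd'⟩
  · obtain ⟨hq1, hq2⟩ := Finset.mem_filter.1 hq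
    rcases F.update_mem d hd x (F.fst_subset x (hsub d hd hu)) with h | h | h
    · obtain ⟨d', hd', e1, e2, e3, e4⟩ := h.2.2 q hq1
      have hl := F.lab_tgt d' hd'
      rw [e2, hq2] at hl
      refine mem_oneSet.2 ⟨d', mem_moves.2 ⟨hd', e1 ▸ hP, (Option.some.inj hl).symm, ?_⟩, e4, e2⟩
      rw [e1, e3]
      exact hg
    · simp [h.1] at hu
    · simp [h.1] at hu

theorem plain_subset (hA : ¬ Aborts A F.hi F.q₀) {P : Finset Q} {Act : Finset (Shared X Q)}
    (h : AugReach A F.hi F.q₀ (P, Act)) {x : X} {S : Finset (MState Q)} (hS : (x, S) ∈ Act) :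
    plain S ⊆ P := fun _ hq => ((F.reach_inv hA h).1 x S hS).2.1 _ (mem_plain.1 hq)

theorem marked_subset (hA : ¬ Aborts A F.hi F.q₀) {P : Finset Q} {Act : Finset (Shared X Q)}
    (h : AugReach A F.hi F.q₀ (P, Act)) {x : X} {S : Finset (MState Q)} (hS : (x, S) ∈ Act) :
    marked S ⊆ P := fun _ hq => ((F.reach_inv hA h).1 x S hS).2.1 _ (mem_marked.1 hq)

theorem nextSet_eq (hA : ¬ Aborts A F.hi F.q₀) {P : Finset Q} {Act : Finset (Shared X Q)}
    (h : AugReach A F.hi F.q₀ (P, Act)) {x : X} {S : Finset (MState Q)} (hS : (x, S) ∈ Act)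
    {a : α} {Γ : Finset (Guard (X × Q))}
    (h2 : Satisfiable (minterm (subsetGuards A P a) Γ)) :
    nextSet (moves A P a Γ) x S = normPair (F.keepAll x a (plain S))
      (F.keepAll x a (marked S) ∪ incSet (moves A P a Γ) x (plain S)) := by
  rw [nextSet, F.keepSet_moves h2 x (F.plain_subset hA h hS),
    F.keepSet_moves h2 x (F.marked_subset hA h hS), Finset.union_comm]

/-- The register `x_S` is active in some state. -/
def Occurs (x : X) (S : Finset (MState Q)) : Prop :=
  ∃ P Act, AugReach A F.hi F.q₀ (P, Act) ∧ (x, S) ∈ Act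

theorem occurs_next (hA : ¬ Aborts A F.hi F.q₀) {P : Finset Q} {Act : Finset (Shared X Q)}
    (h : AugReach A F.hi F.q₀ (P, Act)) {x : X} {S : Finset (MState Q)} (hS : (x, S) ∈ Act)
    {a : α} {Γ : Finset (Guard (X × Q))} (h1 : Γ ⊆ subsetGuards A P a)
    (h2 : Satisfiable (minterm (subsetGuards A P a) Γ))
    (hne : (nextSet (moves A P a Γ) x S).Nonempty) :
    (x, nextSet (moves A P a Γ) x S) ∈ (augTrans F.hi Act (subsetOf A P a Γ)).tgt.2 :=
  mem_augTrans_active.2 ⟨_, (F.mem_augTrans_update (not_doubleInc hA h h1 h2)).2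
    ⟨hne, Or.inr (Or.inr ⟨S, hS, rfl, rfl⟩)⟩⟩

/-- Since `Occurs` ranges over all generated states, the steps may be taken with the minterm in
which all guards are positive; there an increment happens exactly when the unmarked part meets `lst
x`. -/
theorem pairSystem (hA : ¬ Aborts A F.hi F.q₀) {x : X} {a : α} (hne : (F.fstLab x a).Nonempty)
    (hst : F.Occurs x (ofPair (F.fstLab x a) ∅)) :
    PairSystem (F.keepAll x a) (F.fstLab x a) (F.lst x) fun U V => F.Occurs x (ofPair U V) where
  map_empty := F.keepAll_empty x a
  map_union := F.keepAll_union x a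
  start_nonempty := hne
  disjoint := by
    rintro U V ⟨P, Act, h, hS⟩
    exact Finset.disjoint_left.2 fun q hq => F.marked_not_mem_lst hA h hS (mem_ofPair_true.2 hq)
  start := hst
  step := by
    rintro U V ⟨P, Act, h, hS⟩ hU
    have hs := F.satisfiable_full P a
    have e := F.nextSet_eq hA h hS hs
    have hp := F.plain_subset hA h hS
    rw [plain_ofPair] at hp
    rw [plain_ofPair, marked_ofPair, F.incSet_moves_full x hp, normPair, if_neg hU.ne_empty] at e
    refine ⟨_, _, reach_next h subset_rfl hs, ?_⟩
    rw [← e]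
    refine F.occurs_next hA h hS subset_rfl hs ?_
    rw [e, ofPair_nonempty]
    exact Or.inl hU
  step_norm := by
    rintro U V ⟨P, Act, h, hS⟩ hU hV
    have hs := F.satisfiable_full P a
    have e := F.nextSet_eq hA h hS hs
    have hp := F.plain_subset hA h hS
    rw [plain_ofPair] at hp
    rw [plain_ofPair, marked_ofPair, F.incSet_moves_full x hp, normPair, if_pos hU] at e
    refine ⟨_, _, reach_next h subset_rfl hs, ?_⟩
    rw [← e]
    refine F.occurs_next hA h hS subset_rfl hs ?_
    rw [e, ofPair_nonempty]
    exact Or.inl hV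

/-- No state is both unmarked and marked in the index of an active register. -/
theorem disjoint_plain_marked (hA : ¬ Aborts A F.hi F.q₀) {P : Finset Q}
    {Act : Finset (Shared X Q)} (h : AugReach A F.hi F.q₀ (P, Act)) {x : X}
    {S : Finset (MState Q)} (hS : (x, S) ∈ Act) {q : Q} (h0 : (q, false) ∈ S)
    (h1 : (q, true) ∈ S) : False := by
  have hq : q ∈ F.mem x := by
    rcases ((F.reach_inv hA h).1 x S hS).2.2 with hm | rfl
    · exact hm _ h0
    · simp at h1
  obtain ⟨p, hp, hpath⟩ := F.live x q hq
  induction hpath using Relation.ReflTransGen.head_induction_on generalizing P Act S with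
  | refl => exact F.marked_not_mem_lst hA h hS h1 hp
  | @head q r hqr _ ih =>
    obtain ⟨d, hd, rfl, rfl, hu⟩ := hqr
    have hs := F.satisfiable_full P d.letter
    have e := F.nextSet_eq hA h hS hs
    have k0 : d.tgt ∈ F.keepAll x d.letter (plain S) :=
      F.mem_keepAll.2 ⟨d, hd, rfl, hu, mem_plain.2 h0, rfl⟩
    have k1 : d.tgt ∈ F.keepAll x d.letter (marked S) :=
      F.mem_keepAll.2 ⟨d, hd, rfl, hu, mem_marked.2 h1, rfl⟩
    rw [normPair, if_neg (Finset.ne_empty_of_mem k0)] at e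
    have m0 : (d.tgt, false) ∈ nextSet (moves A P d.letter (subsetGuards A P d.letter)) x S := by
      rw [e]
      exact mem_ofPair_false.2 k0
    -- Both copies follow the same keeping path. The unmarked part stays nonempty, so marks are not
    -- removed, and at the end of the path a marked exit state contradicts `marked_not_mem_lst`.
    refine ih (reach_next h subset_rfl hs) (F.occurs_next hA h hS subset_rfl hs ⟨_, m0⟩) m0 ?_
      (F.update_eq_var hd hu).2.2
    rw [e]
    exact mem_ofPair_true.2 (Finset.mem_union_left _ k1)

/-! ### Indices that arise while one letter is repeated -/

open Classical in
/-- The indices that descend from `fstLab x a` along repetitions of `a`. -/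
noncomputable def descendants (x : X) (a : α) : Finset (Finset (MState Q)) :=
  Finset.univ.filter fun S =>
    (F.fstLab x a).Nonempty ∧ F.Occurs x (ofPair (F.fstLab x a) ∅) ∧ S.Nonempty ∧
    ((∃ k, S = ofPair (F.follow x a k) ∅) ∨
      ∃ j k, (F.follow x a j ∩ F.lst x).Nonempty ∧ (F.follow x a (k + j + 1)).Nonempty ∧
        S = ofPair (F.follow x a (k + j + 1)) (F.follow x a k))

theorem mem_descendants {x : X} {a : α} {S : Finset (MState Q)} : S ∈ F.descendants x a ↔
    (F.fstLab x a).Nonempty ∧ F.Occurs x (ofPair (F.fstLab x a) ∅) ∧ S.Nonempty ∧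
    ((∃ k, S = ofPair (F.follow x a k) ∅) ∨
      ∃ j k, (F.follow x a j ∩ F.lst x).Nonempty ∧ (F.follow x a (k + j + 1)).Nonempty ∧
        S = ofPair (F.follow x a (k + j + 1)) (F.follow x a k)) := by
  simp [descendants]

theorem normPair_empty (U : Finset Q) : normPair U ∅ = ofPair U ∅ := by
  unfold normPair
  split_ifs with h
  · rw [h]
  · rfl

/-- In the second shape the unmarked part has been followed for `k + j + 1` steps, and the marked
part for `k` steps since the increment at time `j`. Another increment would need a second hit time
and is excluded; the first increment produces this shape with `k = 0`, or restarts at `fstLab x a`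
when nothing else survives. -/
theorem next_mem_descendants (hA : ¬ Aborts A F.hi F.q₀) {P : Finset Q}
    {Act : Finset (Shared X Q)} (h : AugReach A F.hi F.q₀ (P, Act)) {x : X}
    {S : Finset (MState Q)} (hS : (x, S) ∈ Act) {a : α} {Γ : Finset (Guard (X × Q))}
    (h2 : Satisfiable (minterm (subsetGuards A P a) Γ))
    (hne : (nextSet (moves A P a Γ) x S).Nonempty) (hD : S ∈ F.descendants x a) :
    nextSet (moves A P a Γ) x S ∈ F.descendants x a := by
  obtain ⟨hE, hO, -, hcase⟩ := F.mem_descendants.1 hD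
  have hps := F.pairSystem hA hE hO
  refine F.mem_descendants.2 ⟨hE, hO, hne, ?_⟩
  rw [F.nextSet_eq hA h hS h2]
  rcases hcase with ⟨k, rfl⟩ | ⟨j, k, hj, hk, rfl⟩
  · rw [plain_ofPair, marked_ofPair, F.keepAll_empty, Finset.empty_union, ← follow_succ]
    rcases F.incSet_moves (P := P) (a := a) (Γ := Γ) x (F.follow x a k) with hi | ⟨hi, hl⟩
    · rw [hi, normPair_empty]
      exact Or.inl ⟨_, rfl⟩
    · rw [hi, normPair]
      split_ifs with h0
      · exact Or.inl ⟨0, rfl⟩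
      · refine Or.inr ⟨k, 0, hl, ?_, ?_⟩
        · rw [zero_add]
          exact Finset.nonempty_iff_ne_empty.2 h0
        · rw [zero_add]
          rfl
  · rw [plain_ofPair, marked_ofPair, ← follow_succ, ← follow_succ]
    rcases F.incSet_moves (P := P) (a := a) (Γ := Γ) x (F.follow x a (k + j + 1)) with hi | ⟨-, hl⟩
    · rw [hi, Finset.union_empty, normPair]
      split_ifs with h0
      · exact Or.inl ⟨_, rfl⟩
      · refine Or.inr ⟨j, k + 1, hj, ?_, ?_⟩
        · rw [show k + 1 + j + 1 = k + j + 1 + 1 by ring]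
          exact Finset.nonempty_iff_ne_empty.2 h0
        · rw [show k + 1 + j + 1 = k + j + 1 + 1 by ring]
    · have := hps.hit_unique hl hj
      omega

/-- An index with marks is already past the unique hit time, so only `ofPair (F.follow x a k) ∅` for
that time `k` can meet `lst x` in its unmarked part. -/
theorem descendants_eq_of_hit (hA : ¬ Aborts A F.hi F.q₀) {x : X} {a : α}
    {S S' : Finset (MState Q)} (hS : S ∈ F.descendants x a) (hS' : S' ∈ F.descendants x a)
    (h : (plain S ∩ F.lst x).Nonempty) (h' : (plain S' ∩ F.lst x).Nonempty) : S = S' := by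
  obtain ⟨hE, hO, -, hcase⟩ := F.mem_descendants.1 hS
  have hps := F.pairSystem hA hE hO
  have key : ∀ S ∈ F.descendants x a, (plain S ∩ F.lst x).Nonempty →
      ∃ k, S = ofPair (F.follow x a k) ∅ ∧ (F.follow x a k ∩ F.lst x).Nonempty := by
    intro S hS h
    rcases (F.mem_descendants.1 hS).2.2.2 with ⟨k, rfl⟩ | ⟨j, k, hj, -, rfl⟩
    · rw [plain_ofPair] at h
      exact ⟨k, rfl, h⟩
    · rw [plain_ofPair] at h
      have := hps.hit_unique h hj
      omega
  obtain ⟨k, rfl, hk⟩ := key S hS h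
  obtain ⟨k', rfl, hk'⟩ := key S' hS' h'
  rw [hps.hit_unique hk hk']

/-- If there is a hit time `j`, all runs die by time `2 * j + 1`, so there are at most `2 * (2 * j +
1)` indices, and `j` is less than the number of available states. Without a hit there are no marks,
and the index is a subset of the states that are not exits. -/
theorem card_descendants (hA : ¬ Aborts A F.hi F.q₀) (x : X) (a : α) :
    (F.descendants x a).card ≤ 4 * (F.memLab x a).card + 2 ^ (F.memLab x a \ F.lst x).card := by
  by_cases hst : (F.fstLab x a).Nonempty ∧ F.Occurs x (ofPair (F.fstLab x a) ∅)
  swap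
  · have : F.descendants x a = ∅ := by
      rw [Finset.eq_empty_iff_forall_notMem]
      intro S hS
      have := F.mem_descendants.1 hS
      exact hst ⟨this.1, this.2.1⟩
    simp [this]
  have hps := F.pairSystem hA hst.1 hst.2
  by_cases hhit : ∃ j, (F.follow x a j ∩ F.lst x).Nonempty
  · obtain ⟨j, hj⟩ := hhit
    have hjc : j < (F.memLab x a).card := hps.hit_lt_card (F.follow_subset x a) hj
    have hemp : ∀ k, (F.follow x a k).Nonempty → k < 2 * j + 1 := by
      intro k hk
      by_contra hlt
      exact hk.ne_empty (hps.iterate_eq_empty hj (not_lt.1 hlt))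
    have hsub : F.descendants x a ⊆
        ((Finset.range (2 * j + 1)).image fun k => ofPair (F.follow x a k) ∅) ∪
        (Finset.range (2 * j + 1)).image
          fun k => ofPair (F.follow x a (k + j + 1)) (F.follow x a k) := by
      intro S hS
      obtain ⟨-, -, hne, ⟨k, rfl⟩ | ⟨j', k, hj', hk, rfl⟩⟩ := F.mem_descendants.1 hS
      · rw [ofPair_nonempty] at hne
        refine Finset.mem_union_left _ (Finset.mem_image_of_mem _ (Finset.mem_range.2 (hemp k ?_)))
        simpa using hne
      · obtain rfl := hps.hit_unique hj hj'
        have := hemp _ hk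
        exact Finset.mem_union_right _ (Finset.mem_image.2
          ⟨k, Finset.mem_range.2 (by omega), rfl⟩)
    have h1 := Finset.card_le_card hsub
    have h2 := Finset.card_union_le
      ((Finset.range (2 * j + 1)).image fun k => ofPair (F.follow x a k) ∅)
      ((Finset.range (2 * j + 1)).image
          fun k => ofPair (F.follow x a (k + j + 1)) (F.follow x a k))
    have h3 := (Finset.range (2 * j + 1)).card_image_le (f := fun k => ofPair (F.follow x a k) ∅)
    have h4 := (Finset.range (2 * j + 1)).card_image_le
      (f := fun k => ofPair (F.follow x a (k + j + 1)) (F.follow x a k))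
    rw [Finset.card_range] at h3 h4
    exact le_add_right (by omega)
  · have hsub : F.descendants x a ⊆
        (F.memLab x a \ F.lst x).powerset.image fun U => ofPair U ∅ := by
      intro S hS
      obtain ⟨-, -, -, ⟨k, rfl⟩ | ⟨j, -, hj, -⟩⟩ := F.mem_descendants.1 hS
      · refine Finset.mem_image_of_mem _ (Finset.mem_powerset.2 fun q hq => ?_)
        exact Finset.mem_sdiff.2 ⟨F.follow_subset x a k hq,
          fun hl => hhit ⟨k, q, Finset.mem_inter.2 ⟨hq, hl⟩⟩⟩
      · exact absurd ⟨j, hj⟩ hhit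
    have h1 := (Finset.card_le_card hsub).trans Finset.card_image_le
    rw [Finset.card_powerset] at h1
    omega

/-! ### Counting the indices in a generated state. -/

/-- The indices of the active registers in the scope of the counter. -/
def inner (Act : Finset (Shared X Q)) (x : X) : Finset (Finset (MState Q)) :=
  Finset.univ.filter fun S => (x, S) ∈ Act ∧ ∀ m ∈ S, m.1 ∈ F.mem x

theorem mem_inner {Act : Finset (Shared X Q)} {x : X} {S : Finset (MState Q)} :
    S ∈ F.inner Act x ↔ (x, S) ∈ Act ∧ ∀ m ∈ S, m.1 ∈ F.mem x := by
  simp [inner]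

/-- The states with letter `a`. -/
def labelled (a : α) : Finset Q := Finset.univ.filter fun q => F.lab q = some a

theorem card_labelled_lt (a : α) : (F.labelled a).card + 1 ≤ Fintype.card Q := by
  have : F.labelled a ⊆ Finset.univ.erase F.q₀ := by
    intro q hq
    refine Finset.mem_erase.2 ⟨?_, Finset.mem_univ _⟩
    rintro rfl
    have := (Finset.mem_filter.1 hq).2
    simp [F.lab_q₀] at this
  have h := Finset.card_le_card this
  rw [Finset.card_erase_of_mem (Finset.mem_univ _), Finset.card_univ] at h
  have : 0 < Fintype.card Q := Fintype.card_pos_iff.2 ⟨F.q₀⟩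
  omega

theorem card_labelled_add_lt {a b : α} (hab : a ≠ b) :
    (F.labelled a).card + (F.labelled b).card + 1 ≤ Fintype.card Q := by
  have hd : Disjoint (F.labelled a) (F.labelled b) := by
    rw [Finset.disjoint_left]
    intro q h1 h2
    have e1 := (Finset.mem_filter.1 h1).2
    have e2 := (Finset.mem_filter.1 h2).2
    rw [e1] at e2
    exact hab (Option.some.inj e2)
  have : F.labelled a ∪ F.labelled b ⊆ Finset.univ.erase F.q₀ := by
    intro q hq
    refine Finset.mem_erase.2 ⟨?_, Finset.mem_univ _⟩
    rintro rfl
    rcases Finset.mem_union.1 hq with hq | hq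
    all_goals
      have := (Finset.mem_filter.1 hq).2
      simp [F.lab_q₀] at this
  have h := Finset.card_le_card this
  rw [Finset.card_union_of_disjoint hd, Finset.card_erase_of_mem (Finset.mem_univ _),
    Finset.card_univ] at h
  have : 0 < Fintype.card Q := Fintype.card_pos_iff.2 ⟨F.q₀⟩
  omega

theorem card_inner_le (hA : ¬ Aborts A F.hi F.q₀) {P : Finset Q}
    {Act : Finset (Shared X Q)} (h : AugReach A F.hi F.q₀ (P, Act)) {a : α}
    (hP : ∀ q ∈ P, F.lab q = some a) (x : X) :
    (F.inner Act x).card ≤ 3 ^ (F.labelled a).card := by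
  classical
  -- A state is unmarked, marked or absent in an index. As it is never both of the former, these
  -- three values recover the index.
  let f : Finset (MState Q) → ({q // q ∈ F.labelled a} → Fin 3) := fun S q =>
    if (q.1, false) ∈ S then 0 else if (q.1, true) ∈ S then 1 else 2
  have hinj : Set.InjOn f (F.inner Act x : Set (Finset (MState Q))) := by
    intro S hS S' hS' he
    have hS := (F.mem_inner.1 (Finset.mem_coe.1 hS)).1
    have hS' := (F.mem_inner.1 (Finset.mem_coe.1 hS')).1
    have hlab : ∀ S, (x, S) ∈ Act → ∀ m ∈ S, m.1 ∈ F.labelled a := fun S hS m hm =>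
      Finset.mem_filter.2 ⟨Finset.mem_univ _, hP _ (((F.reach_inv hA h).1 x S hS).2.1 m hm)⟩
    have hdis : ∀ S, (x, S) ∈ Act → ∀ q, (q, false) ∈ S → (q, true) ∉ S := fun S hS q h0 h1 =>
      F.disjoint_plain_marked hA h hS h0 h1
    have key : ∀ S S', (x, S) ∈ Act → (x, S') ∈ Act → f S = f S' → S ⊆ S' := by
      intro S S' hS hS' he m hm
      have hfm := congrFun he ⟨m.1, hlab S hS m hm⟩
      obtain ⟨q, b⟩ := m
      simp only [f] at hfm
      cases b
      · rw [if_pos hm] at hfm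
        split_ifs at hfm with h1 h2
        · exact h1
        all_goals exact absurd hfm (by decide)
      · rw [if_neg (fun h0 => hdis S hS q h0 hm), if_pos hm] at hfm
        split_ifs at hfm with h1 h2
        · exact absurd hfm (by decide)
        · exact h2
        · exact absurd hfm (by decide)
    exact (key S S' hS hS' he).antisymm (key S' S hS' hS he.symm)
  have := Finset.card_le_card_of_injOn f (fun _ _ => Finset.mem_coe.2 (Finset.mem_univ _)) hinj
  simpa using this

/-- A new index in the scope stems from a fresh `1`, which is a descendant, or from an old index in
the scope, whose successor stays a descendant if it was one. The register outside the scope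
contributes nothing, since keeping and incrementing need a source inside. -/
theorem inner_next (hA : ¬ Aborts A F.hi F.q₀) {P : Finset Q}
    {Act : Finset (Shared X Q)} (h : AugReach A F.hi F.q₀ (P, Act)) {a : α}
    {Γ : Finset (Guard (X × Q))} (h1 : Γ ⊆ subsetGuards A P a)
    (h2 : Satisfiable (minterm (subsetGuards A P a) Γ)) (x : X) :
    F.inner (augTrans F.hi Act (subsetOf A P a Γ)).tgt.2 x ⊆
      F.descendants x a ∪
        (F.inner Act x \ F.descendants x a).image (nextSet (moves A P a Γ) x) := by
  intro S' hS'
  obtain ⟨hS', hmem⟩ := F.mem_inner.1 hS'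
  obtain ⟨t, ht⟩ := mem_augTrans_active.1 hS'
  obtain ⟨hne, ht⟩ := (F.mem_augTrans_update (not_doubleInc hA h h1 h2)).1 ht
  rcases ht with ⟨-, rfl⟩ | ⟨-, rfl⟩ | ⟨S, hS, -, rfl⟩
  · exfalso
    obtain ⟨r, hr⟩ : (zeroSet (moves A P a Γ) x).Nonempty := by
      simpa [ofPair_nonempty] using hne
    have hrm := hmem (r, false) (mem_ofPair_false.2 hr)
    obtain ⟨d, hd, hu, rfl⟩ := mem_zeroSet.1 hr
    rcases F.update_cases (mem_moves.1 hd).1 x with h | h | h | h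
    · exact h.2 hrm
    all_goals simp [h.1] at hu
  · refine Finset.mem_union_left _ ?_
    have hne' : (oneSet (moves A P a Γ) x).Nonempty := by
      simpa [ofPair_nonempty] using hne
    rcases F.oneSet_moves (P := P) (a := a) (Γ := Γ) x with h0 | h0
    · simp [h0] at hne'
    · rw [h0] at hne hne' hS' ⊢
      exact F.mem_descendants.2 ⟨hne', ⟨_, _, reach_next h h1 h2, hS'⟩, hne, Or.inl ⟨0, rfl⟩⟩
  · have hin : S ∈ F.inner Act x := by
      refine F.mem_inner.2 ⟨hS, ?_⟩
      rcases ((F.reach_inv hA h).1 x S hS).2.2 with hm | rfl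
      · exact hm
      · exfalso
        have k0 : F.keepAll x a (P \ F.mem x) = ∅ := by
          rw [Finset.eq_empty_iff_forall_notMem]
          intro r hr
          obtain ⟨d, hd, -, hu, hs, -⟩ := F.mem_keepAll.1 hr
          exact (Finset.mem_sdiff.1 hs).2 (F.update_eq_var hd hu).2.1
        have i0 : incSet (moves A P a Γ) x (P \ F.mem x) = ∅ := by
          rw [Finset.eq_empty_iff_forall_notMem]
          intro r hr
          obtain ⟨d, hd, hu, hs, -⟩ := mem_incSet.1 hr
          exact (Finset.mem_sdiff.1 hs).2
            (F.lst_subset x (F.update_eq_succ (mem_moves.1 hd).1 hu).2.1)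
        rw [F.nextSet_eq hA h hS h2, plain_ofPair, marked_ofPair, k0, i0, F.keepAll_empty,
          Finset.union_empty, normPair_empty, ofPair_nonempty] at hne
        simp at hne
    by_cases hD : S ∈ F.descendants x a
    · exact Finset.mem_union_left _ (F.next_mem_descendants hA h hS h2 hne hD)
    · exact Finset.mem_union_right _ (Finset.mem_image_of_mem _ (Finset.mem_sdiff.2 ⟨hin, hD⟩))

/-- In every state but the initial one, few indices do not descend from `fstLab x a`. -/
theorem inner_inv (hA : ¬ Aborts A F.hi F.q₀) {P : Finset Q} {Act : Finset (Shared X Q)}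
    (h : AugReach A F.hi F.q₀ (P, Act)) :
    (P = {F.q₀} ∧ Act = augInit X F.q₀) ∨ ∃ a, (∀ q ∈ P, F.lab q = some a) ∧
      ∀ x, (F.inner Act x \ F.descendants x a).card ≤
        3 ^ (Fintype.card Q - 1 - (F.labelled a).card) := by
  generalize hs : (P, Act) = s at h
  induction h generalizing P Act with
  | init =>
    obtain ⟨rfl, rfl⟩ := Prod.mk.inj hs
    exact Or.inl ⟨rfl, rfl⟩
  | @step P₀ Act₀ a δ h0 hδ ih =>
    replace ih := ih rfl
    obtain ⟨Γ, h1, h2, rfl⟩ := mem_subsetTrans.1 hδ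
    obtain ⟨hP, hAct⟩ := Prod.mk.inj hs
    refine Or.inr ⟨a, ?_, fun x => ?_⟩
    · intro r hr
      rw [hP] at hr
      obtain ⟨d, hd, rfl⟩ := mem_subsetOf_tgt.1 hr
      obtain ⟨hd', -, rfl, -⟩ := mem_moves.1 hd
      exact F.lab_tgt d hd'
    · have hle : (F.inner Act x \ F.descendants x a).card ≤
          (F.inner Act₀ x \ F.descendants x a).card := by
        refine (Finset.card_le_card ?_).trans (Finset.card_image_le
          (f := nextSet (moves A P₀ a Γ) x) (s := F.inner Act₀ x \ F.descendants x a))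
        rw [hAct]
        exact sdiff_le_iff.2 (F.inner_next hA h0 h1 h2 x)
      refine hle.trans ?_
      rcases ih with ⟨rfl, rfl⟩ | ⟨b, hb, hcard⟩
      · have : F.inner (augInit X F.q₀) x = ∅ := by
          rw [Finset.eq_empty_iff_forall_notMem]
          intro S hS
          obtain ⟨hS, hm⟩ := F.mem_inner.1 hS
          simp only [augInit, Finset.mem_image, Finset.mem_univ, true_and, Prod.mk.injEq] at hS
          obtain ⟨y, rfl, rfl⟩ := hS
          exact F.not_mem y (hm _ (Finset.mem_singleton_self _))
        simp [this]
      · by_cases hab : a = b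
        -- A repeated letter: non-descendants come only from non-descendants, so their number does
        -- not grow.
        · rw [hab]
          exact hcard x
        -- A change of letter: all old indices live on states labelled `b`, which are disjoint from
        -- those labelled `a` and from `q₀`.
        · refine (Finset.card_le_card Finset.sdiff_subset).trans
            ((F.card_inner_le hA h0 hb x).trans ?_)
          refine Nat.pow_le_pow_right (by norm_num) ?_
          have := F.card_labelled_add_lt hab
          omega

end FlatCA

end Indices

/-! ### Sizes of guards and updates -/

namespace Form

variable {B C : Type}

theorem size_conj (l : List (Form B)) : (conj l).size = 1 + (l.map fun φ => φ.size + 1).sum := by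
  induction l with
  | nil => rfl
  | cons φ l ih =>
    have e : (conj (φ :: l)).size = φ.size + (conj l).size + 1 := rfl
    rw [e, ih, List.map_cons, List.sum_cons]
    ring

theorem size_disj (l : List (Form B)) : (disj l).size = 1 + (l.map fun φ => φ.size + 1).sum := by
  induction l with
  | nil => rfl
  | cons φ l ih =>
    have e : (disj (φ :: l)).size = φ.size + (disj l).size + 1 := rfl
    rw [e, ih, List.map_cons, List.sum_cons]
    ring

theorem subst_conj (f : B → Form C) (l : List (Form B)) :
    (conj l).subst f = conj (l.map fun φ => φ.subst f) := by
  induction l with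
  | nil => rfl
  | cons φ l ih =>
    have e : (conj (φ :: l)).subst f = .and (φ.subst f) ((conj l).subst f) := rfl
    rw [e, ih]
    rfl

theorem subst_disj (f : B → Form C) (l : List (Form B)) :
    (disj l).subst f = disj (l.map fun φ => φ.subst f) := by
  induction l with
  | nil => rfl
  | cons φ l ih =>
    have e : (disj (φ :: l)).subst f = .or (φ.subst f) ((disj l).subst f) := rfl
    rw [e, ih]
    rfl

theorem size_conj_le {l : List (Form B)} {c : ℕ} (h : ∀ φ ∈ l, φ.size ≤ c) :
    (conj l).size ≤ 1 + l.length * (c + 1) := by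
  rw [size_conj]
  have := List.sum_le_card_nsmul (l.map fun φ => φ.size + 1) (c + 1) (by simpa using h)
  simpa using this

theorem size_disj_le {l : List (Form B)} {c : ℕ} (h : ∀ φ ∈ l, φ.size ≤ c) :
    (disj l).size ≤ 1 + l.length * (c + 1) := by
  rw [size_disj]
  have := List.sum_le_card_nsmul (l.map fun φ => φ.size + 1) (c + 1) (by simpa using h)
  simpa using this

end Form

section Sizes

variable {α X Q : Type} [DecidableEq α] [DecidableEq X] [DecidableEq Q]
  [Fintype X] [Fintype Q] {A : CA α X Q} (F : FlatCA A)

theorem size_shareAtom_le (Act : Finset (Shared X Q)) (c : CPred × (X × Q)) :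
    (shareAtom Act c).size ≤
      1 + 2 * (Act.filter fun z => z.1 = c.2.1 ∧ (c.2.2, false) ∈ z.2).card := by
  refine (Form.size_disj_le (c := 1) fun φ hφ => ?_).trans ?_
  · obtain ⟨z, -, rfl⟩ := List.mem_map.1 hφ
    exact le_rfl
  · rw [List.length_map, Finset.length_toList, mul_comm]

namespace FlatCA

/-- The states in `P` where some counter is tested. -/
def tested (P : Finset Q) : Finset Q := P.filter fun q => ∃ x, q ∈ F.lst x

/-- The trade-off behind the search time: `n` counts the states of the current letter and `k` the
remaining non-initial ones. The registers relevant to a tested atom are older ones, at most `3 ^ k`,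
and at most one descendant. -/
theorem exists_card_tested (hA : ¬ Aborts A F.hi F.q₀) {P : Finset Q}
    {Act : Finset (Shared X Q)} (h : AugReach A F.hi F.q₀ (P, Act)) :
    ∃ n k, n + k + 1 = Fintype.card Q ∧ (F.tested P).card ≤ n ∧ ∀ x, ∀ p ∈ F.lst x, p ∈ P →
      (Act.filter fun z => z.1 = x ∧ (p, false) ∈ z.2).card ≤ 4 ^ k + 1 := by
  have hQ : 0 < Fintype.card Q := Fintype.card_pos_iff.2 ⟨F.q₀⟩
  rcases F.inner_inv hA h with ⟨rfl, rfl⟩ | ⟨a, hP, hcard⟩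
  · have hnot : ∀ x, F.q₀ ∉ F.lst x := fun x hx => F.not_mem x (F.lst_subset x hx)
    refine ⟨0, Fintype.card Q - 1, by omega, ?_, ?_⟩
    · rw [Nat.le_zero, Finset.card_eq_zero, Finset.eq_empty_iff_forall_notMem]
      intro q hq
      obtain ⟨hq, x, hx⟩ := Finset.mem_filter.1 hq
      rw [Finset.mem_singleton] at hq
      exact hnot x (hq ▸ hx)
    · intro x p hp hpP
      rw [Finset.mem_singleton] at hpP
      exact absurd (hpP ▸ hp) (hnot x)
  · have hlt := F.card_labelled_lt a
    refine ⟨(F.labelled a).card, Fintype.card Q - 1 - (F.labelled a).card, by omega, ?_, ?_⟩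
    · refine Finset.card_le_card fun q hq => ?_
      exact Finset.mem_filter.2 ⟨Finset.mem_univ _, hP q (Finset.mem_filter.1 hq).1⟩
    · intro x p hp hpP
      have hsub : (Act.filter fun z => z.1 = x ∧ (p, false) ∈ z.2) ⊆
          ((F.inner Act x \ F.descendants x a) ∪
            (F.descendants x a).filter fun S => (p, false) ∈ S).image fun S => (x, S) := by
        rintro ⟨y, S⟩ hz
        replace ⟨hz, hy, hpS⟩ := Finset.mem_filter.1 hz
        obtain rfl : y = x := hy
        refine Finset.mem_image.2 ⟨S, ?_, rfl⟩
        by_cases hD : S ∈ F.descendants y a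
        · exact Finset.mem_union_right _ (Finset.mem_filter.2 ⟨hD, hpS⟩)
        · refine Finset.mem_union_left _ (Finset.mem_sdiff.2 ⟨F.mem_inner.2 ⟨hz, ?_⟩, hD⟩)
          rcases ((F.reach_inv hA h).1 y S hz).2.2 with hm | rfl
          · exact hm
          · rw [mem_ofPair_false] at hpS
            exact absurd (F.lst_subset y hp) (Finset.mem_sdiff.1 hpS).2
      have hone : ((F.descendants x a).filter fun S => (p, false) ∈ S).card ≤ 1 := by
        rw [Finset.card_le_one]
        intro S hS S' hS'
        rw [Finset.mem_filter] at hS hS'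
        exact F.descendants_eq_of_hit hA hS.1 hS'.1
          ⟨p, Finset.mem_inter.2 ⟨mem_plain.2 hS.2, hp⟩⟩
          ⟨p, Finset.mem_inter.2 ⟨mem_plain.2 hS'.2, hp⟩⟩
      refine (Finset.card_le_card hsub).trans (Finset.card_image_le.trans
        ((Finset.card_union_le _ _).trans (add_le_add ((hcard x).trans ?_) hone)))
      exact Nat.pow_le_pow_left (by norm_num) _

/-- A source state determines its counter, so it contributes at most one lower and one upper test;
all true guards coincide. -/
theorem card_subsetGuards_le (P : Finset Q) (a : α) :
    (subsetGuards A P a).card ≤ 1 + 2 * (F.tested P).card := by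
  classical
  let g : (X → Guard X) → Q → Guard (X × Q) := fun γ q =>
    if h : ∃ x, q ∈ F.lst x then indexGuard q (γ h.choose) else .tt
  have hg : ∀ γ q x, q ∈ F.lst x → g γ q = indexGuard q (γ x) := by
    intro γ q x hx
    have h : ∃ x, q ∈ F.lst x := ⟨x, hx⟩
    have e : h.choose = x := F.mem_inj (F.lst_subset _ h.choose_spec) (F.lst_subset _ hx)
    simp only [g, dif_pos h, e]
  have hsub : subsetGuards A P a ⊆ insert .tt ((F.tested P).image (g (geGuard F.lo)) ∪
      (F.tested P).image (g (ltGuard F.hi))) := by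
    intro φ hφ
    obtain ⟨d, hd, hP, -, rfl⟩ := mem_subsetGuards.1 hφ
    rcases F.guard_cases d hd with h | ⟨x, hx, h | h⟩
    · rw [h]
      exact Finset.mem_insert_self _ _
    · refine Finset.mem_insert_of_mem (Finset.mem_union_left _ (Finset.mem_image.2
        ⟨d.src, Finset.mem_filter.2 ⟨hP, x, hx⟩, ?_⟩))
      rw [hg _ _ x hx, h]
    · refine Finset.mem_insert_of_mem (Finset.mem_union_right _ (Finset.mem_image.2
        ⟨d.src, Finset.mem_filter.2 ⟨hP, x, hx⟩, ?_⟩))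
      rw [hg _ _ x hx, h]
  have h1 := Finset.card_le_card hsub
  have h2 := Finset.card_insert_le (Form.tt : Guard (X × Q))
    ((F.tested P).image (g (geGuard F.lo)) ∪ (F.tested P).image (g (ltGuard F.hi)))
  have h3 := Finset.card_union_le ((F.tested P).image (g (geGuard F.lo)))
    ((F.tested P).image (g (ltGuard F.hi)))
  have h4 := (F.tested P).card_image_le (f := g (geGuard F.lo))
  have h5 := (F.tested P).card_image_le (f := g (ltGuard F.hi))
  omega

theorem size_share_index_le {P : Finset Q} {Act : Finset (Shared X Q)} {N : ℕ}
    (hN : ∀ x, ∀ p ∈ F.lst x, p ∈ P →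
      (Act.filter fun z => z.1 = x ∧ (p, false) ∈ z.2).card ≤ N) {q : Q} (hq : q ∈ P)
    {φ : Guard X} (hφ : φ = .tt ∨ φ = .ff ∨ ∃ x, q ∈ F.lst x ∧ ∃ p, φ = .and (.atom (p, x)) .tt) :
    ((indexGuard q φ).subst (shareAtom Act)).size ≤ 3 + 2 * N := by
  rcases hφ with rfl | rfl | ⟨x, hx, p, rfl⟩
  · exact le_add_right (Nat.le_of_ble_eq_true rfl)
  · exact le_add_right (Nat.le_of_ble_eq_true rfl)
  · have e : ((indexGuard q (.and (.atom (p, x)) .tt)).subst (shareAtom Act)).size =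
        (shareAtom Act (p, (x, q))).size + 1 + 1 := rfl
    have h1 := size_shareAtom_le Act (p, (x, q))
    have h2 := hN x q hx hq
    simp only at h1
    omega

theorem size_guard_le {P : Finset Q} {Act : Finset (Shared X Q)} {N : ℕ}
    (hN : ∀ x, ∀ p ∈ F.lst x, p ∈ P →
      (Act.filter fun z => z.1 = x ∧ (p, false) ∈ z.2).card ≤ N) (a : α)
    (Γ : Finset (Guard (X × Q))) :
    (augTrans F.hi Act (subsetOf A P a Γ)).guard.size ≤
      1 + (subsetGuards A P a).card * (5 + 2 * N) := by
  have e : (augTrans F.hi Act (subsetOf A P a Γ)).guard =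
      (minterm (subsetGuards A P a) Γ).subst (shareAtom Act) := rfl
  rw [e, minterm, Form.subst_conj]
  refine (Form.size_conj_le (c := 4 + 2 * N) ?_).trans ?_
  · intro φ hφ
    obtain ⟨φ₁, hφ₁, rfl⟩ := List.mem_map.1 hφ
    obtain ⟨φ₂, hφ₂, rfl⟩ := List.mem_map.1 hφ₁
    obtain ⟨d, hd, hP, -, rfl⟩ := mem_subsetGuards.1 (Finset.mem_toList.1 hφ₂)
    have hs : ((indexGuard d.src d.guard).subst (shareAtom Act)).size ≤ 3 + 2 * N := by
      refine F.size_share_index_le hN hP ?_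
      rcases F.guard_cases d hd with h | ⟨x, hx, h | h⟩
      · exact Or.inl h
      · exact Or.inr (Or.inr ⟨x, hx, _, h⟩)
      · exact Or.inr (Or.inr ⟨x, hx, _, h⟩)
    split_ifs
    · omega
    · have e2 : ((Form.neg (indexGuard d.src d.guard)).subst (shareAtom Act)).size =
        ((indexGuard d.src d.guard).subst (shareAtom Act)).size + 1 := rfl
      omega
  · rw [List.length_map, List.length_map, Finset.length_toList]
    exact le_of_eq (by ring)

/-- The search for an enabled transition is short. -/
theorem sum_guard_le [Fintype α] (hA : ¬ Aborts A F.hi F.q₀) {m : ℕ}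
    (hm : Fintype.card Q = m + 1) (s : AugState X Q) (a : α) :
    ∑ δ ∈ (augAut A F.hi F.q₀).trans.filter (fun δ => δ.src = s ∧ δ.letter = a),
      (1 + δ.guard.size) ≤ 64 * ((m + 1) * 4 ^ m) := by
  obtain ⟨P, Act⟩ := s
  by_cases h : AugReach A F.hi F.q₀ (P, Act)
  swap
  · have : (augAut A F.hi F.q₀).trans.filter (fun δ => δ.src = (P, Act) ∧ δ.letter = a) = ∅ := by
      rw [Finset.eq_empty_iff_forall_notMem]
      intro δ hδ
      obtain ⟨hδ, hsrc, -⟩ := Finset.mem_filter.1 hδ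
      obtain ⟨P', Act', a', Γ, h', -, -, rfl⟩ := mem_augAut_trans.1 hδ
      exact h (hsrc ▸ h')
    rw [this]
    exact Nat.zero_le _
  obtain ⟨n, k, hnk, htest, hN⟩ := F.exists_card_tested hA h
  obtain rfl : m = n + k := by omega
  set Ψ := subsetGuards A P a with hΨdef
  have hΨ : Ψ.card ≤ 1 + 2 * n := (F.card_subsetGuards_le P a).trans (by omega)
  have hsub : (augAut A F.hi F.q₀).trans.filter (fun δ => δ.src = (P, Act) ∧ δ.letter = a) ⊆
      Ψ.powerset.image fun Γ => augTrans F.hi Act (subsetOf A P a Γ) := by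
    intro δ hδ
    obtain ⟨hδ, hsrc, hlet⟩ := Finset.mem_filter.1 hδ
    obtain ⟨P', Act', a', Γ, h', h1, -, rfl⟩ := mem_augAut_trans.1 hδ
    obtain ⟨hP, hAct⟩ := Prod.mk.inj hsrc
    obtain rfl : P' = P := hP
    obtain rfl : Act' = Act := hAct
    obtain rfl : a' = a := hlet
    exact Finset.mem_image_of_mem _ (Finset.mem_powerset.2 h1)
  -- At most `1 + 2 * n` guards give at most `2 ^ (1 + 2 * n) = 2 * 4 ^ n` minterms; the factor `4 ^
  -- n` meets the `4 ^ k` from the guard sizes.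
  have hcard : (Ψ.powerset.image fun Γ => augTrans F.hi Act (subsetOf A P a Γ)).card ≤
      2 * 4 ^ n := by
    refine Finset.card_image_le.trans ?_
    rw [Finset.card_powerset]
    refine (Nat.pow_le_pow_right (by norm_num) hΨ).trans ?_
    rw [pow_add, pow_mul]
    norm_num
  refine (Finset.sum_le_sum_of_subset hsub).trans ?_
  refine (Finset.sum_le_card_nsmul _ _ (2 + (1 + 2 * n) * (7 + 2 * 4 ^ k)) ?_).trans ?_
  · intro δ hδ
    obtain ⟨Γ, -, rfl⟩ := Finset.mem_image.1 hδ
    have h1 := F.size_guard_le hN a Γ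
    have h2 : Ψ.card * (5 + 2 * (4 ^ k + 1)) ≤ (1 + 2 * n) * (5 + 2 * (4 ^ k + 1)) :=
      Nat.mul_le_mul_right _ hΨ
    have h3 : 5 + 2 * (4 ^ k + 1) = 7 + 2 * 4 ^ k := by ring
    rw [h3] at h1 h2
    calc 1 + (augTrans F.hi Act (subsetOf A P a Γ)).guard.size
        ≤ 1 + (1 + Ψ.card * (7 + 2 * 4 ^ k)) := Nat.add_le_add_left h1 1
      _ ≤ 2 + (1 + 2 * n) * (7 + 2 * 4 ^ k) := by omega
  · rw [smul_eq_mul]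
    refine (Nat.mul_le_mul_right _ hcard).trans ?_
    rw [pow_add]
    have hk : 1 ≤ 4 ^ k := Nat.one_le_pow _ _ (by norm_num)
    generalize 4 ^ k = K at hk
    generalize 4 ^ n = N
    have h1 : 2 + (1 + 2 * n) * (7 + 2 * K) ≤ 32 * (n + 1) * K := by nlinarith
    calc 2 * N * (2 + (1 + 2 * n) * (7 + 2 * K)) ≤ 2 * N * (32 * (n + 1) * K) :=
          Nat.mul_le_mul_left _ h1
      _ = 64 * ((n + 1) * (N * K)) := by ring
      _ ≤ 64 * ((n + k + 1) * (N * K)) := by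
          gcongr
          omega

theorem size_final_le [Fintype α] (hA : ¬ Aborts A F.hi F.q₀) {m : ℕ}
    (hm : Fintype.card Q = m + 1) {s : AugState X Q} (hs : s ∈ (augAut A F.hi F.q₀).states) :
    ((augAut A F.hi F.q₀).final s).size ≤ 64 * ((m + 1) * 4 ^ m) := by
  obtain ⟨P, Act⟩ := s
  obtain ⟨n, k, hnk, -, hN⟩ := F.exists_card_tested hA (mem_augAut_states.1 hs)
  have hN' : ∀ x, ∀ p ∈ F.lst x, p ∈ P →
      (Act.filter fun z => z.1 = x ∧ (p, false) ∈ z.2).card ≤ 4 ^ m + 1 := fun x p hp hpP =>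
    (hN x p hp hpP).trans
      (Nat.add_le_add_right (Nat.pow_le_pow_right (by norm_num) (by omega)) 1)
  have e : (augAut A F.hi F.q₀).final (P, Act) = (subsetFinal A P).subst (shareAtom Act) := rfl
  rw [e, subsetFinal, Form.subst_disj]
  refine (Form.size_disj_le (c := 3 + 2 * (4 ^ m + 1)) ?_).trans ?_
  · intro φ hφ
    obtain ⟨φ₁, hφ₁, rfl⟩ := List.mem_map.1 hφ
    obtain ⟨q, hq, rfl⟩ := List.mem_map.1 hφ₁
    refine F.size_share_index_le hN' (Finset.mem_toList.1 hq) ?_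
    rcases F.final_cases q with h | h | ⟨x, hx, h⟩
    · exact Or.inl h
    · exact Or.inr (Or.inl h)
    · exact Or.inr (Or.inr ⟨x, hx, _, h⟩)
  · rw [List.length_map, List.length_map, Finset.length_toList]
    have h1 : P.card ≤ m + 1 := hm ▸ Finset.card_le_univ P
    have hk : 1 ≤ 4 ^ m := Nat.one_le_pow _ _ (by norm_num)
    generalize 4 ^ m = K at hk
    calc 1 + P.card * (3 + 2 * (K + 1) + 1) ≤ 1 + (m + 1) * (3 + 2 * (K + 1) + 1) :=
          Nat.add_le_add_left (Nat.mul_le_mul_right _ h1) 1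
      _ ≤ 64 * ((m + 1) * K) := by nlinarith

/-- Updates are short, since they are non-replicating. -/
theorem sum_updateCost_le [Fintype α] (hA : ¬ Aborts A F.hi F.q₀)
    {δ : Trans α (AugState X Q) (Guard (Shared X Q)) (Shared X Q → SetTerm (Shared X Q))}
    (hδ : δ ∈ (augAut A F.hi F.q₀).trans) :
    ∑ y, updateCost δ.update y ≤ 32 * Fintype.card (Shared X Q) := by
  have hnr := F.nonReplicating hA δ hδ
  obtain ⟨P, Act, a, Γ, h, h1, h2, rfl⟩ := mem_augAut_trans.1 hδ
  have hd := not_doubleInc hA h h1 h2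
  set u := (augTrans F.hi Act (subsetOf A P a Γ)).update with hu
  have hsize : ∀ y, ∀ t ∈ u y, t.size ≤ 3 := by
    rintro ⟨x, S⟩ t ht
    rcases ((F.mem_augTrans_update hd).1 ht).2 with ⟨rfl, -⟩ | ⟨rfl, -⟩ | ⟨S, -, rfl, -⟩
    · simp [RTerm.size]
    · simp [RTerm.size]
    · unfold nextTerm
      split_ifs <;> simp [finc, RTerm.size]
  -- An r-term is identified by its register, or else by its constant and counter; hence two extra
  -- copies of `X`.
  have hcard : ∑ y, (u y).card ≤ Fintype.card (Shared X Q) + (Fintype.card X + Fintype.card X) := by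
    rw [← Finset.card_sigma, ← Fintype.card_sum, ← Fintype.card_sum, ← Finset.card_univ]
    let f : (Σ _ : Shared X Q, RTerm (Shared X Q)) → Shared X Q ⊕ X ⊕ X := fun p =>
      match p.2.reg with
      | some z => .inl z
      | none => if p.2 = .zero then .inr (.inl p.1.1) else .inr (.inr p.1.1)
    refine Finset.card_le_card_of_injOn f (fun _ _ => Finset.mem_coe.2 (Finset.mem_univ _)) ?_
    have hcase : ∀ x S t, t ∈ u (x, S) →
        (t = .zero ∧ f ⟨(x, S), t⟩ = .inr (.inl x) ∧
          S = ofPair (zeroSet (moves A P a Γ) x) ∅) ∨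
        (t = .one ∧ f ⟨(x, S), t⟩ = .inr (.inr x) ∧
          S = ofPair (oneSet (moves A P a Γ) x) ∅) ∨
        ∃ z, t.reg = some z ∧ f ⟨(x, S), t⟩ = .inl z := by
      intro x S t ht
      rcases ((F.mem_augTrans_update hd).1 ht).2 with ⟨rfl, hS⟩ | ⟨rfl, hS⟩ | ⟨S', -, rfl, -⟩
      · exact Or.inl ⟨rfl, by simp [f, RTerm.reg], hS⟩
      · exact Or.inr (Or.inl ⟨rfl, by simp [f, RTerm.reg], hS⟩)
      · have hreg : (nextTerm (moves A P a Γ) F.hi x S').reg = some (x, S') := by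
          unfold nextTerm
          split_ifs <;> rfl
        exact Or.inr (Or.inr ⟨_, hreg, by simp [f, hreg]⟩)
    rintro ⟨⟨x, S⟩, t⟩ ht ⟨⟨x', S'⟩, t'⟩ ht' he
    replace ht : t ∈ u (x, S) := by simpa using ht
    replace ht' : t' ∈ u (x', S') := by simpa using ht'
    rcases hcase x S t ht with ⟨rfl, e1, e2⟩ | ⟨rfl, e1, e2⟩ | ⟨z, e1, e2⟩ <;>
      rcases hcase x' S' t' ht' with ⟨rfl, e3, e4⟩ | ⟨rfl, e3, e4⟩ | ⟨z', e3, e4⟩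
    · rw [e1, e3] at he
      simp only [Sum.inr.injEq, Sum.inl.injEq] at he
      subst he
      rw [e2, e4]
    · rw [e1, e3] at he
      simp at he
    · rw [e1, e4] at he
      simp at he
    · rw [e1, e3] at he
      simp at he
    · rw [e1, e3] at he
      simp only [Sum.inr.injEq] at he
      subst he
      rw [e2, e4]
    · rw [e1, e4] at he
      simp at he
    · rw [e2, e3] at he
      simp at he
    · rw [e2, e3] at he
      simp at he
    · rw [e2, e4] at he
      obtain rfl := Sum.inl.inj he
      obtain ⟨e5, rfl⟩ := hnr z _ _ t t' ht ht' e1 e3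
      rw [e5]
  have hX : Fintype.card X ≤ Fintype.card (Shared X Q) :=
    Fintype.card_le_of_injective (fun x => (x, ∅)) fun x y hxy => (Prod.mk.inj hxy).1
  -- An r-term has at most three symbols, so it costs at most `3 * 3 + 1 = 10`. In total `2` per
  -- register plus `10` for at most three times as many r-terms as registers, which gives the `32`.
  have hcost : ∀ y, updateCost u y ≤ 2 + (u y).card * 10 := by
    intro y
    refine Nat.add_le_add_left (Finset.sum_le_card_nsmul _ _ 10 fun t ht => ?_) 2
    have := hsize y t ht
    omega
  refine (Finset.sum_le_sum fun y _ => hcost y).trans ?_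
  rw [Finset.sum_add_distrib, ← Finset.sum_mul, Finset.sum_const, Finset.card_univ, smul_eq_mul]
  omega

theorem termSize_le {Y : Type} (u : Y → SetTerm Y) (y : Y) :
    (setLang Y).termSize (u y) ≤ updateCost u y := by
  simp only [setLang, updateCost]
  split_ifs
  · omega
  · have : ∑ t ∈ u y, (3 * t.size + 1) = 3 * ∑ t ∈ u y, t.size + (u y).card := by
      rw [Finset.sum_add_distrib, ← Finset.mul_sum]
      simp
    omega

/-- Guards and updates are bounded crudely by a product per transition. The sum over the transitions
is then grouped by source and letter, where the bound for the search applies. -/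
theorem size_le [Fintype α] (hA : ¬ Aborts A F.hi F.q₀) {m : ℕ} (hm : Fintype.card Q = m + 1) :
    (augAut A F.hi F.q₀).size (setLang _) ≤ (augAut A F.hi F.q₀).states.card *
      (1 + Fintype.card α * (64 * ((m + 1) * 4 ^ m) *
        (1 + 32 * Fintype.card (Shared X Q)))) := by
  set B := augAut A F.hi F.q₀ with hB
  set G := 64 * ((m + 1) * 4 ^ m)
  set U := 32 * Fintype.card (Shared X Q)
  have hcost : ∀ δ ∈ B.trans, (setLang (Shared X Q)).guardSize δ.guard +
      ∑ y, (setLang (Shared X Q)).termSize (δ.update y) ≤ (1 + δ.guard.size) * (1 + U) := by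
    intro δ hδ
    have h1 : ∑ y, (setLang (Shared X Q)).termSize (δ.update y) ≤ U :=
      (Finset.sum_le_sum fun y _ => termSize_le δ.update y).trans (F.sum_updateCost_le hA hδ)
    have h2 : (setLang (Shared X Q)).guardSize δ.guard = δ.guard.size := rfl
    rw [h2]
    nlinarith [Nat.zero_le (δ.guard.size * U)]
  have hsum : ∑ δ ∈ B.trans, (1 + δ.guard.size) ≤ B.states.card * (Fintype.card α * G) := by
    have hmaps : ∀ δ ∈ B.trans, (δ.src, δ.letter) ∈ B.states ×ˢ (Finset.univ : Finset α) := by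
      intro δ hδ
      obtain ⟨P, Act, a, Γ, h, -, -, rfl⟩ := mem_augAut_trans.1 hδ
      exact Finset.mem_product.2 ⟨mem_augAut_states.2 h, Finset.mem_univ _⟩
    rw [← Finset.sum_fiberwise_of_maps_to hmaps]
    refine (Finset.sum_le_card_nsmul _ _ G ?_).trans ?_
    · rintro ⟨s, a⟩ -
      have := F.sum_guard_le hA hm s a
      simpa only [Prod.mk.injEq] using this
    · rw [Finset.card_product, Finset.card_univ, smul_eq_mul, mul_assoc]
  unfold RegAut.size
  calc B.states.card + ∑ δ ∈ B.trans, ((setLang (Shared X Q)).guardSize δ.guard +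
        ∑ y, (setLang (Shared X Q)).termSize (δ.update y))
      ≤ B.states.card + ∑ δ ∈ B.trans, (1 + δ.guard.size) * (1 + U) :=
        Nat.add_le_add_left (Finset.sum_le_sum hcost) _
    _ = B.states.card + (∑ δ ∈ B.trans, (1 + δ.guard.size)) * (1 + U) := by
        rw [Finset.sum_mul]
    _ ≤ B.states.card + B.states.card * (Fintype.card α * G) * (1 + U) :=
        Nat.add_le_add_left (Nat.mul_le_mul_right _ hsum) _
    _ = B.states.card * (1 + Fintype.card α * (G * (1 + U))) := by ring

end FlatCA

end Sizes

/-! ### The number of states -/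

/-- Such a set is obtained by at most `k` choices, each of an element to insert or of nothing. -/
theorem card_small_subsets_le (β : Type) [Fintype β] [DecidableEq β] (k : ℕ) :
    ((Finset.univ : Finset (Finset β)).filter fun s => s.card ≤ k).card ≤
      (Fintype.card β + 1) ^ k := by
  induction k with
  | zero =>
    rw [pow_zero, Finset.card_le_one]
    intro s hs t ht
    simp only [Finset.mem_filter, Finset.mem_univ, true_and, Nat.le_zero,
      Finset.card_eq_zero] at hs ht
    rw [hs, ht]
  | succ k ih =>
    have hsub : ((Finset.univ : Finset (Finset β)).filter fun s => s.card ≤ k + 1) ⊆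
        ((Finset.univ : Finset (Option β)) ×ˢ
          (Finset.univ : Finset (Finset β)).filter fun s => s.card ≤ k).image
            fun p => p.1.elim p.2 fun b => insert b p.2 := by
      intro s hs
      replace hs := (Finset.mem_filter.1 hs).2
      rcases s.eq_empty_or_nonempty with rfl | ⟨b, hb⟩
      · exact Finset.mem_image.2 ⟨(none, ∅), by simp, rfl⟩
      · refine Finset.mem_image.2 ⟨(some b, s.erase b), ?_, Finset.insert_erase hb⟩
        have := Finset.card_erase_of_mem hb
        simp only [Finset.mem_product, Finset.mem_univ, true_and, Finset.mem_filter]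
        omega
    refine (Finset.card_le_card hsub).trans (Finset.card_image_le.trans ?_)
    rw [Finset.card_product, Finset.card_univ, Fintype.card_option, pow_succ, mul_comm]
    exact Nat.mul_le_mul_right _ ih

/-- A set with few elements outside `W` splits into an arbitrary subset of `W` and a small set. With
`W` the descendants, this counts the possible families of indices. -/
theorem card_near_le {β : Type} [Fintype β] [DecidableEq β] (W : Finset β) (k : ℕ) :
    ((Finset.univ : Finset (Finset β)).filter fun s => (s \ W).card ≤ k).card ≤
      2 ^ W.card * (Fintype.card β + 1) ^ k := by
  have h := Finset.card_le_card_of_injOn (fun s : Finset β => (s ∩ W, s \ W))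
    (s := (Finset.univ : Finset (Finset β)).filter fun s => (s \ W).card ≤ k)
    (t := W.powerset ×ˢ (Finset.univ : Finset (Finset β)).filter fun s => s.card ≤ k) ?_ ?_
  · refine h.trans ?_
    rw [Finset.card_product, Finset.card_powerset]
    exact Nat.mul_le_mul_left _ (card_small_subsets_le β k)
  · intro s hs
    simp only [Finset.coe_filter, Finset.mem_univ, true_and, Set.mem_ofPred_eq] at hs
    simp [hs]
  · intro s _ t _ he
    obtain ⟨h1, h2⟩ := Prod.mk.inj he
    rw [← Finset.sdiff_union_inter s W, ← Finset.sdiff_union_inter t W, h1, h2]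

/-- For numbers at least one, a sum is at most the product plus the number of terms. It combines the
exponential contributions of several counters into one. -/
theorem sum_two_pow_le {ι : Type} (s : Finset ι) (d : ι → ℕ) :
    ∑ i ∈ s, 2 ^ d i ≤ s.card + 2 ^ ∑ i ∈ s, d i := by
  classical
  induction s using Finset.induction_on with
  | empty => simp
  | insert i s hi ih =>
    rw [Finset.sum_insert hi, Finset.sum_insert hi, Finset.card_insert_of_notMem hi, pow_add]
    have h1 : 1 ≤ 2 ^ d i := Nat.one_le_two_pow
    have h2 : 1 ≤ 2 ^ ∑ i ∈ s, d i := Nat.one_le_two_pow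
    nlinarith

section States

variable {α X Q : Type} [DecidableEq α] [DecidableEq X] [DecidableEq Q]
  [Fintype X] [Fintype Q] {A : CA α X Q} (F : FlatCA A)

namespace FlatCA

theorem sum_card_mem_le {m : ℕ} (hm : Fintype.card Q = m + 1) : ∑ x, (F.mem x).card ≤ m := by
  rw [← Finset.card_biUnion]
  · have hsub : Finset.univ.biUnion F.mem ⊆ Finset.univ.erase F.q₀ := by
      intro q hq
      obtain ⟨x, -, hx⟩ := Finset.mem_biUnion.1 hq
      refine Finset.mem_erase.2 ⟨?_, Finset.mem_univ _⟩
      rintro rfl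
      exact F.not_mem x hx
    have := Finset.card_le_card hsub
    rw [Finset.card_erase_of_mem (Finset.mem_univ _), Finset.card_univ, hm] at this
    exact this
  · intro x _ y _ hxy
    exact Finset.disjoint_left.2 fun q h1 h2 => hxy (F.mem_inj h1 h2)

/-- By liveness the scope contains an exit state. The unit gained here is what makes the main
exponent `2 ^ (m - 1)` and not `2 ^ m`. -/
theorem card_memLab_sdiff (x : X) (a : α) :
    (F.memLab x a \ F.lst x).card + 1 ≤ (F.mem x).card := by
  obtain ⟨q, hq⟩ := F.fst_nonempty x
  obtain ⟨p, hp, -⟩ := F.live x q (F.fst_subset x hq)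
  refine Finset.card_lt_card ((Finset.ssubset_iff_of_subset ?_).2 ⟨p, F.lst_subset x hp, ?_⟩)
  · exact Finset.sdiff_subset.trans (Finset.filter_subset _ _)
  · exact fun h => (Finset.mem_sdiff.1 h).2 hp

include F in
theorem card_ctr_le {m : ℕ} (hm : Fintype.card Q = m + 1) : Fintype.card X ≤ m := by
  refine le_trans ?_ (F.sum_card_mem_le hm)
  rw [← Finset.card_univ, Finset.card_eq_sum_ones]
  refine Finset.sum_le_sum fun x _ => Finset.card_pos.2 ?_
  exact (F.fst_nonempty x).mono (F.fst_subset x)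

/-- Disjoint scopes share the `m` letter states, so the linear parts add up to `4 * m`, at most `m`
comes from `sum_two_pow_le`, and one exponential with exponent at most `m - 1` remains. -/
theorem sum_card_descendants_le (hA : ¬ Aborts A F.hi F.q₀) {m : ℕ}
    (hm : Fintype.card Q = m + 1) (a : α) :
    ∑ x, (F.descendants x a).card ≤ 5 * m + 2 ^ (m - 1) := by
  have hmem := F.sum_card_mem_le hm
  have h1 : ∑ x, (F.descendants x a).card ≤
      4 * ∑ x, (F.mem x).card + ∑ x, 2 ^ (F.memLab x a \ F.lst x).card := by
    rw [Finset.mul_sum, ← Finset.sum_add_distrib]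
    refine Finset.sum_le_sum fun x _ => (F.card_descendants hA x a).trans ?_
    have : (F.memLab x a).card ≤ (F.mem x).card := Finset.card_le_card (Finset.filter_subset _ _)
    omega
  have h2 := sum_two_pow_le Finset.univ fun x => (F.memLab x a \ F.lst x).card
  have h3 : ∑ x, (F.memLab x a \ F.lst x).card + Fintype.card X ≤ ∑ x, (F.mem x).card := by
    rw [← Finset.card_univ, Finset.card_eq_sum_ones, ← Finset.sum_add_distrib]
    exact Finset.sum_le_sum fun x _ => F.card_memLab_sdiff x a
  have hX := F.card_ctr_le hm
  rw [Finset.card_univ] at h2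
  by_cases h0 : Fintype.card X = 0
  · have : IsEmpty X := Fintype.card_eq_zero_iff.1 h0
    simp
  · have h4 : 2 ^ ∑ x, (F.memLab x a \ F.lst x).card ≤ 2 ^ (m - 1) :=
      Nat.pow_le_pow_right (by norm_num) (by omega)
    omega

/-- The register outside the scope is active exactly when `P` leaves the scope, and its index is
then a function of `P`; so only the inner indices carry information. -/
theorem reach_ext (hA : ¬ Aborts A F.hi F.q₀) {P : Finset Q} {Act Act' : Finset (Shared X Q)}
    (h : AugReach A F.hi F.q₀ (P, Act)) (h' : AugReach A F.hi F.q₀ (P, Act'))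
    (he : ∀ x, F.inner Act x = F.inner Act' x) : Act = Act' := by
  have key : ∀ Act Act', AugReach A F.hi F.q₀ (P, Act) → AugReach A F.hi F.q₀ (P, Act') →
      (∀ x, F.inner Act x = F.inner Act' x) → Act ⊆ Act' := by
    rintro Act Act' h h' he ⟨x, S⟩ hS
    obtain ⟨⟨m, hm⟩, -, hmem | rfl⟩ := (F.reach_inv hA h).1 x S hS
    · have : S ∈ F.inner Act' x := he x ▸ F.mem_inner.2 ⟨hS, hmem⟩
      exact (F.mem_inner.1 this).1
    · refine (F.reach_inv hA h').2 x ?_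
      have hne : (ofPair (P \ F.mem x) ∅).Nonempty := ⟨m, hm⟩
      simpa [ofPair_nonempty] using hne
  exact (key _ _ h h' he).antisymm (key _ _ h' h fun x => (he x).symm)

/-- Apart from the initial one, a state is a letter, a set `P`, and for each counter a family of
indices that differs from a part of the descendants by at most `3 ^ (m / 2)` members. -/
theorem card_states_le [Fintype α] (hA : ¬ Aborts A F.hi F.q₀) {m : ℕ}
    (hm : Fintype.card Q = m + 1) :
    (augAut A F.hi F.q₀).states.card ≤ 1 + Fintype.card α *
      2 ^ (6 * m + 1 + 2 ^ (m - 1) + (2 * m + 3) * m * 3 ^ (m / 2)) := by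
  let near : α → X → Finset (Finset (Finset (MState Q))) := fun a x =>
    Finset.univ.filter fun s => (s \ F.descendants x a).card ≤ 3 ^ (m / 2)
  have hnear : ∀ a, ∏ x, (near a x).card ≤
      2 ^ (5 * m + 2 ^ (m - 1) + (2 * m + 3) * m * 3 ^ (m / 2)) := by
    intro a
    -- There are `2 ^ (2 * (m + 1))` candidate indices; one more factor `2` absorbs the choice of
    -- nothing.
    have hbase : Fintype.card (Finset (MState Q)) + 1 ≤ 2 ^ (2 * m + 3) := by
      rw [Fintype.card_finset, Fintype.card_prod, Fintype.card_bool, hm,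
        show 2 * m + 3 = (m + 1) * 2 + 1 by ring, pow_succ]
      have : 1 ≤ 2 ^ ((m + 1) * 2) := Nat.one_le_two_pow
      omega
    have h1 : ∀ x ∈ (Finset.univ : Finset X), (near a x).card ≤
        2 ^ (F.descendants x a).card * 2 ^ ((2 * m + 3) * 3 ^ (m / 2)) := fun x _ => by
      refine (card_near_le _ _).trans (Nat.mul_le_mul_left _ ?_)
      rw [pow_mul]
      exact Nat.pow_le_pow_left hbase _
    refine (Finset.prod_le_prod' h1).trans ?_
    rw [Finset.prod_mul_distrib, Finset.prod_pow_eq_pow_sum, Finset.prod_const, ← pow_mul,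
      ← pow_add, Finset.card_univ]
    refine Nat.pow_le_pow_right (by norm_num) ?_
    have h2 := F.sum_card_descendants_le hA hm a
    have h3 : (2 * m + 3) * 3 ^ (m / 2) * Fintype.card X ≤ (2 * m + 3) * 3 ^ (m / 2) * m :=
      Nat.mul_le_mul_left _ (F.card_ctr_le hm)
    calc _ ≤ 5 * m + 2 ^ (m - 1) + (2 * m + 3) * 3 ^ (m / 2) * m := add_le_add h2 h3
      _ = _ := by ring
  have hcard := Finset.card_le_card_of_injOn
    (fun s : AugState X Q => (s.1, fun x => F.inner s.2 x))
    (s := (augAut A F.hi F.q₀).states)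
    (t := {({F.q₀}, fun x => F.inner (augInit X F.q₀) x)} ∪
      Finset.univ.biUnion fun a : α => (Finset.univ : Finset (Finset Q)) ×ˢ
        Fintype.piFinset (near a)) ?_ ?_
  · refine hcard.trans ((Finset.card_union_le _ _).trans ?_)
    rw [Finset.card_singleton]
    refine Nat.add_le_add_left (Finset.card_biUnion_le.trans ?_) 1
    refine (Finset.sum_le_card_nsmul _ _ _ fun a _ => ?_).trans (le_of_eq (by
      rw [Finset.card_univ, smul_eq_mul]))
    rw [Finset.card_product, Finset.card_univ, Fintype.card_finset, Fintype.card_piFinset, hm]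
    calc 2 ^ (m + 1) * ∏ x, (near a x).card
        ≤ 2 ^ (m + 1) * 2 ^ (5 * m + 2 ^ (m - 1) + (2 * m + 3) * m * 3 ^ (m / 2)) :=
          Nat.mul_le_mul_left _ (hnear a)
      _ = _ := by
          rw [← pow_add]
          congr 1
          ring
  · rintro ⟨P, Act⟩ hs
    replace hs := mem_augAut_states.1 (Finset.mem_coe.1 hs)
    rcases F.inner_inv hA hs with ⟨rfl, rfl⟩ | ⟨a, hP, hc⟩
    · exact Finset.mem_coe.2 (Finset.mem_union_left _ (Finset.mem_singleton_self _))
    · refine Finset.mem_coe.2 (Finset.mem_union_right _ (Finset.mem_biUnion.2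
        ⟨a, Finset.mem_univ _, Finset.mem_product.2 ⟨Finset.mem_univ _,
          Fintype.mem_piFinset.2 fun x => Finset.mem_filter.2 ⟨Finset.mem_univ _, ?_⟩⟩⟩))
      have h1 := hc x
      have h2 : (F.inner Act x \ F.descendants x a).card ≤ 3 ^ (F.labelled a).card :=
        (Finset.card_le_card Finset.sdiff_subset).trans (F.card_inner_le hA hs hP x)
      rw [hm] at h1
      -- The smaller of `|labelled a|` and its complement `m - |labelled a|` is at most `m / 2`, and
      -- a bound of non-descendants is available for either.
      by_cases hle : (F.labelled a).card ≤ m / 2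
      · exact h2.trans (Nat.pow_le_pow_right (by norm_num) hle)
      · exact h1.trans (Nat.pow_le_pow_right (by norm_num) (by omega))
  · rintro ⟨P, Act⟩ hs ⟨P', Act'⟩ hs' he
    replace hs := mem_augAut_states.1 (Finset.mem_coe.1 hs)
    replace hs' := mem_augAut_states.1 (Finset.mem_coe.1 hs')
    obtain ⟨h1, h2⟩ := Prod.mk.inj he
    obtain rfl : P = P' := h1
    rw [F.reach_ext hA hs hs' fun x => congrFun h2 x]

end FlatCA

end States

/-! ### The bounds -/

/-- Since `√3 < 7 / 4 < 2`, the left side is at most `36 * m ^ 2 * (7 / 8) ^ m * 2 ^ m`, which is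
eventually below `2 ^ m`; `c` handles the finitely many other `m`. -/
theorem exists_poly_mul_pow_le :
    ∃ c : ℕ, ∀ m : ℕ, 36 * (m ^ 2 * 3 ^ (m / 2)) ≤ 2 ^ m + c := by
  have hlim := tendsto_pow_const_mul_const_pow_of_abs_lt_one 2
    (show |(7 / 8 : ℝ)| < 1 by rw [abs_of_pos] <;> norm_num)
  obtain ⟨N, hN⟩ := Filter.eventually_atTop.1
    (hlim.eventually (gt_mem_nhds (show (0 : ℝ) < 1 / 36 by norm_num)))
  refine ⟨36 * (N ^ 2 * 3 ^ N), fun m => ?_⟩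
  rcases le_total N m with h | h
  · refine le_add_right ?_
    have h1 := hN m h
    have h2 : (3 : ℝ) ^ (m / 2) ≤ (7 / 4) ^ m := by
      calc (3 : ℝ) ^ (m / 2) ≤ ((7 / 4) ^ 2) ^ (m / 2) := by gcongr; norm_num
        _ = (7 / 4) ^ (2 * (m / 2)) := by rw [pow_mul]
        _ ≤ (7 / 4) ^ m := pow_le_pow_right₀ (by norm_num) (Nat.mul_div_le m 2)
    have h3 : (7 / 4 : ℝ) ^ m = (7 / 8) ^ m * 2 ^ m := by
      rw [← mul_pow]
      norm_num
    have h4 : (36 * ((m : ℝ) ^ 2 * 3 ^ (m / 2))) ≤ 2 ^ m := by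
      calc 36 * ((m : ℝ) ^ 2 * 3 ^ (m / 2)) ≤ 36 * ((m : ℝ) ^ 2 * (7 / 4) ^ m) := by gcongr
        _ = 36 * ((m : ℝ) ^ 2 * (7 / 8) ^ m) * 2 ^ m := by rw [h3]; ring
        _ ≤ 1 * 2 ^ m := by
            gcongr
            linarith
        _ = 2 ^ m := one_mul _
    exact_mod_cast h4
  · refine le_add_left ?_
    gcongr
    · norm_num
    · exact (Nat.div_le_self m 2).trans h

/-- Half of `2 ^ m` is spent on `2 ^ (m - 1)`; the other half must absorb the rest, whence `36 = 2 *
18` in the preceding estimate. -/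
theorem exists_size_exponent :
    ∃ c : ℕ, ∀ m : ℕ, 1 ≤ m →
      12 * m + 1 + 2 ^ (m - 1) + (2 * m + 3) * m * 3 ^ (m / 2) ≤ 2 ^ m + c := by
  obtain ⟨c, hc⟩ := exists_poly_mul_pow_le
  refine ⟨c, fun m hm => ?_⟩
  have h1 := hc m
  have h2 : 2 ^ m = 2 * 2 ^ (m - 1) := by
    rw [← pow_succ']
    congr 1
    omega
  have h3 : 1 ≤ 3 ^ (m / 2) := Nat.one_le_pow _ _ (by norm_num)
  generalize 3 ^ (m / 2) = K at *
  -- Each monomial is at most `m ^ 2 * K`, and the coefficients add up to `12 + 1 + 2 + 3 = 18`.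
  have h4 : 12 * m + 1 + (2 * m + 3) * m * K ≤ 18 * (m ^ 2 * K) := by
    have e1 : m ≤ m ^ 2 * K := by nlinarith
    have e2 : m * K ≤ m ^ 2 * K := Nat.mul_le_mul_right _ (by nlinarith)
    nlinarith
  omega

theorem Regex.card_pos {α : Type} [DecidableEq α] {M : Regex α} (hL : M.Linear) :
    Fintype.card M.Pos = M.chars := by
  rw [← Regex.card_letters hL]
  exact Fintype.card_coe M.letters

section Bounds

variable {α X Q : Type} [DecidableEq α] [DecidableEq X] [DecidableEq Q]
  [Fintype X] [Fintype Q] [Fintype α] {A : CA α X Q} (F : FlatCA A)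

namespace FlatCA

include F in
theorem card_shared_le {m : ℕ} (hm : Fintype.card Q = m + 1) :
    Fintype.card (Shared X Q) ≤ 4 * (4 ^ m * m) := by
  have e : Fintype.card (Shared X Q) = Fintype.card X * 4 ^ (m + 1) := by
    rw [Fintype.card_prod, Fintype.card_finset, Fintype.card_prod, Fintype.card_bool, hm, mul_comm _ 2,
      pow_mul]
    norm_num
  rw [e]
  calc Fintype.card X * 4 ^ (m + 1) ≤ m * 4 ^ (m + 1) :=
        Nat.mul_le_mul_right _ (F.card_ctr_le hm)
    _ = 4 * (4 ^ m * m) := by ring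

/-- The states contribute `6 * m + 1` and the two large terms to the exponent, guards and updates
another `5 * m`; together this stays below the exponent in `hc`. The constant `16512` is `128 *
129`. -/
theorem size_le_double_exp (hA : ¬ Aborts A F.hi F.q₀) {m c : ℕ} (hm : Fintype.card Q = m + 1)
    (h1 : 1 ≤ m)
    (hc : 12 * m + 1 + 2 ^ (m - 1) + (2 * m + 3) * m * 3 ^ (m / 2) ≤ 2 ^ m + c) :
    (augAut A F.hi F.q₀).size (setLang _) ≤
      (1 + Fintype.card α) ^ 2 * 16512 * 2 ^ c * (2 ^ 2 ^ m * m) := by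
  refine (F.size_le hA hm).trans ?_
  set k := Fintype.card α
  set e := 2 ^ (m - 1) + (2 * m + 3) * m * 3 ^ (m / 2)
  have hstates : (augAut A F.hi F.q₀).states.card ≤ (1 + k) * 2 ^ (6 * m + 1 + e) := by
    refine (F.card_states_le hA hm).trans ?_
    rw [add_assoc (6 * m + 1), add_mul 1 k, one_mul]
    exact Nat.add_le_add_right Nat.one_le_two_pow _
  have hY := F.card_shared_le hm
  have hK : 1 ≤ 4 ^ m := Nat.one_le_pow _ _ (by norm_num)
  have hm2 : m ≤ 2 ^ m := Nat.lt_two_pow_self.le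
  have hrest : 1 + k * (64 * ((m + 1) * 4 ^ m) * (1 + 32 * Fintype.card (Shared X Q))) ≤
      (1 + k) * (16512 * (2 ^ (5 * m) * m)) := by
    have hKm : 1 ≤ 4 ^ m * m := Nat.mul_pos hK h1
    have e1 : 1 + 32 * Fintype.card (Shared X Q) ≤ 129 * (4 ^ m * m) := by omega
    have e2 : 64 * ((m + 1) * 4 ^ m) ≤ 128 * (4 ^ m * m) := by nlinarith
    have e3 : 64 * ((m + 1) * 4 ^ m) * (1 + 32 * Fintype.card (Shared X Q)) ≤
        16512 * (2 ^ (5 * m) * m) := by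
      calc _ ≤ 128 * (4 ^ m * m) * (129 * (4 ^ m * m)) := Nat.mul_le_mul e2 e1
        _ = 16512 * (4 ^ m * 4 ^ m * m * m) := by ring
        _ ≤ 16512 * (4 ^ m * 4 ^ m * 2 ^ m * m) := by gcongr
        _ = 16512 * (2 ^ (5 * m) * m) := by
            rw [show (4 : ℕ) = 2 ^ 2 by norm_num, ← pow_mul, ← pow_add, ← pow_add]
            congr 3
            ring
    have e4 : 1 ≤ 16512 * (2 ^ (5 * m) * m) :=
      Nat.mul_pos (by norm_num) (Nat.mul_pos (by positivity) h1)
    calc _ ≤ 16512 * (2 ^ (5 * m) * m) + k * (16512 * (2 ^ (5 * m) * m)) :=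
          add_le_add e4 (Nat.mul_le_mul_left _ e3)
      _ = _ := by ring
  calc _ ≤ (1 + k) * 2 ^ (6 * m + 1 + e) * ((1 + k) * (16512 * (2 ^ (5 * m) * m))) :=
        Nat.mul_le_mul hstates hrest
    _ = (1 + k) ^ 2 * 16512 * (2 ^ (6 * m + 1 + e + 5 * m) * m) := by
        rw [pow_add 2 (6 * m + 1 + e)]
        ring
    _ ≤ (1 + k) ^ 2 * 16512 * (2 ^ (2 ^ m + c) * m) := by
        refine Nat.mul_le_mul_left _ (Nat.mul_le_mul_right _
          (Nat.pow_le_pow_right (by norm_num) ?_))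
        rw [add_assoc (12 * m + 1)] at hc
        omega
    _ = (1 + k) ^ 2 * 16512 * 2 ^ c * (2 ^ 2 ^ m * m) := by
        rw [pow_add]
        ring

/-- The initial configuration. -/
def initConf (X : Type) {Q : Type} [DecidableEq X] [DecidableEq Q] [Fintype X] (q₀ : Q) :
    AugState X Q × (Shared X Q → Set ℕ) :=
  (({q₀}, augInit X q₀), fun z => if z ∈ augInit X q₀ then {0} else ∅)

/-- Initially every list has height at most `1`, so the starting potential is at most the number of
registers, in addition to the same number of steps for initialisation. -/
theorem simulate_spec (hA : ¬ Aborts A F.hi F.q₀) {m : ℕ} (hm : Fintype.card Q = m + 1)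
    (w : List α) :
    ((simulate (augAut A F.hi F.q₀) (initConf X F.q₀) w).val = true ↔
      w ∈ (augAut A F.hi F.q₀).lang (setLang _)) ∧
    (simulate (augAut A F.hi F.q₀) (initConf X F.q₀) w).time ≤
      2 * Fintype.card (Shared X Q) + 1 +
        w.length * (1 + 64 * ((m + 1) * 4 ^ m) + 32 * Fintype.card (Shared X Q)) +
        64 * ((m + 1) * 4 ^ m) := by
  set B := augAut A F.hi F.q₀
  set c₀ := initConf X F.q₀
  have hset : ∀ y, c₀.2 y = ∅ ∨ c₀.2 y = {0} := by
    intro y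
    by_cases hy : y ∈ augInit X F.q₀
    · exact Or.inr (if_pos hy)
    · exact Or.inl (if_neg hy)
  obtain ⟨h1, h2⟩ := simulateFrom_spec (A := B) (deterministic _ _) (F.nonReplicating hA)
    (F.ltOnly hA)
    (fun δ hδ => by
      obtain ⟨P, Act, a, Γ, h, hΓ, hs, rfl⟩ := mem_augAut_trans.1 hδ
      exact mem_augAut_states.2 (reach_next h hΓ hs))
    (F.sum_guard_le hA hm) (fun s hs => F.size_final_le hA hm hs)
    (fun δ hδ => F.sum_updateCost_le hA hδ) w c₀.1 (fun y => OList.ofSet (c₀.2 y))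
    (mem_augAut_states.2 .init) fun y => (OList.ofSet_spec (hset y)).1
  have hmem : (fun y => (OList.ofSet (c₀.2 y)).toSet) = c₀.2 :=
    funext fun y => (OList.ofSet_spec (hset y)).2.1
  have hpot : potential (fun y => OList.ofSet (c₀.2 y)) ≤ Fintype.card (Shared X Q) := by
    refine (Finset.sum_le_card_nsmul _ _ 1 fun y _ => (OList.ofSet_spec (hset y)).2.2).trans ?_
    simp
  rw [hmem] at h1
  refine ⟨?_, ?_⟩
  · simp only [simulate, Timed.bind_val]
    rw [h1]
    constructor
    · rintro ⟨c', hr, hs⟩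
      exact ⟨c₀, rfl, c', hr, hs⟩
    · rintro ⟨c, rfl, c', hr, hs⟩
      exact ⟨c', hr, hs⟩
  · simp only [simulate, Timed.bind_time, spend_time]
    omega

/-- With `K = 4 ^ m * m`, each letter costs at most `257 * K` and the start and end together at most
`137 * K`; for a nonempty word the sum is at most `394 * K * n`. -/
theorem simulate_time_le (hA : ¬ Aborts A F.hi F.q₀) {m : ℕ} (hm : Fintype.card Q = m + 1)
    {w : List α} (h1 : 1 ≤ m) (hw : 1 ≤ w.length) :
    (simulate (augAut A F.hi F.q₀) (initConf X F.q₀) w).time ≤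
      394 * (2 ^ (2 * m) * m * w.length) := by
  refine (F.simulate_spec hA hm w).2.trans ?_
  have hY := F.card_shared_le hm
  have hK : 1 ≤ 4 ^ m := Nat.one_le_pow _ _ (by norm_num)
  rw [pow_mul, show 2 ^ 2 = 4 by norm_num]
  have hKm : 1 ≤ 4 ^ m * m := Nat.mul_pos hK h1
  have e2 : 64 * ((m + 1) * 4 ^ m) ≤ 128 * (4 ^ m * m) := by nlinarith
  generalize w.length = n at hw
  generalize Fintype.card (Shared X Q) = Y at hY
  generalize 64 * ((m + 1) * 4 ^ m) = G at e2
  generalize 4 ^ m * m = K at *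
  have e3 : n * (1 + G + 32 * Y) ≤ n * (257 * K) := Nat.mul_le_mul_left _ (by omega)
  have e4 : 2 * Y + 1 + G ≤ 137 * K * n := by nlinarith
  nlinarith

end FlatCA

end Bounds

end CountReg

/-- The constant `C` depends on the finite alphabet only; `m = ♯R` and `n` is the length of `w`. -/
theorem mainTheorem3 {α : Type} [Fintype α] [DecidableEq α] :
    ∃ C : ℕ, ∀ R : Regex α, R.Flat →
      ∀ B : CSA α (Shared R.marked.Ctr (Option R.marked.Pos))
          (AugState R.marked.Ctr (Option R.marked.Pos)),
        R.csa = some B →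
        NonReplicating B ∧
        (1 ≤ R.chars → B.size (setLang _) ≤ C * (2 ^ 2 ^ R.chars * R.chars)) ∧
        B.lang (setLang _) = R.ca.lang (natLang _) ∧
        ∃ c₀, B.init = {c₀} ∧ ∀ w : List α,
          ((simulate B c₀ w).val = true ↔ w ∈ B.lang (setLang _)) ∧
          (1 ≤ R.chars → 1 ≤ w.length →
            (simulate B c₀ w).time ≤ C * (2 ^ (2 * R.chars) * R.chars * w.length)) := by
  obtain ⟨c, hc⟩ := exists_size_exponent
  -- One constant for both bounds: the factor for the size plus the factor for the time.
  refine ⟨(1 + Fintype.card α) ^ 2 * 16512 * 2 ^ c + 394, fun R hR B hB => ?_⟩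
  have hL : R.marked.Linear := Regex.linear_mark R.norm 0
  have hF : R.marked.Flat := Regex.flat_mark R.norm (Regex.flat_norm R hR) 0
  have hC : R.marked.CountPos := Regex.countPos_mark R.norm (Regex.countPos_norm R) 0
  let F : FlatCA R.ca := Regex.glushkovFlat hF hL hC
  have hcard : Fintype.card (Option R.marked.Pos) = R.chars + 1 := by
    rw [Fintype.card_option, Regex.card_pos hL, Regex.marked, Regex.chars_mark, Regex.chars_norm]
  obtain ⟨hA, rfl⟩ := augDet_eq_some hB
  refine ⟨F.nonReplicating hA, fun hm => ?_, F.lang_eq hA, _, rfl, fun w => ⟨?_, fun hm hw => ?_⟩⟩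
  · exact (F.size_le_double_exp hA hcard hm (hc _ hm)).trans
      (Nat.mul_le_mul_right _ (Nat.le_add_right _ _))
  · exact (F.simulate_spec hA hcard w).1
  · exact (F.simulate_time_le hA hcard hm hw).trans (Nat.mul_le_mul_right _ (Nat.le_add_left _ _))
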